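/- Let $K$ be an algebraically closed field. For a finite acyclic quiver $Q$, call a $K$-algebra $B$ *silted of type $Q$* if $B\cong \mathrm{End}_{K^b(\mathrm{proj}\,KQ)}(P)$ for some basic 2-term silting complex $P$ over the path algebra $KQ$, and *tilted of type $Q$* if $B\cong\mathrm{End}_{KQ}(T)$ for some tilting $KQ$-module $T$ (that is, $T$ is a finite-dimensional module with $\mathrm{pd}\,T\le 1$, $\mathrm{Ext}^1(T,T)=0$ and $|T|=|KQ|$, where $|M|$ is the number of isomorphism classes of indecomposable direct summands of $M$). For a finite forest $G$, call $B$ *tilted of type $G$* if it is tilted of type $Q$ for some orientation $Q$ of $G$. Algebras are considered up to isomorphism of $K$-algebras. Consider the following algebras: (1) the path algebra of $\circ\to\circ\to\circ$; (2) the path algebra of $\circ\to\circ\leftarrow\circ$; (3) the path algebra of $\circ\leftarrow\circ\to\circ$; (4) the quotient of the path algebra of $\circ\to\circ\to\circ$ by the ideal generated by the path of length two; (5) the path algebra of $\circ\to\circ\quad\circ$; (6) the path algebra of $\circ\quad\circ\quad\circ$ (three vertices, no arrows). These algebras are pairwise non-isomorphic, and: (a) The silted algebras of type $1\to 2\to 3$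 are, up to isomorphism, exactly the five algebras (1)–(5). Among these, exactly the four algebras (1)–(4) are tilted of type $\mathbb A_3$, and exactly (5) is tilted of type $\mathbb A_2\amalg\mathbb A_1$. (b) The silted algebras of type $1\to 3\leftarrow 2$ are, up to isomorphism, exactly the six algebras (1)–(6). Among these, exactly the four algebras (1)–(4) are tilted of type $\mathbb A_3$, exactly (5) is tilted of type $\mathbb A_2\amalg\mathbb A_1$, and exactly (6) is tilted of type $\mathbb A_1\amalg\mathbb A_1\amalg\mathbb A_1$. In particular, all of these silted algebras are tilted. -/

import Mathlib

universe u v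

namespace Silted

open CategoryTheory CategoryTheory.Limits

/-! ### Path algebras -/

/-- A path in a quiver, together with its source and its target. -/
structure QPath (V : Type) [Quiver.{0} V] : Type where
  src : V
  tgt : V
  path : Quiver.Path src tgt

/-- The path algebra `KV` of a quiver `V`: the `K`-vector space with basis the set of all paths. -/
def PathAlgebra (K : Type u) [Field K] (V : Type) [Quiver.{0} V] : Type u := QPath V →₀ K

namespace PathAlgebra

section

variable (K : Type u) [Field K] (V : Type) [Quiver.{0} V]

noncomputable instance : AddCommGroup (PathAlgebra K V) :=
  inferInstanceAs (AddCommGroup (QPath V →₀ K))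

noncomputable instance : Module K (PathAlgebra K V) :=
  inferInstanceAs (Module K (QPath V →₀ K))

end

section

variable (K : Type u) [Field K] {V : Type} [Quiver.{0} V]

/-- The basis element given by a path. -/
noncomputable def ofPath (p : QPath V) : PathAlgebra K V :=
  (Finsupp.single p 1 : QPath V →₀ K)

/-- The product of two paths: the concatenation "first `p`, then `q`" if `p` ends where `q`
starts, and zero otherwise. -/
noncomputable def concat [DecidableEq V] (p q : QPath V) : PathAlgebra K V :=
  if h : p.tgt = q.src then ofPath K ⟨p.src, q.tgt, p.path.comp (q.path.cast h.symm rfl)⟩ else 0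

/-- The bilinear extension of the product of paths. -/
noncomputable def mulHom [DecidableEq V] :
    PathAlgebra K V →ₗ[K] PathAlgebra K V →ₗ[K] PathAlgebra K V :=
  Finsupp.linearCombination K (M := PathAlgebra K V →ₗ[K] PathAlgebra K V)
    fun p : QPath V => Finsupp.linearCombination K (M := PathAlgebra K V) (concat K p)

theorem mulHom_ofPath [DecidableEq V] (p q : QPath V) :
    mulHom K (ofPath K p) (ofPath K q) = concat K p q := by
  have h1 : mulHom K (ofPath K p) =
      Finsupp.linearCombination K (M := PathAlgebra K V) (concat K p) := by
    unfold mulHom ofPath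
    exact (Finsupp.linearCombination_single K (1 : K) p).trans (one_smul K _)
  rw [h1]
  exact (Finsupp.linearCombination_single K (1 : K) q).trans (one_smul K _)

/-- Linear maps out of the path algebra that agree on all paths are equal. -/
theorem hom_ext {M : Type*} [AddCommMonoid M] [Module K M] {f g : PathAlgebra K V →ₗ[K] M}
    (h : ∀ p, f (ofPath K p) = g (ofPath K p)) : f = g :=
  Finsupp.lhom_ext' fun p => LinearMap.ext_ring (h p)

theorem concat_assoc [DecidableEq V] (p q r : QPath V) :
    mulHom K (concat K p q) (ofPath K r) = mulHom K (ofPath K p) (concat K q r) := by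
  obtain ⟨a, b, p⟩ := p
  obtain ⟨b', c, q⟩ := q
  obtain ⟨c', d, r⟩ := r
  by_cases h : b = b'
  · subst h
    by_cases h' : c = c'
    · subst h'
      simp [concat, mulHom_ofPath, Quiver.Path.comp_assoc]
    · simp [concat, mulHom_ofPath, h']
  · by_cases h' : c = c'
    · subst h'
      simp [concat, mulHom_ofPath, h]
    · simp [concat, h, h']

theorem mulHom_assoc [DecidableEq V] (x y z : PathAlgebra K V) :
    mulHom K (mulHom K x y) z = mulHom K x (mulHom K y z) := by
  have h1 : ∀ p q : QPath V, mulHom K (mulHom K (ofPath K p) (ofPath K q)) =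
      (mulHom K (ofPath K p)).comp (mulHom K (ofPath K q)) := fun p q => hom_ext K fun r => by
    simpa only [LinearMap.comp_apply, mulHom_ofPath] using concat_assoc K p q r
  have h2 : ∀ p : QPath V, ((mulHom K (V := V)).flip z).comp (mulHom K (ofPath K p)) =
      (mulHom K (ofPath K p)).comp ((mulHom K (V := V)).flip z) := fun p => hom_ext K fun q =>
    LinearMap.congr_fun (h1 p q) z
  have h3 : ((mulHom K (V := V)).flip z).comp ((mulHom K (V := V)).flip y) =
      (mulHom K (V := V)).flip (mulHom K y z) := hom_ext K fun p => LinearMap.congr_fun (h2 p) y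
  exact LinearMap.congr_fun h3 x

/-- The sum of the trivial paths. -/
noncomputable def oneElt (V : Type) [Quiver.{0} V] [Fintype V] : PathAlgebra K V :=
  ∑ a : V, ofPath K ⟨a, a, Quiver.Path.nil⟩

theorem one_mulHom [Fintype V] [DecidableEq V] (x : PathAlgebra K V) :
    mulHom K (oneElt K V) x = x := by
  have h : mulHom K (oneElt K V) = LinearMap.id := hom_ext K fun p => by
    obtain ⟨a, b, p⟩ := p
    rw [oneElt, map_sum, LinearMap.sum_apply, Finset.sum_eq_single a]
    · simp [mulHom_ofPath, concat]
    · intro c _ hc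
      simp [mulHom_ofPath, concat, hc]
    · simp
  exact LinearMap.congr_fun h x

theorem mulHom_one [Fintype V] [DecidableEq V] (x : PathAlgebra K V) :
    mulHom K x (oneElt K V) = x := by
  have h : (mulHom K (V := V)).flip (oneElt K V) = LinearMap.id := hom_ext K fun p => by
    obtain ⟨a, b, p⟩ := p
    rw [oneElt, map_sum, LinearMap.sum_apply, Finset.sum_eq_single b]
    · simp [mulHom_ofPath, concat]
    · intro c _ hc
      simp [mulHom_ofPath, concat, Ne.symm hc]
    · simp
  exact LinearMap.congr_fun h x

noncomputable instance [Fintype V] [DecidableEq V] : Ring (PathAlgebra K V) where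
  __ := (inferInstance : AddCommGroup (PathAlgebra K V))
  mul x y := mulHom K x y
  one := oneElt K V
  left_distrib x y z := map_add (mulHom K x) y z
  right_distrib x y z := LinearMap.map_add₂ (mulHom K) x y z
  zero_mul x := LinearMap.map_zero₂ (mulHom K) x
  mul_zero x := map_zero (mulHom K x)
  mul_assoc := mulHom_assoc K
  one_mul := one_mulHom K
  mul_one := mulHom_one K

noncomputable instance [Fintype V] [DecidableEq V] : Algebra K (PathAlgebra K V) :=
  Algebra.ofModule (fun r x y => LinearMap.map_smul₂ (mulHom K) r x y)
    (fun r x y => map_smul (mulHom K x) r y)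

/-- The defining property of the multiplication of the path algebra. -/
theorem ofPath_mul_ofPath [Fintype V] [DecidableEq V] (p q : QPath V) :
    ofPath K p * ofPath K q = concat K p q :=
  mulHom_ofPath K p q

end

end PathAlgebra

/-- The bound quiver algebra `KV / ⟨R⟩`, the quotient of the path algebra by the two-sided ideal
generated by a set `R` of paths. -/
abbrev BoundPathAlgebra (K : Type u) [Field K] (V : Type) [Quiver.{0} V] [Fintype V]
    [DecidableEq V] (R : Set (QPath V)) : Type u :=
  RingQuot fun x y : PathAlgebra K V => (∃ p ∈ R, x = PathAlgebra.ofPath K p) ∧ y = 0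

/-! ### Quivers without multiple arrows, and their underlying graphs -/

/-- The quiver with vertex set `V` that has exactly one arrow `a → b` if `r a b` holds, and no
arrow from `a` to `b` otherwise. -/
def RelQuiver {V : Type} (_r : V → V → Prop) : Type := V

section

variable {V : Type} (r : V → V → Prop)

instance : Quiver.{0} (RelQuiver r) := ⟨fun a b : V => PLift (r a b)⟩

instance [Fintype V] : Fintype (RelQuiver r) := inferInstanceAs (Fintype V)

instance [DecidableEq V] : DecidableEq (RelQuiver r) := inferInstanceAs (DecidableEq V)

end

/-- The quiver `RelQuiver r` is an orientation of the graph `G`: each edge of `G` becomes an arrow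
in exactly one of the two directions, and there are no other arrows. -/
def IsOrientation {V : Type} (G : SimpleGraph V) (r : V → V → Prop) : Prop :=
  (∀ a b, G.Adj a b ↔ (r a b ∨ r b a)) ∧ ∀ a b, r a b → ¬ r b a

/-- The quiver `0 → 1 → 2`. -/
abbrev linearA3 : Fin 3 → Fin 3 → Prop := fun a b => (a = 0 ∧ b = 1) ∨ (a = 1 ∧ b = 2)

/-- The quiver `0 → 2 ← 1`. -/
abbrev sinkA3 : Fin 3 → Fin 3 → Prop := fun a b => (a = 0 ∧ b = 2) ∨ (a = 1 ∧ b = 2)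

/-- The quiver `0 ← 2 → 1`. -/
abbrev sourceA3 : Fin 3 → Fin 3 → Prop := fun a b => (a = 2 ∧ b = 0) ∨ (a = 2 ∧ b = 1)

/-- The quiver `0 → 1   2`. -/
abbrev arrowAndPoint : Fin 3 → Fin 3 → Prop := fun a b => a = 0 ∧ b = 1

/-- The quiver with three vertices and no arrows. -/
abbrev threePoints : Fin 3 → Fin 3 → Prop := fun _ _ => False

/-- The graph `𝔸₃`. -/
abbrev graphA3 : SimpleGraph (Fin 3) := SimpleGraph.pathGraph 3

/-- The graph `𝔸₂ ⨿ 𝔸₁`. -/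
abbrev graphA2A1 : SimpleGraph (Fin 2 ⊕ Fin 1) :=
  (SimpleGraph.pathGraph 2).sum (SimpleGraph.pathGraph 1)

/-- The graph `𝔸₁ ⨿ 𝔸₁ ⨿ 𝔸₁`. -/
abbrev graphA1A1A1 : SimpleGraph ((Fin 1 ⊕ Fin 1) ⊕ Fin 1) :=
  ((SimpleGraph.pathGraph 1).sum (SimpleGraph.pathGraph 1)).sum (SimpleGraph.pathGraph 1)

section

variable (K : Type u) [Field K]

/-! ### Tilting modules and tilted algebras

Right modules over a `K`-algebra `A` are (left) modules over `Aᵐᵒᵖ`.  The product in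
`CategoryTheory.End` is the composition of maps, `(f * g) x = f (g x)`. -/

/-- The category of right modules over a ring. -/
abbrev RightMod (A : Type u) [Ring A] : Type (u + 1) := ModuleCat.{u} Aᵐᵒᵖ

/-- `|M| = n`: the object `M` is a finite direct sum of indecomposable objects, which belong to
exactly `n` isomorphism classes. Here `X i` occurs with multiplicity `m i`. -/
def HasNumSummands {C : Type*} [Category C] [Preadditive C] [HasFiniteBiproducts C]
    [HasBinaryBiproducts C] (M : C) (n : ℕ) : Prop :=
  ∃ (X : Fin n → C) (m : Fin n → ℕ),
    (∀ i, Indecomposable (X i)) ∧ (∀ i j, i ≠ j → IsEmpty (X i ≅ X j)) ∧ (∀ i, 0 < m i) ∧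
      Nonempty (M ≅ ⨁ fun k : (Σ i, Fin (m i)) => X k.1)

/-- A (classical) tilting right module over a finite-dimensional algebra `A`: a finite-dimensional
module `T` with `pd T ≤ 1`, `Ext¹(T, T) = 0` and `|T| = |A|`. -/
structure IsTilting {A : Type u} [Ring A] (T : RightMod A) : Prop where
  finite : Module.Finite Aᵐᵒᵖ T
  pd_le_one : HasProjectiveDimensionLE T 1
  ext_one : Subsingleton (Abelian.Ext T T 1)
  card : ∃ n, HasNumSummands T n ∧ HasNumSummands (ModuleCat.of Aᵐᵒᵖ A) n

/-- The algebra `B` is tilted of type `V`, where `V` is a finite acyclic quiver: it is the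
endomorphism algebra of a tilting module over the path algebra of `V`. -/
def IsTilted (V : Type) [Quiver.{0} V] [Fintype V] [DecidableEq V]
    (B : Type v) [Ring B] [Algebra K B] : Prop :=
  ∃ T : RightMod (PathAlgebra K V), IsTilting T ∧ Nonempty (B ≃ₐ[K] End T)

/-- The algebra `B` is tilted of type `G`, where `G` is a finite forest: it is tilted of type
`V` for some quiver `V` with underlying graph `G`. -/
def IsTiltedOfGraph {V : Type} [Fintype V] [DecidableEq V] (G : SimpleGraph V)
    (B : Type v) [Ring B] [Algebra K B] : Prop :=
  ∃ r : V → V → Prop, IsOrientation G r ∧ IsTilted K (RelQuiver r) B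

/-! ### 2-term silting complexes and silted algebras -/

/-- The homotopy category of cochain complexes of right `A`-modules. It contains
`K^b(proj A)` as a full triangulated subcategory. -/
abbrev HoCat (A : Type u) [Ring A] : Type (u + 1) :=
  HomotopyCategory (RightMod A) (ComplexShape.up ℤ)

/-- The image of a complex in the homotopy category. -/
abbrev toHo {A : Type u} [Ring A] (P : CochainComplex (RightMod A) ℤ) : HoCat A :=
  (HomotopyCategory.quotient (RightMod A) (ComplexShape.up ℤ)).obj P

/-- `P` is a bounded complex of finitely generated projective right `A`-modules, that is, an object
of `K^b(proj A)`. -/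
structure IsPerfect {A : Type u} [Ring A] (P : CochainComplex (RightMod A) ℤ) : Prop where
  finite : ∀ i, Module.Finite Aᵐᵒᵖ (P.X i)
  projective : ∀ i, Module.Projective Aᵐᵒᵖ (P.X i)
  bounded : ∃ N : ℕ, ∀ i : ℤ, N < |i| → IsZero (P.X i)

/-- `P` is a silting complex: `Hom(P, P[i]) = 0` for `i > 0`, and `P` generates `K^b(proj A)`,
i.e. every triangulated subcategory closed under direct summands that contains `P` contains all of
`K^b(proj A)`. -/
structure IsSilting {A : Type u} [Ring A] (P : CochainComplex (RightMod A) ℤ) : Prop where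
  perfect : IsPerfect P
  presilting : ∀ i : ℤ, 0 < i → ∀ f : toHo P ⟶ (toHo P)⟦i⟧, f = 0
  generates : ∀ S : ObjectProperty (HoCat A), S.IsTriangulated → S.IsStableUnderRetracts →
    S (toHo P) → ∀ Q : CochainComplex (RightMod A) ℤ, IsPerfect Q → S (toHo Q)

/-- `P` is 2-term: it is concentrated in the degrees `-1` and `0`. -/
def IsTwoTerm {A : Type u} [Ring A] (P : CochainComplex (RightMod A) ℤ) : Prop :=
  ∀ i : ℤ, i ≠ -1 → i ≠ 0 → IsZero (P.X i)

/-- An object is basic if no nonzero object occurs twice in it as a direct summand. In a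
Krull-Schmidt category this says that it is a direct sum of pairwise non-isomorphic
indecomposables. -/
def IsBasic {C : Type*} [Category C] [Preadditive C] [HasBinaryBiproducts C] (T : C) : Prop :=
  ∀ X Y : C, Nonempty (T ≅ (X ⊞ X) ⊞ Y) → IsZero X

/-- The algebra `B` is (basic) silted of type `V`, where `V` is a finite acyclic quiver: it is the
endomorphism algebra, in `K^b(proj A)`, of a basic 2-term silting complex over the path algebra
`A` of `V`. -/
def IsSilted (V : Type) [Quiver.{0} V] [Fintype V] [DecidableEq V]
    (B : Type v) [Ring B] [Algebra K B] : Prop :=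
  ∃ P : CochainComplex (RightMod (PathAlgebra K V)) ℤ,
    IsSilting P ∧ IsTwoTerm P ∧ IsBasic (toHo P) ∧ Nonempty (B ≃ₐ[K] End (toHo P))

/-! ### The algebras in the two lists -/

/-- The algebra of the quiver `0 → 1 → 2` in which the path of length two is zero. -/
abbrev RelA3 : Type u :=
  BoundPathAlgebra K (RelQuiver linearA3) {p | p.path.length = 2}

/-- Five algebras: the path algebras of the three quivers of type `𝔸₃`, the quiver `0 → 1 → 2` with
zero relation, and the path algebra of `0 → 1   2`. -/
noncomputable def listLinear : Fin 5 → AlgCat.{u} K :=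
  ![AlgCat.of K (PathAlgebra K (RelQuiver linearA3)),
    AlgCat.of K (PathAlgebra K (RelQuiver sinkA3)),
    AlgCat.of K (PathAlgebra K (RelQuiver sourceA3)),
    AlgCat.of K (RelA3 K),
    AlgCat.of K (PathAlgebra K (RelQuiver arrowAndPoint))]

/-- The five algebras above, and the path algebra of three points without arrows. -/
noncomputable def listSink : Fin 6 → AlgCat.{u} K :=
  ![AlgCat.of K (PathAlgebra K (RelQuiver linearA3)),
    AlgCat.of K (PathAlgebra K (RelQuiver sinkA3)),
    AlgCat.of K (PathAlgebra K (RelQuiver sourceA3)),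
    AlgCat.of K (RelA3 K),
    AlgCat.of K (PathAlgebra K (RelQuiver arrowAndPoint)),
    AlgCat.of K (PathAlgebra K (RelQuiver threePoints))]

end

end Silted

-- All algebras involved have a basis of matrix units: elements `el i j`, one for each pair of a
-- relation on the vertices, where `el i j * el j k` is `el i k`, or zero if that pair does not
-- belong to the relation (`RelBasis`). The relation determines the algebra up to isomorphism
-- (`RelBasis.nonempty_algEquiv`), and the six algebras of the statement have the relations `listRel
-- k`. An endomorphism algebra is therefore identified by a table of Hom spaces of dimension at most
-- one between the summands, with compatible generators (`HomTable.nonempty_relBasis`); what remains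
-- is finite combinatorics. The six algebras are pairwise non-isomorphic because their dimensions
-- are 6, 5, 5, 5, 4, 3, and the three of dimension 5 differ in whether all arrows share a source or
-- a target (`eq_of_relBasis`).
--
-- Silted algebras. Let P i be the indecomposable projective modules over the path algebra. Up to
-- contractible summands, every two-term complex is a direct sum of nine complexes: the minimal
-- presentations of the six indecomposable modules, and the three shifted projectives. Each has the
-- form P j → P i, with zero terms allowed, except for P 2 → P 0 ⊕ P 1, which presents the module
-- with full support over 0 → 2 ← 1. The decomposition is obtained by hand: a nonzero module has one
-- of the six indecomposables as a retract, detected by a suitable path that acts nontrivially; the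
-- retraction lifts to presentations, and induction on the length finishes
-- (`exists_decomp_of_retract`). So a basic two-term silting complex is a subset of nine objects.
-- Its members have no morphisms to each other's shifts, which is read off from a table. Generation
-- enters through one obstruction: the objects without morphisms to the shifts of a fixed nonzero
-- thin module (dimension at most one at each vertex) form a proper thick subcategory
-- (`RelBasis.false_of_isOrth`). Checking all subsets of the nine objects leaves 14 candidates for
-- either quiver (`orth_or_exists_clusterLinear`, `orth_or_exists_clusterSink`), whose endomorphism
-- algebras are in the list. Conversely, one silting triple is exhibited for each algebra
-- (`isSilted_of_triple`); it generates because the triangles through its members reach all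
-- projectives.
--
-- Tilted algebras. A path algebra is the endomorphism algebra of its regular module, and the
-- algebra with zero relation is that of P 2 ⊕ P 0 ⊕ S 0 over 0 → 1 → 2. For the exclusions, let T
-- be a tilting module over a path algebra. As Ext¹(T, T) = 0, the dimensions of Hom between the
-- summands are the values of the Euler form at their dimension vectors
-- (`PathAlgebra.finrank_hom_add`). After symmetrization the determinant attached to the algebra is
-- a square times the determinant of the graph (`exists_det_gram_eq`). These determinants are 4, 4,
-- 4, 4, 6, 8 for the algebras and 4, 6, 8 for the graphs, and no two distinct ones differ by the
-- square of an integer.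

universe w

namespace Silted
open CategoryTheory CategoryTheory.Limits

/-! ### Algebras with a basis of matrix units indexed by a relation -/

/-- A basis of `B` consisting of elements `el i j`, one for each pair with `R i j`, which multiply
like matrix units; the product `el i j * el j k` is zero if `R i k` fails. -/
structure RelBasis (K : Type u) [Field K] {V : Type} (R : V → V → Prop) (B : Type v) [Ring B]
    [Algebra K B] where
  el : V → V → B
  basis : Module.Basis {p : V × V // R p.1 p.2} K B
  basis_apply : ∀ p, basis p = el p.1.1 p.1.2
  el_eq_zero : ∀ i j, ¬ R i j → el i j = 0
  mul_of_ne : ∀ i j k l, j ≠ k → el i j * el k l = 0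
  mul_of_rel : ∀ i j k, R i j → R j k → el i j * el j k = el i k

namespace RelBasis

variable {K : Type u} [Field K] {V : Type} {R : V → V → Prop} {B : Type v} [Ring B] [Algebra K B]

theorem el_ne_zero (b : RelBasis K R B) {i j : V} (h : R i j) : b.el i j ≠ 0 := by
  rw [← b.basis_apply ⟨(i, j), h⟩]
  exact b.basis.ne_zero _

open scoped Classical in
/-- The coefficient of `el i j`. -/
noncomputable def coef (b : RelBasis K R B) (i j : V) : B →ₗ[K] K :=
  if h : R i j then b.basis.coord ⟨(i, j), h⟩ else 0

theorem hom_ext (b : RelBasis K R B) {M : Type*} [AddCommMonoid M] [Module K M]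
    {f g : B →ₗ[K] M} (h : ∀ i j, R i j → f (b.el i j) = g (b.el i j)) : f = g :=
  b.basis.ext fun p => by rw [b.basis_apply]; exact h _ _ p.2

theorem coef_of_not (b : RelBasis K R B) {i j : V} (h : ¬ R i j) : b.coef i j = 0 := dif_neg h

open scoped Classical in
theorem coef_el (b : RelBasis K R B) (i j k l : V) (h : R k l) :
    b.coef i j (b.el k l) = if i = k ∧ j = l then 1 else 0 := by
  unfold coef
  rw [← b.basis_apply ⟨(k, l), h⟩]
  split_ifs with h1 h2 h2
  · obtain ⟨rfl, rfl⟩ := h2; simp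
  · rw [Module.Basis.coord_apply, Module.Basis.repr_self, Finsupp.single_apply, if_neg]
    intro h3
    simp only [Subtype.mk.injEq, Prod.mk.injEq] at h3
    exact h2 ⟨h3.1.symm, h3.2.symm⟩
  · obtain ⟨rfl, rfl⟩ := h2; exact absurd h h1
  · rfl

theorem sum_coef [Fintype V] (b : RelBasis K R B) (x : B) :
    x = ∑ i, ∑ j, b.coef i j x • b.el i j := by
  classical
  have : LinearMap.id = ∑ i, ∑ j, (b.coef i j).smulRight (b.el i j) := b.hom_ext fun i j h => by
    simp only [LinearMap.id_coe, id_eq, LinearMap.coe_sum, Finset.sum_apply,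
      LinearMap.smulRight_apply]
    rw [Finset.sum_eq_single i, Finset.sum_eq_single j]
    · rw [b.coef_el _ _ _ _ h]; simp
    · intro k _ hk; rw [b.coef_el _ _ _ _ h, if_neg (by tauto), zero_smul]
    · simp
    · intro k _ hk
      refine Finset.sum_eq_zero fun l _ => ?_
      rw [b.coef_el _ _ _ _ h, if_neg (by tauto), zero_smul]
    · simp
  simpa using LinearMap.congr_fun this x

theorem ext_coef [Fintype V] (b : RelBasis K R B) {x y : B}
    (h : ∀ i j, R i j → b.coef i j x = b.coef i j y) : x = y := by
  rw [b.sum_coef x, b.sum_coef y]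
  refine Finset.sum_congr rfl fun i _ => Finset.sum_congr rfl fun j _ => ?_
  by_cases hR : R i j
  · rw [h i j hR]
  · rw [b.coef_of_not hR]; simp

/-- A reflexive relation. -/
theorem sum_el_self [Fintype V] (b : RelBasis K R B) (hR : ∀ i, R i i) : ∑ i, b.el i i = 1 := by
  classical
  have : LinearMap.mulRight K (∑ i, b.el i i) = LinearMap.id := b.hom_ext fun i j h => by
    simp only [LinearMap.mulRight_apply, LinearMap.id_coe, id_eq, Finset.mul_sum]
    rw [Finset.sum_eq_single j]
    · exact b.mul_of_rel _ _ _ h (hR j)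
    · intro k _ hk; exact b.mul_of_ne _ _ _ _ (Ne.symm hk)
    · simp
  simpa using LinearMap.congr_fun this 1

theorem el_mul_mul_el (b : RelBasis K R B) (hR : ∀ i, R i i) (i j : V) (x : B) :
    b.el i i * x * b.el j j = b.coef i j x • b.el i j := by
  classical
  have : LinearMap.mulRight K (b.el j j) ∘ₗ LinearMap.mulLeft K (b.el i i) =
      (b.coef i j).smulRight (b.el i j) := b.hom_ext fun k l h => by
    simp only [LinearMap.comp_apply, LinearMap.mulLeft_apply, LinearMap.mulRight_apply,
      LinearMap.smulRight_apply]
    rw [b.coef_el _ _ _ _ h]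
    by_cases h1 : i = k
    · subst h1
      rw [b.mul_of_rel _ _ _ (hR i) h]
      by_cases h2 : j = l
      · subst h2
        rw [b.mul_of_rel _ _ _ h (hR j)]; simp
      · rw [b.mul_of_ne _ _ _ _ (Ne.symm h2), if_neg (by tauto), zero_smul]
    · rw [b.mul_of_ne _ _ _ _ h1, zero_mul, if_neg (by tauto), zero_smul]
  exact LinearMap.congr_fun this x

/-- Transitivity is essential: if `R i j` failed, the left side would be zero, while the sum on the
right could still contain a nonzero product along a chain from `i` to `j`. -/
theorem coef_mul [Fintype V] (b : RelBasis K R B) (hR : ∀ i j k, R i j → R j k → R i k) (i j : V)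
    (x y : B) : b.coef i j (x * y) = ∑ k, b.coef i k x * b.coef k j y := by
  classical
  have : (LinearMap.mul K B).compr₂ (b.coef i j) =
      ∑ k, (LinearMap.mul K K).compl₁₂ (b.coef i k) (b.coef k j) :=
    b.hom_ext fun p q hpq => b.hom_ext fun r s hrs => by
      simp only [LinearMap.compr₂_apply, LinearMap.mul_apply', LinearMap.coe_sum, Finset.sum_apply,
        LinearMap.compl₁₂_apply]
      rw [Finset.sum_eq_single q]
      · rw [b.coef_el _ _ _ _ hpq, b.coef_el _ _ _ _ hrs]
        by_cases hqr : q = r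
        · subst hqr
          rw [b.mul_of_rel _ _ _ hpq hrs, b.coef_el _ _ _ _ (hR _ _ _ hpq hrs)]
          by_cases h1 : i = p <;> by_cases h2 : j = s <;> simp [h1, h2]
        · rw [b.mul_of_ne _ _ _ _ hqr]; simp [hqr]
      · intro k _ hk
        rw [b.coef_el _ _ _ _ hpq, if_neg (by tauto), zero_mul]
      · simp
  simpa using LinearMap.congr_fun (LinearMap.congr_fun this x) y

theorem coef_one [Fintype V] [DecidableEq V] (b : RelBasis K R B) (hR : ∀ i, R i i) (i j : V) :
    b.coef i j 1 = if i = j then 1 else 0 := by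
  rw [← b.sum_el_self hR, map_sum]
  simp only [b.coef_el _ _ _ _ (hR _)]
  by_cases h : i = j
  · subst h; simp
  · rw [if_neg h, Finset.sum_eq_zero]
    rintro k _
    rw [if_neg]; rintro ⟨rfl, rfl⟩; exact h rfl

/-- If `R` is antisymmetric, then the diagonal coefficients are multiplicative. -/
theorem coef_self_mul (b : RelBasis K R B) (hR : ∀ i, R i i)
    (hR' : ∀ i j, R i j → R j i → i = j) (i : V) (x y : B) :
    b.coef i i (x * y) = b.coef i i x * b.coef i i y := by
  classical
  have : (LinearMap.mul K B).compr₂ (b.coef i i) =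
      (LinearMap.mul K K).compl₁₂ (b.coef i i) (b.coef i i) :=
    b.hom_ext fun p q hpq => b.hom_ext fun r s hrs => by
      simp only [LinearMap.compr₂_apply, LinearMap.mul_apply', LinearMap.compl₁₂_apply]
      rw [b.coef_el _ _ _ _ hpq, b.coef_el _ _ _ _ hrs]
      by_cases hqr : q = r
      · subst hqr
        rw [b.mul_of_rel _ _ _ hpq hrs]
        by_cases hps : R p s
        · rw [b.coef_el _ _ _ _ hps]
          by_cases h1 : i = p
          · subst h1
            by_cases h2 : i = s
            · subst h2
              -- By antisymmetry a product of two units is diagonal only if both factors are.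
              have := hR' _ _ hpq hrs
              simp [this]
            · simp [h2]
          · simp [h1]
        · rw [b.el_eq_zero _ _ hps, map_zero]
          by_cases h1 : i = p
          · subst h1
            by_cases h2 : i = s
            · subst h2; exact absurd (hR i) hps
            · simp [h2]
          · simp [h1]
      · rw [b.mul_of_ne _ _ _ _ hqr, map_zero]
        by_cases h1 : i = q
        · have : i ≠ r := fun h => hqr (h1 ▸ h)
          simp [this]
        · simp [h1]
  simpa using LinearMap.congr_fun (LinearMap.congr_fun this x) y

theorem nonempty_algEquiv {V' : Type} {R' : V' → V' → Prop} {B' : Type*} [Ring B'] [Algebra K B']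
    (b : RelBasis K R B) (b' : RelBasis K R' B') (σ : V ≃ V')
    (h : ∀ i j, R i j ↔ R' (σ i) (σ j)) : Nonempty (B ≃ₐ[K] B') := by
  let τ : {p : V × V // R p.1 p.2} ≃ {p : V' × V' // R' p.1 p.2} :=
    (Equiv.prodCongr σ σ).subtypeEquiv fun p => h p.1 p.2
  let e : B ≃ₗ[K] B' := b.basis.equiv b'.basis τ
  have he : ∀ i j, e (b.el i j) = b'.el (σ i) (σ j) := fun i j => by
    by_cases hR : R i j
    · rw [← b.basis_apply ⟨(i, j), hR⟩, Module.Basis.equiv_apply, b'.basis_apply]; rfl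
    · rw [b.el_eq_zero _ _ hR, b'.el_eq_zero _ _ (by rwa [← h]), map_zero]
  have hm : ∀ x y, e (x * y) = e x * e y := fun x y => by
    have : (LinearMap.mul K B).compr₂ e.toLinearMap =
        (LinearMap.mul K B').compl₁₂ e.toLinearMap e.toLinearMap :=
      b.hom_ext fun p q hpq => b.hom_ext fun r s hrs => by
        simp only [LinearMap.compr₂_apply, LinearMap.mul_apply', LinearMap.compl₁₂_apply,
          LinearEquiv.coe_coe, he]
        by_cases hqr : q = r
        · subst hqr
          rw [b.mul_of_rel _ _ _ hpq hrs, he,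
            b'.mul_of_rel _ _ _ ((h _ _).1 hpq) ((h _ _).1 hrs)]
        · rw [b.mul_of_ne _ _ _ _ hqr, map_zero, b'.mul_of_ne _ _ _ _ (σ.injective.ne hqr)]
    exact LinearMap.congr_fun (LinearMap.congr_fun this x) y
  refine ⟨AlgEquiv.ofLinearEquiv e ?_ hm⟩
  obtain ⟨x, hx⟩ := e.surjective 1
  rw [← mul_one (e 1), ← hx, ← hm, one_mul, hx]

/-- Transport along an isomorphism of algebras. -/
noncomputable def map {B' : Type*} [Ring B'] [Algebra K B'] (b : RelBasis K R B) (e : B ≃ₐ[K] B') :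
    RelBasis K R B' where
  el i j := e (b.el i j)
  basis := b.basis.map e.toLinearEquiv
  basis_apply p := by simp [b.basis_apply]
  el_eq_zero i j h := by rw [b.el_eq_zero i j h, map_zero]
  mul_of_ne i j k l h := by rw [← map_mul, b.mul_of_ne _ _ _ _ h, map_zero]
  mul_of_rel i j k h h' := by rw [← map_mul, b.mul_of_rel _ _ _ h h']

end RelBasis

/-- The relation `R` describes the paths in the quiver of `r`: it is the reflexive transitive
closure of `r`, and there is at most one path between two vertices. -/
structure IsReach {V : Type} (r R : V → V → Prop) : Prop where
  refl : ∀ i, R i i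
  step : ∀ i j k, R i j → r j k → R i k
  last : ∀ i k, R i k → i = k ∨ ∃ j, R i j ∧ r j k
  no_cycle : ∀ i j, R i j → ¬ r j i
  unique : ∀ i j j' k, R i j → R i j' → r j k → r j' k → j = j'

namespace IsReach

variable {V : Type} {r R : V → V → Prop}

theorem rel_of_path (h : IsReach r R) {i j : RelQuiver r} (p : Quiver.Path i j) : R i j := by
  induction p with
  | nil => exact h.refl i
  | cons p a ih => exact h.step _ _ _ ih a.down

theorem path_unique (h : IsReach r R) {i j : RelQuiver r} (p q : Quiver.Path i j) : p = q := by
  induction p with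
  | nil =>
    cases q with
    | nil => rfl
    | cons q a => exact absurd a.down (h.no_cycle _ _ (h.rel_of_path q))
  | cons p a ih =>
    cases q with
    | nil => exact absurd a.down (h.no_cycle _ _ (h.rel_of_path p))
    | cons q a' =>
      obtain rfl := h.unique _ _ _ _ (h.rel_of_path p) (h.rel_of_path q) a.down a'.down
      rw [ih q]
      exact congrArg (Quiver.Path.cons q) (Subsingleton.elim (α := PLift (r _ _)) a a')

theorem eq_of_paths (h : IsReach r R) {i j : RelQuiver r} (p : Quiver.Path i j)
    (q : Quiver.Path j i) : i = j := by
  cases p with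
  | nil => rfl
  | cons p a => exact absurd (h.path_unique (q.comp (p.cons a)) .nil) (by simp)

/-- The relation only yields a last arrow, so the path is built backwards from `j`. This ends
because the existence of a nontrivial path is a strict order on a finite set. -/
theorem nonempty_path [Finite V] (h : IsReach r R) (i j : RelQuiver r) (hij : R i j) :
    Nonempty (Quiver.Path i j) := by
  have wf : WellFounded (fun a b : V => a ≠ b ∧ Nonempty (Quiver.Path (V := RelQuiver r) a b)) := by
    have : IsStrictOrder V
        (fun a b : V => a ≠ b ∧ Nonempty (Quiver.Path (V := RelQuiver r) a b)) :=
      { irrefl := fun a ha => ha.1 rfl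
        trans := by
          rintro a b c ⟨hab, ⟨p⟩⟩ ⟨hbc, ⟨q⟩⟩
          refine ⟨?_, ⟨p.comp q⟩⟩
          rintro rfl
          exact hbc (h.eq_of_paths q p) }
    exact Finite.wellFounded_of_trans_of_irrefl _
  induction j using wf.induction with
  | _ j ih =>
    rcases h.last i j hij with rfl | ⟨k, hik, hkj⟩
    · exact ⟨.nil⟩
    · have hk : k ≠ j := by rintro rfl; exact h.no_cycle _ _ (h.refl k) hkj
      obtain ⟨p⟩ := ih k ⟨hk, ⟨Quiver.Path.nil.cons ⟨hkj⟩⟩⟩ hik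
      exact ⟨p.cons ⟨hkj⟩⟩

open scoped Classical in
/-- The path from `i` to `j` as an element of the path algebra, or zero if there is none. -/
noncomputable def pathElt (K : Type u) [Field K] (i j : RelQuiver r) :
    PathAlgebra K (RelQuiver r) :=
  if h : Nonempty (Quiver.Path i j) then PathAlgebra.ofPath K ⟨i, j, h.some⟩ else 0

theorem pathElt_eq (K : Type u) [Field K] (h : IsReach r R) {i j : RelQuiver r}
    (p : Quiver.Path i j) : pathElt K i j = PathAlgebra.ofPath K ⟨i, j, p⟩ := by
  rw [pathElt, dif_pos ⟨p⟩]
  exact congrArg (fun p => PathAlgebra.ofPath K ⟨i, j, p⟩) (h.path_unique _ _)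

/-- The path algebra of `RelQuiver r` has a basis of matrix units. -/
noncomputable def relBasis [Fintype V] [DecidableEq V] (K : Type u) [Field K] (h : IsReach r R) :
    RelBasis K R (PathAlgebra K (RelQuiver r)) where
  el := pathElt K
  basis := (Module.Basis.ofRepr (LinearEquiv.refl K (QPath (RelQuiver r) →₀ K)) :
      Module.Basis (QPath (RelQuiver r)) K (PathAlgebra K (RelQuiver r))).reindex
    { toFun := fun p => ⟨(p.src, p.tgt), h.rel_of_path p.path⟩
      invFun := fun p => ⟨p.1.1, p.1.2, (h.nonempty_path p.1.1 p.1.2 p.2).some⟩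
      left_inv := fun p => by
        obtain ⟨a, b, p⟩ := p
        exact congrArg (QPath.mk a b) (h.path_unique _ _)
      right_inv := fun p => rfl }
  basis_apply p := by
    rw [Module.Basis.reindex_apply, pathElt_eq K h (h.nonempty_path p.1.1 p.1.2 p.2).some]
    rfl
  el_eq_zero i j hij := dif_neg fun ⟨p⟩ => hij (h.rel_of_path p)
  mul_of_ne i j k l hjk := by
    unfold pathElt
    split_ifs
    · rw [PathAlgebra.ofPath_mul_ofPath]; exact dif_neg hjk
    all_goals simp
  mul_of_rel i j k hij hjk := by
    obtain ⟨p⟩ := h.nonempty_path i j hij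
    obtain ⟨q⟩ := h.nonempty_path j k hjk
    rw [pathElt_eq K h p, pathElt_eq K h q, pathElt_eq K h (p.comp q),
      PathAlgebra.ofPath_mul_ofPath, PathAlgebra.concat, dif_pos rfl]
    rfl

end IsReach

end Silted

/-! ### Opposite bases, and invariants that separate the algebras -/

namespace Silted
open CategoryTheory CategoryTheory.Limits

namespace RelBasis

variable {K : Type u} [Field K] {V : Type} {R : V → V → Prop} {B : Type v} [Ring B] [Algebra K B]

/-- Replace the relation by an equivalent one. -/
noncomputable def congr (b : RelBasis K R B) {R' : V → V → Prop} (h : ∀ i j, R i j ↔ R' i j) :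
    RelBasis K R' B :=
  (funext fun i => funext fun j => propext (h i j) : R = R') ▸ b

/-- The opposite basis of the opposite algebra. -/
noncomputable def opposite (b : RelBasis K R B) : RelBasis K (fun i j => R j i) Bᵐᵒᵖ where
  el i j := MulOpposite.op (b.el j i)
  basis := (b.basis.map (MulOpposite.opLinearEquiv K)).reindex
    { toFun := fun p => ⟨(p.1.2, p.1.1), p.2⟩
      invFun := fun p => ⟨(p.1.2, p.1.1), p.2⟩
      left_inv := fun _ => rfl
      right_inv := fun _ => rfl }
  basis_apply p := by
    rw [Module.Basis.reindex_apply, Module.Basis.map_apply, b.basis_apply]; rfl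
  el_eq_zero i j h := by rw [b.el_eq_zero _ _ h]; rfl
  mul_of_ne i j k l h := by rw [← MulOpposite.op_mul, b.mul_of_ne _ _ _ _ (Ne.symm h)]; rfl
  mul_of_rel i j k h h' := by rw [← MulOpposite.op_mul, b.mul_of_rel _ _ _ h' h]

theorem coef_self_eq_one (b : RelBasis K R B) (hR : ∀ i, R i i) {i j : V} (hij : R i j) {e : B}
    (he : e * b.el i j = b.el i j) : b.coef i i e = 1 := by
  have h1 : b.coef i i e • b.el i j = (1 : K) • b.el i j := by
    have h := b.el_mul_mul_el hR i i e
    calc b.coef i i e • b.el i j = (b.coef i i e • b.el i i) * b.el i j := by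
          rw [smul_mul_assoc, b.mul_of_rel _ _ _ (hR i) hij]
      _ = b.el i i * (e * b.el i j) := by
          rw [← h, mul_assoc, b.mul_of_rel _ _ _ (hR i) hij, mul_assoc]
      _ = (1 : K) • b.el i j := by rw [he, b.mul_of_rel _ _ _ (hR i) hij, one_smul]
  exact smul_left_injective K (b.el_ne_zero hij) h1

/-- An algebra does not have two bases of matrix units such that the arrows of one start in a
single vertex, and those of the other do not. -/
theorem false_of_sources [Fintype V] (b : RelBasis K R B) {R' : V → V → Prop}
    (b' : RelBasis K R' B)
    (hR : ∀ i, R i i) (hA : ∀ i j, R i j → R j i → i = j) (s : V) (hs : ∀ i j, R i j → i = j ∨ i = s)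
    (hR' : ∀ i, R' i i) (hA' : ∀ i j, R' i j → R' j i → i = j)
    {i j i' j' : V} (hij : R' i j) (hij' : R' i' j') (h1 : i ≠ j) (h2 : i' ≠ j') (h3 : i ≠ i') :
    False := by
  -- A square-zero element has zero diagonal coefficients, since these are multiplicative. It is
  -- then a combination of units `el s l`, and these are fixed by left multiplication with `el s s`.
  have key : ∀ x : B, x * x = 0 → b.el s s * x = x := fun x hx => by
    have h0 : ∀ k, b.coef k k x = 0 := fun k => by
      have := congrArg (b.coef k k) hx
      rw [b.coef_self_mul hR hA, map_zero] at this
      exact mul_self_eq_zero.1 this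
    conv_rhs => rw [b.sum_coef x]
    conv_lhs => rw [b.sum_coef x]
    simp only [Finset.mul_sum, mul_smul_comm]
    refine Finset.sum_congr rfl fun k _ => Finset.sum_congr rfl fun l _ => ?_
    by_cases hkl : R k l
    · rcases hs k l hkl with rfl | rfl
      · rw [h0, zero_smul, zero_smul]
      · rw [b.mul_of_rel _ _ _ (hR _) hkl]
    · rw [b.el_eq_zero _ _ hkl, mul_zero]
  have hsq : ∀ {i j}, i ≠ j → b'.el i j * b'.el i j = 0 := fun h => b'.mul_of_ne _ _ _ _ h.symm
  have e1 := b'.coef_self_eq_one hR' hij (key _ (hsq h1))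
  have e2 := b'.coef_self_eq_one hR' hij' (key _ (hsq h2))
  -- The corner at `s` is one-dimensional, so `el s s * b'.el i i * el s s` equals c times `el s s`.
  -- By `e1` and `e2`, comparing diagonal coefficients of the second basis at `i` gives c = 1, and
  -- at `i'` it gives c = 0.
  have hc := b.el_mul_mul_el hR s s (b'.el i i)
  have c1 := congrArg (b'.coef i i) hc
  have c2 := congrArg (b'.coef i' i') hc
  simp only [b'.coef_self_mul hR' hA', e1, e2, map_smul, b'.coef_el _ _ _ _ (hR' i)] at c1 c2
  simp only [and_self, if_true, mul_one, smul_eq_mul] at c1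
  rw [← c1] at c2
  simp [h3.symm] at c2

/-- Two bases of matrix units of one algebra have the same number of elements. -/
theorem card_eq (b : RelBasis K R B) {V' : Type} {R' : V' → V' → Prop} (b' : RelBasis K R' B) :
    Nat.card {p : V × V // R p.1 p.2} = Nat.card {p : V' × V' // R' p.1 p.2} :=
  Nat.card_congr (b.basis.indexEquiv b'.basis)

/-- With zero diagonal, `p` is strictly triangular with respect to `ρ`, hence nilpotent, and a
nilpotent idempotent is zero. Concretely, `p * el j j = p * p * el j j` expands into terms
containing `p * el i i` with `ρ i < ρ j`. -/
theorem eq_zero_of_isIdempotentElem [Fintype V] (b : RelBasis K R B) (hR : ∀ i, R i i) (ρ : V → ℕ)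
    (hρ : ∀ i j, R i j → i ≠ j → ρ i < ρ j) {p : B} (hp : p * p = p)
    (h0 : ∀ i, b.coef i i p = 0) : p = 0 := by
  have key : ∀ n j, ρ j = n → p * b.el j j = 0 := fun n => by
    induction n using Nat.strong_induction_on with
    | _ n ih =>
      rintro j rfl
      calc p * b.el j j = p * (∑ i, b.el i i) * p * b.el j j := by
            rw [b.sum_el_self hR, mul_one, hp]
        _ = ∑ i, b.coef i j p • (p * b.el i i * b.el i j) := by
            simp only [Finset.mul_sum, Finset.sum_mul]
            refine Finset.sum_congr rfl fun i _ => ?_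
            rw [mul_assoc p, mul_assoc p, b.el_mul_mul_el hR, mul_smul_comm]
            by_cases hij : R i j
            · rw [mul_assoc, b.mul_of_rel _ _ _ (hR i) hij]
            · rw [b.coef_of_not hij]; simp
        _ = 0 := Finset.sum_eq_zero fun i _ => by
            by_cases hij : i = j
            · subst hij; rw [h0, zero_smul]
            · by_cases hR : R i j
              · rw [ih _ (hρ i j hR hij) i rfl, zero_mul, smul_zero]
              · rw [b.coef_of_not hR]; simp
  rw [← mul_one p, ← b.sum_el_self hR, Finset.mul_sum]
  exact Finset.sum_eq_zero fun j _ => key _ j rfl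

end RelBasis

/-! ### The algebras in the lists -/

/-- The relation for which the path algebra of `0 → 1 → 2` modulo the path of length two has a
basis of matrix units. -/
abbrev relRelA3 : Fin 3 → Fin 3 → Prop := fun i j => i ≤ j ∧ ¬ (i = 0 ∧ j = 2)

theorem isReach_linearA3 : IsReach linearA3 (fun i j => i ≤ j) where
  refl := by decide
  step := by decide
  last := by decide
  no_cycle := by decide
  unique := by decide

theorem isReach_sinkA3 : IsReach sinkA3 (fun i j => i = j ∨ j = 2) where
  refl := by decide
  step := by decide
  last := by decide
  no_cycle := by decide
  unique := by decide

theorem isReach_sourceA3 : IsReach sourceA3 (fun i j => i = j ∨ i = 2) where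
  refl := by decide
  step := by decide
  last := by decide
  no_cycle := by decide
  unique := by decide

theorem isReach_arrowAndPoint : IsReach arrowAndPoint (fun i j => i = j ∨ (i = 0 ∧ j = 1)) where
  refl := by decide
  step := by decide
  last := by decide
  no_cycle := by decide
  unique := by decide

theorem isReach_threePoints : IsReach threePoints (fun i j => i = j) where
  refl := by decide
  step := by decide
  last := by decide
  no_cycle := by decide
  unique := by decide

section

variable (K : Type u) [Field K]

/-- If some algebra has a basis of matrix units of the right shape, then so has `RelA3 K`. -/
theorem nonempty_relBasis_relA3 {B : Type*} [Ring B] [Algebra K B] (b : RelBasis K relRelA3 B) :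
    Nonempty (RelBasis K relRelA3 (RelA3 K)) := by
  have hreach := isReach_linearA3
  let c := hreach.relBasis K
  -- The path from `i` to `j` goes to the unit of `B`, which is zero for the pair (0, 2). The
  -- algebra `B` is a model in which the other paths are visibly independent.
  let φ₀ : PathAlgebra K (RelQuiver linearA3) →ₗ[K] B :=
    ∑ i, ∑ j, (c.coef i j).smulRight (b.el i j)
  have hφ₀ : ∀ i j, φ₀ (c.el i j) = b.el i j := fun i j => by
    by_cases hij : i ≤ j
    · simp only [φ₀, LinearMap.coe_sum, Finset.sum_apply, LinearMap.smulRight_apply,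
        c.coef_el _ _ _ _ hij]
      rw [Finset.sum_eq_single i, Finset.sum_eq_single j]
      · simp
      · intro l _ hl; rw [if_neg (by tauto), zero_smul]
      · simp
      · intro k _ hk
        exact Finset.sum_eq_zero fun l _ => by rw [if_neg (by tauto), zero_smul]
      · simp
    · rw [c.el_eq_zero _ _ hij, map_zero, b.el_eq_zero _ _ fun h => hij h.1]
  have hdec : ∀ i j k : Fin 3, i ≤ j → j ≤ k → relRelA3 i k → relRelA3 i j ∧ relRelA3 j k := by
    decide
  have hdec' : ∀ i j k : Fin 3, relRelA3 i j → relRelA3 j k → i ≤ j ∧ j ≤ k := by decide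
  have hmul : ∀ x y, φ₀ (x * y) = φ₀ x * φ₀ y := fun x y => by
    have : (LinearMap.mul K _).compr₂ φ₀ = (LinearMap.mul K B).compl₁₂ φ₀ φ₀ :=
      c.hom_ext fun p q hpq => c.hom_ext fun r s hrs => by
        simp only [LinearMap.compr₂_apply, LinearMap.mul_apply', LinearMap.compl₁₂_apply, hφ₀]
        by_cases hqr : q = r
        · subst hqr
          rw [c.mul_of_rel _ _ _ hpq hrs, hφ₀]
          by_cases h : relRelA3 p q ∧ relRelA3 q s
          · rw [b.mul_of_rel _ _ _ h.1 h.2]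
          · rw [b.el_eq_zero p s fun h' => h (hdec _ _ _ hpq hrs h')]
            by_cases h1 : relRelA3 p q
            · rw [b.el_eq_zero q s fun h' => h ⟨h1, h'⟩, mul_zero]
            · rw [b.el_eq_zero p q h1, zero_mul]
        · rw [c.mul_of_ne _ _ _ _ hqr, b.mul_of_ne _ _ _ _ hqr, map_zero]
    exact LinearMap.congr_fun (LinearMap.congr_fun this x) y
  have hone : φ₀ 1 = 1 := by
    rw [← c.sum_el_self (by decide), ← b.sum_el_self (by decide), map_sum]
    exact Finset.sum_congr rfl fun i _ => hφ₀ i i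
  let φ := AlgHom.ofLinearMap φ₀ hone hmul
  have hφ : ∀ ⦃x y : PathAlgebra K (RelQuiver linearA3)⦄,
      ((∃ p ∈ {p : QPath (RelQuiver linearA3) | p.path.length = 2}, x = PathAlgebra.ofPath K p) ∧
        y = 0) → φ x = φ y := by
    rintro _ _ ⟨⟨⟨i, j, p⟩, hp, rfl⟩, rfl⟩
    rw [← IsReach.pathElt_eq K hreach p, map_zero]
    refine (hφ₀ i j).trans (b.el_eq_zero _ _ ?_)
    simp only [Set.mem_ofPred_eq] at hp
    cases p with
    | nil => simp at hp
    | cons p a =>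
      cases p with
      | nil => simp at hp
      | cons p a' =>
        cases p with
        | cons p a'' => simp at hp
        | nil =>
          have h1 := a.down
          have h2 := a'.down
          revert h1 h2
          clear a a' hp
          rename_i k
          exact (by decide : ∀ i k j : Fin 3, linearA3 k j → linearA3 i k → ¬ relRelA3 i j) i k j
  let ψ : RelA3 K →ₐ[K] B := RingQuot.liftAlgHom K ⟨φ, hφ⟩
  have hψ : ∀ x, ψ (RingQuot.mkAlgHom K _ x) = φ₀ x := fun x =>
    RingQuot.liftAlgHom_mkAlgHom_apply K φ hφ x
  have h02 : RingQuot.mkAlgHom K _ (c.el 0 2) = (0 : RelA3 K) := by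
    let v : Fin 3 → RelQuiver linearA3 := fun i => i
    let a : v 0 ⟶ v 1 := ⟨Or.inl ⟨rfl, rfl⟩⟩
    let a' : v 1 ⟶ v 2 := ⟨Or.inr ⟨rfl, rfl⟩⟩
    let p : Quiver.Path (v 0) (v 2) := (Quiver.Path.nil.cons a).cons a'
    have h1 : c.el 0 2 = PathAlgebra.ofPath K ⟨v 0, v 2, p⟩ := IsReach.pathElt_eq K hreach p
    rw [h1, ← map_zero (RingQuot.mkAlgHom K _)]
    exact RingQuot.mkAlgHom_rel K ⟨⟨_, rfl, rfl⟩, rfl⟩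
  have hinj : Function.Injective ψ := by
    rw [injective_iff_map_eq_zero]
    intro x hx
    obtain ⟨y, rfl⟩ := RingQuot.mkAlgHom_surjective K _ x
    rw [hψ] at hx
    have hy : ∀ i j, relRelA3 i j → c.coef i j y = 0 := fun i j hij => by
      have h1 : b.coef i j ∘ₗ φ₀ = c.coef i j := c.hom_ext fun k l hkl => by
        rw [LinearMap.comp_apply, hφ₀, c.coef_el _ _ _ _ hkl]
        by_cases h : relRelA3 k l
        · exact b.coef_el _ _ _ _ h
        · rw [b.el_eq_zero _ _ h, map_zero, if_neg]
          rintro ⟨rfl, rfl⟩; exact h hij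
      rw [← h1, LinearMap.comp_apply, hx, map_zero]
    -- An element of the path algebra with image zero in `B` is a multiple of the path of length
    -- two, and that path is zero in the quotient.
    have : y = c.coef 0 2 y • c.el 0 2 := c.ext_coef fun i j hij => by
      rw [map_smul, c.coef_el _ _ _ _ (by decide)]
      by_cases h : i = 0 ∧ j = 2
      · obtain ⟨rfl, rfl⟩ := h; simp
      · rw [hy i j ⟨hij, h⟩, if_neg h, smul_zero]
    rw [this, map_smul, h02, smul_zero]
  have hsurj : Function.Surjective ψ := fun z => by
    refine ⟨RingQuot.mkAlgHom K _ (∑ i, ∑ j, b.coef i j z • c.el i j), ?_⟩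
    rw [hψ]
    conv_rhs => rw [b.sum_coef z]
    simp only [map_sum, map_smul, hφ₀]
  exact ⟨b.map (AlgEquiv.ofBijective ψ ⟨hinj, hsurj⟩).symm⟩

/-- The Boolean tables of the relations belonging to the six algebras in the lists. -/
def listBool : Fin 6 → Fin 3 → Fin 3 → Bool :=
  ![fun i j => i ≤ j, fun i j => i = j ∨ j = 2, fun i j => i = j ∨ i = 2,
    fun i j => i ≤ j ∧ ¬ (i = 0 ∧ j = 2), fun i j => i = j ∨ (i = 0 ∧ j = 1), fun i j => i = j]

/-- The relations belonging to the six algebras in the lists. -/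
abbrev listRel (k : Fin 6) (i j : Fin 3) : Prop := listBool k i j = true

theorem listRel_refl : ∀ k i, listRel k i i := by decide

variable {K} in
/-- The relations in `listRel` are distinguished by the algebras. -/
theorem eq_of_relBasis {B : Type v} [Ring B] [Algebra K B] {k l : Fin 6}
    (b : RelBasis K (listRel k) B) (b' : RelBasis K (listRel l) B) : k = l := by
  have hcard := b.card_eq b'
  rw [Nat.card_eq_fintype_card, Nat.card_eq_fintype_card] at hcard
  -- The numbers of pairs are 6, 5, 5, 5, 4, 3, so only the indices 1, 2 and 3 can be confused.
  have h1 : ∀ k l : Fin 6, Fintype.card {p : Fin 3 × Fin 3 // listRel k p.1 p.2} =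
      Fintype.card {p : Fin 3 × Fin 3 // listRel l p.1 p.2} →
      k = l ∨ (k = 2 ∧ (l = 1 ∨ l = 3)) ∨ ((k = 1 ∨ k = 3) ∧ l = 2) ∨ (k = 1 ∧ l = 3) ∨
        (k = 3 ∧ l = 1) := by decide
  -- In the algebra 2 all arrows start in one vertex, in the algebras 1 and 3 they do not. The
  -- latter two are told apart by the same test on the opposite algebras, since in the algebra 1 all
  -- arrows end in one vertex.
  have src : ∀ {C : Type v} [Ring C] [Algebra K C] {l : Fin 6}, RelBasis K (listRel 2) C →
      RelBasis K (listRel l) C → (l = 1 ∨ l = 3) → False := by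
    rintro C _ _ l c c' (rfl | rfl)
    · exact c.false_of_sources c' (by decide) (by decide) 2 (by decide) (by decide) (by decide)
        (i := 0) (j := 2) (i' := 1) (j' := 2) (by decide) (by decide) (by decide) (by decide)
        (by decide)
    · exact c.false_of_sources c' (by decide) (by decide) 2 (by decide) (by decide) (by decide)
        (i := 0) (j := 1) (i' := 1) (j' := 2) (by decide) (by decide) (by decide) (by decide)
        (by decide)
  have tgt : RelBasis K (listRel 1) B → RelBasis K (listRel 3) B → False := fun c c' =>
    c.opposite.false_of_sources c'.opposite (by decide) (by decide) 2 (by decide) (by decide) (by decide)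
      (i := 1) (j := 0) (i' := 2) (j' := 1) (by decide) (by decide) (by decide) (by decide)
      (by decide)
  rcases h1 k l hcard with h | ⟨rfl, h⟩ | ⟨h, rfl⟩ | ⟨rfl, rfl⟩ | ⟨rfl, rfl⟩
  · exact h
  · exact (src b b' h).elim
  · exact (src b' b h).elim
  · exact (tgt b b').elim
  · exact (tgt b' b).elim

end

end Silted

namespace Silted
open CategoryTheory CategoryTheory.Limits

/-! ### Direct sum decompositions and endomorphism algebras -/

/-- A decomposition of `T` as the direct sum of the objects `X k`. -/
structure Decomp {C : Type*} [Category C] [Preadditive C] (T : C) {κ : Type} [Fintype κ]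
    (X : κ → C) where
  inc : ∀ k, X k ⟶ T
  prj : ∀ k, T ⟶ X k
  inc_prj_self : ∀ k, inc k ≫ prj k = 𝟙 (X k)
  inc_prj_ne : ∀ k l, k ≠ l → inc k ≫ prj l = 0
  total : ∑ k, prj k ≫ inc k = 𝟙 T

namespace Decomp

variable {C : Type*} [Category C] [Preadditive C] {T : C} {κ : Type} [Fintype κ] {X : κ → C}

theorem inc_prj_self_assoc (D : Decomp T X) (k : κ) {Z : C} (h : X k ⟶ Z) : D.inc k ≫ D.prj k ≫ h = h := by
  rw [← Category.assoc, D.inc_prj_self, Category.id_comp]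

theorem inc_prj_ne_assoc (D : Decomp T X) (k l : κ) (hkl : k ≠ l) {Z : C} (h : X l ⟶ Z) :
    D.inc k ≫ D.prj l ≫ h = 0 ≫ h := by
  rw [← Category.assoc, D.inc_prj_ne k l hkl]

/-- The image of a decomposition under an additive functor. -/
def map (D : Decomp T X) {C' : Type*} [Category C'] [Preadditive C'] (F : C ⥤ C') [F.Additive] :
    Decomp (F.obj T) (fun k => F.obj (X k)) where
  inc k := F.map (D.inc k)
  prj k := F.map (D.prj k)
  inc_prj_self k := by rw [← F.map_comp, D.inc_prj_self, F.map_id]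
  inc_prj_ne k l h := by rw [← F.map_comp, D.inc_prj_ne k l h, F.map_zero]
  total := by simp only [← F.map_comp, ← F.map_sum, D.total, F.map_id]

/-- Decompositions are unchanged if the summands are replaced by isomorphic ones. -/
def congr (D : Decomp T X) {Y : κ → C} (e : ∀ k, X k ≅ Y k) : Decomp T Y where
  inc k := (e k).inv ≫ D.inc k
  prj k := D.prj k ≫ (e k).hom
  inc_prj_self k := by simp [D.inc_prj_self_assoc]
  inc_prj_ne k l h := by simp [D.inc_prj_ne_assoc k l h]
  total := by simpa using D.total

/-- Reindexing of a decomposition. -/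
def reindex (D : Decomp T X) {κ' : Type} [Fintype κ'] (σ : κ' ≃ κ) :
    Decomp T (fun k => X (σ k)) where
  inc k := D.inc (σ k)
  prj k := D.prj (σ k)
  inc_prj_self _ := D.inc_prj_self _
  inc_prj_ne _ _ h := D.inc_prj_ne _ _ (σ.injective.ne h)
  total := (Equiv.sum_comp σ fun k => D.prj k ≫ D.inc k).trans D.total

/-- The empty decomposition of a zero object. -/
def ofIsZero (h : IsZero T) (X : Empty → C) : Decomp T X where
  inc := nofun
  prj := nofun
  inc_prj_self := nofun
  inc_prj_ne := nofun
  total := h.eq_of_src _ _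

/-- Add a direct summand to a decomposition. -/
noncomputable def cons [HasBinaryBiproducts C] {ι : Type*} {X : ι → C} {a : κ → ι} (i : ι)
    {T' : C} (e : T ≅ X i ⊞ T') (D : Decomp T' fun k => X (a k)) :
    Decomp T (fun o : Option κ => X (o.elim i a)) where
  inc
    | none => biprod.inl ≫ e.inv
    | some k => D.inc k ≫ biprod.inr ≫ e.inv
  prj
    | none => e.hom ≫ biprod.fst
    | some k => e.hom ≫ biprod.snd ≫ D.prj k
  inc_prj_self
    | none => by simp
    | some k => by simp [D.inc_prj_self]
  inc_prj_ne
    | none, none, h => (h rfl).elim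
    | none, some k, _ => by simp; rfl
    | some k, none, _ => by simp; rfl
    | some k, some l, h => by simp [D.inc_prj_ne k l fun h' => h (congrArg some h')]; rfl
  total := by
    rw [Fintype.sum_option]
    have : ∑ k, (e.hom ≫ biprod.snd ≫ D.prj k) ≫ D.inc k ≫ biprod.inr ≫ e.inv =
        e.hom ≫ biprod.snd ≫ (∑ k, D.prj k ≫ D.inc k) ≫ biprod.inr ≫ e.inv := by
      simp [Preadditive.comp_sum, Preadditive.sum_comp]
    change (e.hom ≫ biprod.fst) ≫ biprod.inl ≫ e.inv +
      ∑ k, (e.hom ≫ biprod.snd ≫ D.prj k) ≫ D.inc k ≫ biprod.inr ≫ e.inv = _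
    rw [this, D.total, Category.id_comp]
    have h2 : e.hom ≫ (biprod.fst ≫ biprod.inl + biprod.snd ≫ biprod.inr) ≫ e.inv = 𝟙 T := by
      rw [biprod.total, Category.id_comp, e.hom_inv_id]
    simpa only [Preadditive.add_comp, Preadditive.comp_add, Category.assoc] using h2

/-- The decomposition of a finite biproduct. -/
noncomputable def biproduct [HasFiniteBiproducts C] (X : κ → C) : Decomp (⨁ X) X where
  inc := biproduct.ι X
  prj := biproduct.π X
  inc_prj_self := biproduct.ι_π_self X
  inc_prj_ne k l h := biproduct.ι_π_ne X h
  total := by classical exact biproduct.total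

theorem hom_ext (D : Decomp T X) {Y : C} {f g : T ⟶ Y} (h : ∀ k, D.inc k ≫ f = D.inc k ≫ g) :
    f = g := by
  rw [← Category.id_comp f, ← Category.id_comp g, ← D.total, Preadditive.sum_comp,
    Preadditive.sum_comp]
  exact Finset.sum_congr rfl fun k _ => by rw [Category.assoc, Category.assoc, h]

theorem inc_comp_sum (D : Decomp T X) {Y : C} (g : ∀ k, X k ⟶ Y) (k : κ) :
    D.inc k ≫ ∑ l, D.prj l ≫ g l = g k := by
  rw [Preadditive.comp_sum, Finset.sum_eq_single k
    (fun l _ hl => by rw [← Category.assoc, D.inc_prj_ne _ _ hl.symm, zero_comp]) (by simp),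
    ← Category.assoc, D.inc_prj_self, Category.id_comp]

theorem inc_comp_sum_assoc (D : Decomp T X) {Y : C} (g : ∀ k, X k ⟶ Y) (k : κ) {Z : C} (h : Y ⟶ Z) :
    D.inc k ≫ (∑ l, D.prj l ≫ g l) ≫ h = g k ≫ h := by
  rw [← Category.assoc, D.inc_comp_sum]

/-- Any two direct sums of the same objects are isomorphic. -/
noncomputable def iso (D : Decomp T X) {T' : C} (D' : Decomp T' X) : T ≅ T' where
  hom := ∑ k, D.prj k ≫ D'.inc k
  inv := ∑ k, D'.prj k ≫ D.inc k
  hom_inv_id := D.hom_ext fun k => by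
    rw [inc_comp_sum_assoc, inc_comp_sum, Category.comp_id]
  inv_hom_id := D'.hom_ext fun k => by
    rw [inc_comp_sum_assoc, inc_comp_sum, Category.comp_id]

/-- In a basic object, no two nonzero summands are isomorphic. -/
theorem isZero_of_isBasic [HasFiniteBiproducts C] [HasBinaryBiproducts C] (D : Decomp T X)
    (hT : IsBasic T) {k l : κ} (hkl : k ≠ l) (e : X l ≅ X k) : IsZero (X k) := by
  classical
  let Y : {m // m ≠ k ∧ m ≠ l} → C := fun m => X m.1
  refine hT (X k) (⨁ Y) ⟨⟨biprod.lift (biprod.lift (D.prj k) (D.prj l ≫ e.hom))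
    (biproduct.lift fun m => D.prj m.1), biprod.desc (biprod.desc (D.inc k) (e.inv ≫ D.inc l))
    (biproduct.desc fun m => D.inc m.1), ?_, ?_⟩⟩
  · have h : ∑ m : {m // m ≠ k ∧ m ≠ l}, D.prj m.1 ≫ D.inc m.1 =
        ∑ m ∈ Finset.univ.filter (fun m => m ≠ k ∧ m ≠ l), D.prj m ≫ D.inc m :=
      (Finset.sum_subtype _ (by simp) (fun m => D.prj m ≫ D.inc m)).symm
    have h2 : (Finset.univ : Finset κ) =
        insert k (insert l (Finset.univ.filter (fun m => m ≠ k ∧ m ≠ l))) := by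
      ext m; simp; tauto
    have h3 := D.total
    rw [h2, Finset.sum_insert (by simp [hkl]), Finset.sum_insert (by simp)] at h3
    simp only [biprod.lift_desc, biproduct.lift_desc, Category.assoc, Iso.hom_inv_id_assoc]
    rw [h, add_assoc, h3]
  · ext m
    · simp [D.inc_prj_self]
    · simp [D.inc_prj_ne_assoc k l hkl]
    · simp [D.inc_prj_ne _ _ m.2.1.symm]
    · simp [D.inc_prj_ne _ _ hkl.symm]
    · simp [D.inc_prj_self_assoc]
    · simp [D.inc_prj_ne _ _ m.2.2.symm]
    · simp [D.inc_prj_ne _ _ m.2.1]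
    · simp [D.inc_prj_ne_assoc _ _ m.2.2]
    · rename_i m'
      by_cases h : m = m'
      · subst h; simp [D.inc_prj_self, Y]
      · simp [D.inc_prj_ne _ _ (fun h' => h (Subtype.ext h')), biproduct.ι_π_ne _ h]

end Decomp

section

variable (K : Type u) [Field K] {C : Type v} [Category.{w} C] [Preadditive C] [Linear K C]

/-- The morphisms between the objects `X k` are the multiples of given morphisms `f k l`, which
are nonzero exactly if `R k l` holds, and are compatible with composition. -/
structure HomTable {κ : Type} (X : κ → C) (R : κ → κ → Prop) where
  f : ∀ k l, X k ⟶ X l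
  span : ∀ k l (φ : X k ⟶ X l), ∃ c : K, φ = c • f k l
  zero : ∀ k l, ¬ R k l → f k l = 0
  ne_zero : ∀ k l, R k l → f k l ≠ 0
  id : ∀ k, f k k = 𝟙 (X k)
  comp : ∀ j k l, R j k → R k l → R j l → f j k ≫ f k l = f j l

variable {K}

/-- The endomorphism algebra of a direct sum has a basis of matrix units if there is a
table of homomorphisms between the summands. -/
theorem HomTable.nonempty_relBasis {T : C} {κ : Type} [Fintype κ] {X : κ → C} {R : κ → κ → Prop}
    (H : HomTable K X R) (D : Decomp T X) : Nonempty (RelBasis K (fun k l => R l k) (End T)) := by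
  classical
  -- The unit `el k l` leads from the summand `l` to the summand `k`. In `End` the product `f * g`
  -- is `g ≫ f`, so these multiply like matrix units, and the relation of the table appears
  -- transposed.
  let el : κ → κ → End T := fun k l => (D.prj l ≫ H.f l k ≫ D.inc k : T ⟶ T)
  have key : ∀ (φ : End T) (k l : κ), ∃ c : K, D.inc l ≫ (φ : T ⟶ T) ≫ D.prj k = c • H.f l k :=
    fun φ k l => H.span _ _ _
  have hel : ∀ i j k l, D.inc l ≫ (el i j : T ⟶ T) ≫ D.prj k =
      if i = k ∧ j = l then H.f l k else 0 := fun i j k l => by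
    split_ifs with h
    · obtain ⟨rfl, rfl⟩ := h
      simp [el, D.inc_prj_self_assoc, D.inc_prj_self]
    · by_cases h1 : j = l
      · have h2 : i ≠ k := fun h2 => h ⟨h2, h1⟩
        simp [el, D.inc_prj_ne _ _ h2]
      · simp [el, D.inc_prj_ne_assoc _ _ (Ne.symm h1)]
  let v : {p : κ × κ // R p.2 p.1} → End T := fun p => el p.1.1 p.1.2
  have hli : LinearIndependent K v := by
    rw [linearIndependent_iff']
    intro s g hg p hp
    have h1 : D.inc p.1.2 ≫ ((∑ q ∈ s, g q • v q : End T) : T ⟶ T) ≫ D.prj p.1.1 =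
        g p • H.f p.1.2 p.1.1 := by
      have h2 : ((∑ q ∈ s, g q • v q : End T) : T ⟶ T) = ∑ q ∈ s, g q • (v q : T ⟶ T) := rfl
      rw [h2, Preadditive.sum_comp, Preadditive.comp_sum, Finset.sum_eq_single p]
      · rw [Linear.smul_comp, Linear.comp_smul, hel, if_pos ⟨rfl, rfl⟩]
      · intro q _ hq
        rw [Linear.smul_comp, Linear.comp_smul, hel, if_neg, smul_zero]
        rintro ⟨h3, h4⟩
        exact hq (Subtype.ext (Prod.ext h3 h4))
      · exact fun h => absurd hp h
    rw [hg] at h1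
    have h2 : g p • H.f p.1.2 p.1.1 = 0 := by
      rw [← h1]
      change D.inc p.1.2 ≫ (0 : T ⟶ T) ≫ D.prj p.1.1 = 0
      simp
    exact (smul_eq_zero.1 h2).resolve_right (H.ne_zero _ _ p.2)
  have hsp : ⊤ ≤ Submodule.span K (Set.range v) := by
    intro φ _
    have h1 : φ = ∑ l, ∑ k, (D.prj l ≫ (D.inc l ≫ (φ : T ⟶ T) ≫ D.prj k) ≫ D.inc k : T ⟶ T) := by
      have h2 : (φ : T ⟶ T) = (∑ l, D.prj l ≫ D.inc l) ≫ φ ≫ (∑ k, D.prj k ≫ D.inc k) := by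
        rw [D.total]; simp
      rw [Preadditive.sum_comp] at h2
      refine h2.trans (Finset.sum_congr rfl fun l _ => ?_)
      simp [Preadditive.comp_sum]
    rw [h1]
    refine Submodule.sum_mem _ fun l _ => Submodule.sum_mem _ fun k _ => ?_
    obtain ⟨c, hc⟩ := key φ k l
    rw [hc]
    by_cases hR : R l k
    · have : (D.prj l ≫ (c • H.f l k) ≫ D.inc k : T ⟶ T) = c • v ⟨(k, l), hR⟩ := by
        simp [v, el]
      rw [this]
      exact Submodule.smul_mem _ _ (Submodule.subset_span ⟨_, rfl⟩)
    · rw [H.zero _ _ hR]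
      have : (D.prj l ≫ (c • (0 : X l ⟶ X k)) ≫ D.inc k : T ⟶ T) = 0 := by simp
      rw [this]
      exact Submodule.zero_mem _
  refine ⟨{ el := el, basis := Module.Basis.mk hli hsp, basis_apply := fun p => ?_,
            el_eq_zero := fun i j h => ?_, mul_of_ne := fun i j k l h => ?_,
            mul_of_rel := fun i j k h h' => ?_ }⟩
  · rw [Module.Basis.mk_apply]
  · change D.prj j ≫ H.f j i ≫ D.inc i = 0
    rw [H.zero _ _ h]; simp
  · change (D.prj l ≫ H.f l k ≫ D.inc k) ≫ (D.prj j ≫ H.f j i ≫ D.inc i) = 0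
    simp [D.inc_prj_ne_assoc _ _ h.symm]
  · change (D.prj k ≫ H.f k j ≫ D.inc j) ≫ (D.prj j ≫ H.f j i ≫ D.inc i) =
      D.prj k ≫ H.f k i ≫ D.inc i
    have : H.f k j ≫ H.f j i = H.f k i := by
      by_cases hR : R k i
      · exact H.comp _ _ _ h' h hR
      -- If there are no nonzero morphisms from `X k` to `X i`, the composite is a multiple of a
      -- zero generator.
      · obtain ⟨c, hc⟩ := H.span _ _ (H.f k j ≫ H.f j i)
        rw [hc, H.zero _ _ hR, smul_zero]
    simp [D.inc_prj_self_assoc, reassoc_of% this]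

/-- An object whose endomorphism algebra has a triangular basis of matrix units is basic. -/
theorem isBasic_of_relBasis [HasBinaryBiproducts C] {T : C} {V : Type} [Fintype V]
    {R : V → V → Prop} (b : RelBasis K R (End T)) (hR : ∀ i, R i i) (ρ : V → ℕ)
    (hρ : ∀ i j, R i j → i ≠ j → ρ i < ρ j) : IsBasic T := by
  rintro X Y ⟨e⟩
  let i₁ : X ⟶ T := biprod.inl ≫ biprod.inl ≫ e.inv
  let i₂ : X ⟶ T := biprod.inr ≫ biprod.inl ≫ e.inv
  let p₁ : T ⟶ X := e.hom ≫ biprod.fst ≫ biprod.fst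
  let p₂ : T ⟶ X := e.hom ≫ biprod.fst ≫ biprod.snd
  have h11 : i₁ ≫ p₁ = 𝟙 X := by simp [i₁, p₁]
  have h12 : i₁ ≫ p₂ = 0 := by simp [i₁, p₂]
  have h22 : i₂ ≫ p₂ = 𝟙 X := by simp [i₂, p₂]
  -- The maps `x` and `y` interchange the two copies of `X`, so `y * x` and `x * y` are the
  -- orthogonal idempotents belonging to the two copies. Diagonal coefficients commute, so both
  -- idempotents have the same ones; as the product is zero, they vanish, and `y * x = 0`.
  let x : End T := (p₁ ≫ i₂ : T ⟶ T)
  let y : End T := (p₂ ≫ i₁ : T ⟶ T)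
  have hyx : y * x = (p₁ ≫ i₁ : T ⟶ T) := by
    change (p₁ ≫ i₂) ≫ (p₂ ≫ i₁) = _
    rw [Category.assoc, reassoc_of% h22]
  have hA : ∀ i j, R i j → R j i → i = j := fun i j h h' => by
    by_contra hij
    exact lt_asymm (hρ i j h hij) (hρ j i h' (Ne.symm hij))
  have h0 : y * x = 0 := by
    refine b.eq_zero_of_isIdempotentElem hR ρ hρ ?_ fun i => ?_
    · rw [hyx]
      change (p₁ ≫ i₁) ≫ (p₁ ≫ i₁) = p₁ ≫ i₁
      rw [Category.assoc, reassoc_of% h11]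
    · have hxy : (x * y) * (y * x) = 0 := by
        change ((p₁ ≫ i₂) ≫ (p₂ ≫ i₁)) ≫ ((p₂ ≫ i₁) ≫ (p₁ ≫ i₂)) = 0
        simp [reassoc_of% h12]
      have := congrArg (b.coef i i) hxy
      simp only [b.coef_self_mul hR hA, map_zero] at this
      rw [b.coef_self_mul hR hA]
      rw [mul_comm (b.coef i i y)] at this ⊢
      exact mul_self_eq_zero.1 this
  have h1 : p₁ ≫ i₁ = 0 := hyx.symm.trans h0
  rw [IsZero.iff_id_eq_zero]
  calc 𝟙 X = (i₁ ≫ p₁) ≫ (i₁ ≫ p₁) := by rw [h11, Category.comp_id]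
    _ = i₁ ≫ (p₁ ≫ i₁) ≫ p₁ := by simp
    _ = 0 := by rw [h1]; simp

/-- An object whose only endomorphisms are the scalars is indecomposable. -/
theorem indecomposable_of_span [HasBinaryBiproducts C] {X : C} (h0 : 𝟙 X ≠ 0)
    (h : ∀ φ : X ⟶ X, ∃ c : K, φ = c • 𝟙 X) : Indecomposable X := by
  refine ⟨fun h' => h0 (h'.eq_of_src _ _), fun Y Z e => ?_⟩
  obtain ⟨c, hc⟩ := h (e.hom ≫ biprod.fst ≫ biprod.inl ≫ e.inv)
  have h1 : (biprod.fst ≫ biprod.inl : Y ⊞ Z ⟶ Y ⊞ Z) = c • 𝟙 _ := by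
    have : e.inv ≫ (e.hom ≫ biprod.fst ≫ biprod.inl ≫ e.inv) ≫ e.hom =
        e.inv ≫ (c • 𝟙 X) ≫ e.hom := by rw [hc]
    simpa using this
  by_cases hc : c = 0
  · left
    rw [IsZero.iff_id_eq_zero]
    have : biprod.inl ≫ (biprod.fst ≫ biprod.inl : Y ⊞ Z ⟶ Y ⊞ Z) ≫ biprod.fst =
        biprod.inl ≫ (c • 𝟙 (Y ⊞ Z)) ≫ biprod.fst := by rw [h1]
    simpa [hc] using this
  · right
    rw [IsZero.iff_id_eq_zero]
    have : biprod.inr ≫ (biprod.fst ≫ biprod.inl : Y ⊞ Z ⟶ Y ⊞ Z) ≫ biprod.snd =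
        biprod.inr ≫ (c • 𝟙 (Y ⊞ Z)) ≫ biprod.snd := by rw [h1]
    have h2 : c • 𝟙 Z = 0 := by simpa using this.symm
    exact (smul_eq_zero.1 h2).resolve_left hc

end

end Silted

namespace Silted
open CategoryTheory CategoryTheory.Limits MulOpposite

/-! ### Modules over an algebra with a basis of matrix units -/

theorem projective_regular (A : Type u) [Ring A] : Module.Projective Aᵐᵒᵖ A :=
  Module.Projective.of_equiv (show Aᵐᵒᵖ ≃ₗ[Aᵐᵒᵖ] A from
    { toFun := unop
      invFun := op
      left_inv := fun _ => rfl
      right_inv := fun _ => rfl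
      map_add' := fun _ _ => rfl
      map_smul' := fun _ _ => rfl })

namespace RelBasis

variable {K : Type u} [Field K] {V : Type} {R : V → V → Prop} {A : Type u} [Ring A] [Algebra K A]
  (b : RelBasis K R A)

theorem smul_hom_apply {M N : RightMod A} (c : K) (φ : M ⟶ N) (x : M) :
    (c • φ).hom x = algebraMap K Aᵐᵒᵖ c • φ.hom x := rfl

/-- The right ideal generated by `el i i`. -/
def projSub (i : V) : Submodule Aᵐᵒᵖ A where
  carrier := {x | b.el i i * x = x}
  zero_mem' := mul_zero _
  add_mem' {x y} hx hy := by
    change _ * (x + y) = x + y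
    rw [mul_add, hx, hy]
  smul_mem' a x hx := by
    change b.el i i * (x * a.unop) = x * a.unop
    rw [← mul_assoc, hx]

/-- The indecomposable projective right module at the vertex `i`. -/
def P (i : V) : RightMod A := ModuleCat.of Aᵐᵒᵖ (b.projSub i)

/-- The inclusion of `P i` into `A`. -/
def val {i : V} : b.P i →ₗ[Aᵐᵒᵖ] A := (b.projSub i).subtype

/-- Elements of `P i` from elements of `A`. -/
def mkP {i : V} (x : A) (hx : b.el i i * x = x) : b.P i := (⟨x, hx⟩ : b.projSub i)

variable {b} in
theorem P_ext {i : V} {x y : b.P i} (h : b.val x = b.val y) : x = y := Subtype.ext h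

theorem val_mkP {i : V} (x : A) (hx : b.el i i * x = x) : b.val (b.mkP x hx) = x := rfl

theorem el_mul_val {i : V} (x : b.P i) : b.el i i * b.val x = b.val x :=
  Subtype.property (p := fun x => x ∈ b.projSub i) x

theorem val_smul {i : V} (a : Aᵐᵒᵖ) (x : b.P i) : b.val (a • x) = b.val x * a.unop := rfl

theorem el_self_mul_el (hR : ∀ i, R i i) (i j : V) : b.el i i * b.el i j = b.el i j := by
  by_cases h : R i j
  · exact b.mul_of_rel _ _ _ (hR i) h
  · rw [b.el_eq_zero _ _ h, mul_zero]

theorem el_mul_el_self (hR : ∀ i, R i i) (i j : V) : b.el i j * b.el j j = b.el i j := by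
  by_cases h : R i j
  · exact b.mul_of_rel _ _ _ h (hR j)
  · rw [b.el_eq_zero _ _ h, zero_mul]

/-- The generator of `P i`. -/
def gen (hR : ∀ i, R i i) (i : V) : b.P i := b.mkP (b.el i i) (b.el_self_mul_el hR i i)

theorem val_gen (hR : ∀ i, R i i) (i : V) : b.val (b.gen hR i) = b.el i i := rfl

theorem op_smul_gen (hR : ∀ i, R i i) {i : V} (x : b.P i) : op (b.val x) • b.gen hR i = x :=
  P_ext (b.el_mul_val x)

theorem gen_smul (hR : ∀ i, R i i) (i : V) : op (b.el i i) • b.gen hR i = b.gen hR i :=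
  P_ext (b.el_self_mul_el hR i i)

/-- The homomorphism from `P i` that maps the generator to `m • el i i`. -/
def fromP {M : RightMod A} (i : V) (m : M) : b.P i ⟶ M :=
  ConcreteCategory.ofHom (C := RightMod A) (X := b.P i) (Y := M)
    { toFun := fun x => op (b.val x) • m
      map_add' := fun x y => by rw [← add_smul, map_add, MulOpposite.op_add]
      map_smul' := fun a x => by
        rw [val_smul, op_mul, mul_smul]; rfl }

theorem fromP_apply {M : RightMod A} (i : V) (m : M) (x : b.P i) :
    (b.fromP i m).hom x = op (b.val x) • m := rfl

theorem P_hom_ext (hR : ∀ i, R i i) {M : RightMod A} {i : V} {f g : b.P i ⟶ M}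
    (h : f.hom (b.gen hR i) = g.hom (b.gen hR i)) : f = g := by
  refine ModuleCat.hom_ext (LinearMap.ext fun x => ?_)
  rw [← b.op_smul_gen hR x, map_smul, map_smul, h]

theorem hom_gen (hR : ∀ i, R i i) {M : RightMod A} {i : V} (f : b.P i ⟶ M) :
    op (b.el i i) • f.hom (b.gen hR i) = f.hom (b.gen hR i) := by
  rw [← map_smul, b.gen_smul hR]

theorem finite_P (hR : ∀ i, R i i) (i : V) : Module.Finite Aᵐᵒᵖ (b.P i) :=
  ⟨⟨{b.gen hR i}, by
    rw [Finset.coe_singleton, eq_top_iff]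
    intro x _
    rw [← b.op_smul_gen hR x]
    exact Submodule.smul_mem _ _ (Submodule.mem_span_singleton_self _)⟩⟩

/-- The projection from `A` onto `P i`. -/
def toP (hR : ∀ i, R i i) (i : V) : ModuleCat.of Aᵐᵒᵖ A ⟶ b.P i :=
  ConcreteCategory.ofHom (C := RightMod A) (X := ModuleCat.of Aᵐᵒᵖ A) (Y := b.P i)
    { toFun := fun x => b.mkP (b.el i i * x) (by
        rw [← mul_assoc, b.mul_of_rel i i i (hR i) (hR i)])
      map_add' := fun x y => P_ext (mul_add _ _ _)
      map_smul' := fun a x => P_ext (mul_assoc _ _ _).symm }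

/-- The decomposition of the regular module. -/
noncomputable def decompRegular [Fintype V] (hR : ∀ i, R i i) :
    Decomp (ModuleCat.of Aᵐᵒᵖ A) b.P where
  inc i := ConcreteCategory.ofHom (C := RightMod A) (X := b.P i) (Y := ModuleCat.of Aᵐᵒᵖ A) b.val
  prj := b.toP hR
  inc_prj_self i := ModuleCat.hom_ext (LinearMap.ext fun x => P_ext (b.el_mul_val x))
  inc_prj_ne i j h := ModuleCat.hom_ext <| LinearMap.ext fun x => P_ext <| by
    change b.el j j * b.val x = 0
    rw [← b.el_mul_val x, ← mul_assoc, b.mul_of_ne _ _ _ _ h.symm, zero_mul]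
  total := ModuleCat.hom_ext <| LinearMap.ext fun x => by
    simp only [ModuleCat.hom_sum, LinearMap.sum_apply]
    change ∑ i, b.el i i * x = x
    rw [← Finset.sum_mul, b.sum_el_self hR, one_mul]

theorem projective_P (hR : ∀ i, R i i) (i : V) : Module.Projective Aᵐᵒᵖ (b.P i) :=
  have := projective_regular A
  Module.Projective.of_split b.val (b.toP hR i).hom
    (LinearMap.ext fun x => P_ext (b.el_mul_val x))

theorem projective_P' (hR : ∀ i, R i i) (i : V) : Projective (b.P i) :=
  (IsProjective.iff_projective (b.P i)).1 (b.projective_P hR i)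

/-- The canonical homomorphism from `P j` to `P i`. -/
def u (hR : ∀ i, R i i) (j i : V) : b.P j ⟶ b.P i :=
  b.fromP j (b.mkP (b.el i j) (b.el_self_mul_el hR i j))

theorem val_u_gen (hR : ∀ i, R i i) (j i : V) :
    b.val ((b.u hR j i).hom (b.gen hR j)) = b.el i j := b.el_mul_el_self hR i j

theorem val_u (hR : ∀ i, R i i) (j i : V) (x : b.P j) :
    b.val ((b.u hR j i).hom x) = b.el i j * b.val x := rfl

theorem u_of_not (hR : ∀ i, R i i) {j i : V} (h : ¬ R i j) : b.u hR j i = 0 :=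
  b.P_hom_ext hR (P_ext (by rw [val_u_gen]; exact b.el_eq_zero _ _ h))

theorem u_ne_zero (hR : ∀ i, R i i) {j i : V} (h : R i j) : b.u hR j i ≠ 0 := fun h0 => by
  have := b.val_u_gen hR j i
  rw [h0] at this
  exact b.el_ne_zero h this.symm

theorem u_self (hR : ∀ i, R i i) (i : V) : b.u hR i i = 𝟙 _ :=
  b.P_hom_ext hR (P_ext (b.val_u_gen hR i i))

theorem u_comp (hR : ∀ i, R i i) {k j i : V} (h : R i j) (h' : R j k) :
    b.u hR k j ≫ b.u hR j i = b.u hR k i := b.P_hom_ext hR <| P_ext <| by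
  rw [val_u_gen, ModuleCat.comp_apply, val_u, val_u_gen, b.mul_of_rel _ _ _ h h']

/-- A homomorphism is determined by the image of the generator, which lies in the corner between `el
i i` and `el j j`, and this corner is spanned by `el i j`. -/
theorem u_span (hR : ∀ i, R i i) {j i : V} (φ : b.P j ⟶ b.P i) : ∃ c : K, φ = c • b.u hR j i := by
  refine ⟨b.coef i j (b.val (φ.hom (b.gen hR j))), b.P_hom_ext hR (P_ext ?_)⟩
  rw [smul_hom_apply, val_smul, val_u_gen]
  have h2 : b.val (φ.hom (b.gen hR j)) * b.el j j = b.val (φ.hom (b.gen hR j)) :=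
    congrArg b.val (b.hom_gen hR φ)
  conv_lhs => rw [← h2, ← b.el_mul_val (φ.hom (b.gen hR j)), b.el_mul_mul_el hR]
  simp only [MulOpposite.algebraMap_apply, unop_op, ← Algebra.commutes, ← Algebra.smul_def]

/-- The table of homomorphisms between the indecomposable projective modules. -/
noncomputable def homTableP (hR : ∀ i, R i i) : HomTable K b.P (fun j i => R i j) where
  f := b.u hR
  span _ _ := b.u_span hR
  zero _ _ := b.u_of_not hR
  ne_zero _ _ := b.u_ne_zero hR
  id := b.u_self hR
  comp _ _ _ h h' _ := b.u_comp hR h' h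

theorem id_P_ne_zero (hR : ∀ i, R i i) (i : V) : 𝟙 (b.P i) ≠ 0 := by
  rw [← b.u_self hR]; exact b.u_ne_zero hR (hR i)

end RelBasis

end Silted

namespace Silted
open CategoryTheory CategoryTheory.Limits MulOpposite

set_option linter.unusedSectionVars false

namespace RelBasis

variable {K : Type u} [Field K] {V : Type} {R : V → V → Prop} {A : Type u} [Ring A] [Algebra K A]
  (b : RelBasis K R A)

/-! #### Thin modules -/

section

variable [Fintype V] [DecidableEq V]

/-- The reflexive and transitive relations. -/
structure IsPreord (R : V → V → Prop) : Prop where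
  refl : ∀ i, R i i
  trans : ∀ i j k, R i j → R j k → R i k

/-- Convex sets of vertices. -/
def IsConvex (R : V → V → Prop) (s : Finset V) : Prop :=
  ∀ i j k, i ∈ s → k ∈ s → R i j → R j k → j ∈ s

/-- This is where convexity enters: an intermediate vertex between two vertices of `s` lies in `s`,
so truncating the matrix of coefficients to `s` is multiplicative and the thin module is a module.
-/
theorem sum_coef_mul_coef (hR : IsPreord R) {s : Finset V} (hs : IsConvex R s) (v w : s)
    (x y : A) : b.coef v w (x * y) = ∑ k : s, b.coef v k x * b.coef k w y := by
  rw [b.coef_mul hR.trans, Finset.sum_coe_sort s fun k => b.coef v k x * b.coef k w y]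
  refine (Finset.sum_subset (Finset.subset_univ s) fun k _ hk => ?_).symm
  by_cases h1 : R v k
  · have h2 : ¬ R k w := fun h2 => hk (hs _ _ _ v.2 w.2 h1 h2)
    rw [b.coef_of_not h2]; simp
  · rw [b.coef_of_not h1]; simp

/-- The action of `A` on the thin module with support `s`. -/
noncomputable abbrev thinModule (hR : IsPreord R) {s : Finset V} (hs : IsConvex R s) : Module Aᵐᵒᵖ (s → K) where
  smul a f := fun w => ∑ v, f v * b.coef v w a.unop
  one_smul f := funext fun w => by
    change ∑ v, f v * b.coef v w 1 = f w
    simp only [b.coef_one hR.refl]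
    rw [Finset.sum_eq_single w]
    · simp
    · intro v _ hv
      rw [if_neg fun h => hv (Subtype.ext h), mul_zero]
    · simp
  mul_smul a a' f := funext fun w => by
    change ∑ v, f v * b.coef v w (a'.unop * a.unop) =
      ∑ k : s, (∑ v : s, f v * b.coef v k a'.unop) * b.coef k w a.unop
    simp only [b.sum_coef_mul_coef hR hs, Finset.mul_sum, Finset.sum_mul, mul_assoc]
    exact Finset.sum_comm
  smul_zero a := funext fun w => by
    change ∑ v, (0 : K) * _ = 0
    simp
  smul_add a f g := funext fun w => by
    change ∑ v, (f v + g v) * _ = ∑ v, f v * _ + ∑ v, g v * _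
    simp only [add_mul, Finset.sum_add_distrib]
  add_smul a a' f := funext fun w => by
    change ∑ v, f v * b.coef v w (a.unop + a'.unop) = ∑ v, f v * _ + ∑ v, f v * _
    simp only [map_add, mul_add, Finset.sum_add_distrib]
  zero_smul f := funext fun w => by
    change ∑ v, f v * b.coef v w 0 = 0
    simp

/-- The module which has a basis indexed by the vertices in `s`, on which `el i j` maps the basis
vector of `i` to that of `j`, if both belong to `s`. -/
noncomputable def thin (hR : IsPreord R) {s : Finset V} (hs : IsConvex R s) : RightMod A :=
  letI := b.thinModule hR hs
  ModuleCat.of Aᵐᵒᵖ (s → K)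

/-- The coordinates of an element of a thin module. -/
noncomputable def coord {hR : IsPreord R} {s : Finset V} {hs : IsConvex R s} (w : s) : b.thin hR hs →+ K :=
  Pi.evalAddMonoidHom (fun _ : s => K) w

/-- Elements of a thin module given by coordinates. -/
noncomputable def mkThin (hR : IsPreord R) {s : Finset V} (hs : IsConvex R s) (f : s → K) : b.thin hR hs := f

section

variable {hR : IsPreord R} {s : Finset V} {hs : IsConvex R s}

theorem coord_mkThin (f : s → K) (w : s) : b.coord w (b.mkThin hR hs f) = f w := rfl

variable {b} in
theorem thin_ext {x y : b.thin hR hs} (h : ∀ w, b.coord w x = b.coord w y) : x = y := funext h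

theorem coord_smul (a : Aᵐᵒᵖ) (x : b.thin hR hs) (w : s) :
    b.coord w (a • x) = ∑ v : s, b.coord v x * b.coef v w a.unop := rfl

theorem coord_el_smul {i j : V} (hij : R i j) (x : b.thin hR hs) (w : s) :
    b.coord w (op (b.el i j) • x) =
      if h : i ∈ s ∧ j = w then b.coord ⟨i, h.1⟩ x else 0 := by
  rw [coord_smul]
  simp only [unop_op, b.coef_el _ _ _ _ hij]
  split_ifs with h
  · rw [Finset.sum_eq_single ⟨i, h.1⟩]
    · simp [h.2]
    · intro v _ hv
      rw [if_neg fun h' => hv (Subtype.ext h'.1), mul_zero]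
    · simp
  · refine Finset.sum_eq_zero fun v _ => ?_
    rw [if_neg, mul_zero]
    rintro ⟨rfl, rfl⟩
    exact h ⟨v.2, rfl⟩

variable (hs) in
/-- Homomorphisms to a thin module from a system of linear forms. -/
noncomputable def toThin (hR : IsPreord R) {M : RightMod A} (lam : s → M →+ K)
    (h₀ : ∀ w (c : K) m, lam w (algebraMap K Aᵐᵒᵖ c • m) = c * lam w m)
    (h : ∀ v (w : s) m, R v w →
      lam w (op (b.el v w) • m) = if hv : v ∈ s then lam ⟨v, hv⟩ m else 0) :
    M ⟶ b.thin hR hs :=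
  ConcreteCategory.ofHom (C := RightMod A) (X := M) (Y := b.thin hR hs)
    { toFun := fun m => b.mkThin hR hs fun w => lam w m
      map_add' := fun m n => b.thin_ext fun w => map_add (lam w) m n
      map_smul' := fun a m => b.thin_ext fun w => by
        classical
        rw [RingHom.id_apply, coord_smul]
        simp only [coord_mkThin]
        -- Units ending in `w` are covered by the hypothesis `h`. A unit ending in another vertex
        -- moves `m` to the part at that vertex, on which the form `lam w` vanishes.
        have h1 : ∀ i j, lam w (op (b.el i j) • m) =
            if j = w then (if hi : i ∈ s then lam ⟨i, hi⟩ m * (if R i j then 1 else 0) else 0)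
              else 0 := by
          intro i j
          by_cases hij : R i j
          · split_ifs with h2 h3
            · subst h2; rw [h i w m hij, dif_pos h3, mul_one]
            · subst h2; rw [h i w m hij, dif_neg h3]
            · have h4 := h w w (op (b.el i j) • m) (hR.refl _)
              rw [dif_pos w.2, smul_smul, ← op_mul, b.mul_of_ne _ _ _ _ h2] at h4
              rw [← h4, MulOpposite.op_zero, zero_smul, map_zero]
          · rw [b.el_eq_zero _ _ hij, MulOpposite.op_zero, zero_smul, map_zero]
            simp [hij]
        have h2 : a = ∑ i, ∑ j, algebraMap K Aᵐᵒᵖ (b.coef i j a.unop) * op (b.el i j) := by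
          conv_lhs => rw [← op_unop a, b.sum_coef a.unop]
          simp only [Finset.op_sum, ← Algebra.smul_def, MulOpposite.op_smul]
        have h3 : lam w (a • m) = ∑ i, ∑ j, b.coef i j a.unop * lam w (op (b.el i j) • m) := by
          conv_lhs => rw [h2]
          simp only [Finset.sum_smul, map_sum, mul_smul, h₀]
        rw [h3]
        simp only [h1]
        have h4 : ∀ i : V, (∑ j, b.coef i j a.unop *
            (if j = w then (if hi : i ∈ s then lam ⟨i, hi⟩ m * (if R i j then 1 else 0) else 0)
              else 0)) = if hi : i ∈ s then lam ⟨i, hi⟩ m * b.coef i w a.unop else 0 := by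
          intro i
          rw [Finset.sum_eq_single (w : V)]
          · by_cases hi : i ∈ s
            · by_cases hiw : R i w
              · simp [hi, hiw, mul_comm]
              · rw [b.coef_of_not hiw]; simp
            · simp [hi]
          · intro j _ hj; simp [hj]
          · simp
        simp only [h4]
        rw [← Finset.sum_subset (Finset.subset_univ s), ← Finset.sum_coe_sort s]
        · refine Finset.sum_congr rfl fun v _ => ?_
          rw [dif_pos v.2]
        · intro i _ hi
          rw [dif_neg hi] }

theorem coord_toThin {M : RightMod A} (lam : s → M →+ K) (h₀) (h) (m : M) (w : s) :
    b.coord w ((b.toThin hs hR lam h₀ h).hom m) = lam w m := rfl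

variable (hR hs) in
/-- The map from `P i` that sends the generator to the basis vector of the vertex `i`. -/
noncomputable def projThin {i : V} (hi : i ∈ s) : b.P i ⟶ b.thin hR hs :=
  b.fromP i (b.mkThin hR hs (Pi.single ⟨i, hi⟩ 1))

theorem coord_projThin {i : V} (hi : i ∈ s) (x : b.P i) (w : s) :
    b.coord w ((b.projThin hR hs hi).hom x) = b.coef i w (b.val x) := by
  rw [projThin, fromP_apply, coord_smul, Finset.sum_eq_single ⟨i, hi⟩]
  · simp [coord_mkThin]
  · intro v _ hv; simp [coord_mkThin, hv]
  · simp

theorem coef_val_of_ne (hR : ∀ i, R i i) {i k w : V} (x : b.P i) (h : k ≠ i) :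
    b.coef k w (b.val x) = 0 := by
  by_cases hw : R k w
  · have h2 : b.coef k w (b.val x) • b.el k w = 0 := by
      rw [← b.el_mul_mul_el hR, ← b.el_mul_val x, ← mul_assoc, b.mul_of_ne _ _ _ _ h, zero_mul,
        zero_mul]
    exact (smul_eq_zero.1 h2).resolve_right (b.el_ne_zero hw)
  · rw [b.coef_of_not hw]; simp

theorem val_eq_sum (hR : ∀ i, R i i) {i : V} (x : b.P i) :
    b.val x = ∑ w, b.coef i w (b.val x) • b.el i w := by
  conv_lhs => rw [b.sum_coef (b.val x)]
  rw [Finset.sum_eq_single i]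
  · intro k _ hk
    exact Finset.sum_eq_zero fun w _ => by rw [b.coef_val_of_ne hR x hk, zero_smul]
  · simp

/-- The element of `P i` with given coefficients. -/
noncomputable def ofCoef (hR : ∀ i, R i i) (i : V) (c : V → K) : b.P i :=
  b.mkP (∑ w, c w • b.el i w) <| by
    rw [Finset.mul_sum]
    exact Finset.sum_congr rfl fun w _ => by rw [mul_smul_comm, b.el_self_mul_el hR]

theorem coef_val_ofCoef (hR : ∀ i, R i i) {i w : V} (h : R i w) (c : V → K) :
    b.coef i w (b.val (b.ofCoef hR i c)) = c w := by
  rw [ofCoef, val_mkP, map_sum, Finset.sum_eq_single w]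
  · rw [map_smul, b.coef_el _ _ _ _ h]; simp
  · intro v _ hv
    rw [map_smul]
    by_cases hiv : R i v
    · rw [b.coef_el _ _ _ _ hiv, if_neg fun h => hv h.2.symm, smul_zero]
    · rw [b.el_eq_zero _ _ hiv]; simp
  · simp

theorem P_ext_coef (hR : ∀ i, R i i) {i : V} {x y : b.P i}
    (h : ∀ w, R i w → b.coef i w (b.val x) = b.coef i w (b.val y)) : x = y := by
  refine P_ext ?_
  rw [b.val_eq_sum hR x, b.val_eq_sum hR y]
  refine Finset.sum_congr rfl fun w _ => ?_
  by_cases hw : R i w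
  · rw [h w hw]
  · rw [b.el_eq_zero _ _ hw]; simp

theorem coef_val_u (hR : IsPreord R) {i j w : V} (hij : R i j) (x : b.P j) :
    b.coef i w (b.val ((b.u hR.refl j i).hom x)) = b.coef j w (b.val x) := by
  rw [val_u, b.coef_mul hR.trans, Finset.sum_eq_single j]
  · rw [b.coef_el _ _ _ _ hij]; simp
  · intro k _ hk
    rw [b.coef_el _ _ _ _ hij, if_neg fun h => hk h.2, zero_mul]
  · simp

theorem coef_val_u_of_not (hR : IsPreord R) {i j w : V} (hij : R i j) (hjw : ¬ R j w)
    (x : b.P j) : b.coef i w (b.val ((b.u hR.refl j i).hom x)) = 0 := by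
  rw [val_u, b.coef_mul hR.trans]
  refine Finset.sum_eq_zero fun k _ => ?_
  rw [b.coef_el _ _ _ _ hij]
  by_cases hk : k = j
  · subst hk; rw [b.coef_of_not hjw]; simp
  · rw [if_neg fun h => hk h.2, zero_mul]

theorem projThin_surjective {i : V} (hi : i ∈ s) (hs' : ∀ w ∈ s, R i w) :
    Function.Surjective (b.projThin hR hs hi).hom := fun y => by
  refine ⟨b.ofCoef hR.refl i fun w => if h : w ∈ s then b.coord ⟨w, h⟩ y else 0, ?_⟩
  refine b.thin_ext fun w => ?_
  rw [coord_projThin, coef_val_ofCoef _ _ (hs' w w.2), dif_pos w.2]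

/-- If the support of a thin module consists of the vertices that can be reached from `i`, but not
from `j`, then `P j ⟶ P i` is a presentation of the module. -/
theorem exists_of_projThin_eq_zero {i j : V} (hi : i ∈ s) (hij : R i j)
    (hs' : ∀ w, R i w → (w ∈ s ↔ ¬ R j w)) (x : b.P i) (hx : (b.projThin hR hs hi).hom x = 0) :
    ∃ y, (b.u hR.refl j i).hom y = x := by
  refine ⟨b.ofCoef hR.refl j fun w => b.coef i w (b.val x), b.P_ext_coef hR.refl fun w hw => ?_⟩
  by_cases hjw : R j w
  · rw [b.coef_val_u hR hij, b.coef_val_ofCoef _ hjw]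
  · rw [b.coef_val_u_of_not hR hij hjw, ← b.coord_projThin (hR := hR) (hs := hs) hi x ⟨w, (hs' w hw).2 hjw⟩, hx,
      map_zero]

theorem u_projThin {i j : V} (hi : i ∈ s) (hij : R i j) (hs' : ∀ w, R j w → w ∉ s) :
    b.u hR.refl j i ≫ b.projThin hR hs hi = 0 := by
  refine b.P_hom_ext hR.refl (b.thin_ext fun w => ?_)
  rw [ModuleCat.comp_apply, coord_projThin, b.coef_val_u_of_not hR hij fun h => hs' w h w.2]
  exact (map_zero (b.coord w)).symm

theorem projThin_injective {i : V} (hi : i ∈ s) (hs' : ∀ w, R i w → w ∈ s) (x : b.P i)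
    (hx : (b.projThin hR hs hi).hom x = 0) : x = 0 := by
  refine b.P_ext_coef hR.refl fun w hw => ?_
  rw [← b.coord_projThin (hR := hR) (hs := hs) hi x ⟨w, hs' w hw⟩, hx]
  simp

end

end

end RelBasis

end Silted

namespace Silted
open CategoryTheory CategoryTheory.Limits MulOpposite

/-! ### Tilting modules given by decompositions -/

section

variable {C : Type*} [Category C] [Abelian C] [HasExt.{w} C]

open Abelian

theorem Decomp.ext_eq_zero {T : C} {κ : Type} [Fintype κ] {X : κ → C} (D : Decomp T X) {Y : C}
    {n : ℕ} (h : ∀ k, ∀ e : Ext (X k) Y n, e = 0) (e : Ext T Y n) : e = 0 := by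
  rw [← Ext.mk₀_id_comp e, ← D.total, Ext.mk₀_sum, Ext.sum_comp]
  refine Finset.sum_eq_zero fun k _ => ?_
  rw [← Ext.mk₀_comp_mk₀_assoc, h k ((Ext.mk₀ _).comp e _), Ext.comp_zero]

/-- By the long exact sequence, Ext¹ of the quotient is the cokernel of restriction from Hom(X₂, Y)
to Hom(X₁, Y) as soon as X₂ is projective. -/
theorem ext_eq_zero_of_presentation {S : ShortComplex C} (hS : S.ShortExact) [Projective S.X₂]
    {Y : C} (h : ∀ f : S.X₁ ⟶ Y, ∃ g, S.f ≫ g = f) (e : Ext S.X₃ Y 1) : e = 0 := by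
  obtain ⟨x, rfl⟩ := Ext.contravariant_sequence_exact₃ hS Y e (Ext.eq_zero_of_projective _)
    (n₀ := 0) rfl
  obtain ⟨f, rfl⟩ := Ext.addEquiv₀.symm.surjective x
  obtain ⟨g, rfl⟩ := h f
  change hS.extClass.comp (Ext.mk₀ (S.f ≫ g)) _ = 0
  rw [← Ext.mk₀_comp_mk₀, hS.extClass_comp_assoc]

end

theorem Decomp.hasProjectiveDimensionLT {C : Type*} [Category C] [Abelian C] {T : C} {κ : Type}
    [Fintype κ] {X : κ → C} (D : Decomp T X) (n : ℕ) (h : ∀ k, HasProjectiveDimensionLT (X k) n) :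
    HasProjectiveDimensionLT T n := by
  let := HasExt.standard C
  rw [hasProjectiveDimensionLT_iff T n]
  exact fun i hi Y e => D.ext_eq_zero
    (fun k e => (hasProjectiveDimensionLT_iff (X k) n).1 (h k) i hi e) e

section

variable {K : Type u} [Field K] {C : Type*} [Category C] [Preadditive C] [Linear K C]
  [HasFiniteBiproducts C] [HasBinaryBiproducts C]

/-- The summands are indecomposable because their endomorphisms are scalars. They are pairwise
non-isomorphic because an isomorphism would give nonzero morphisms in both directions, which
antisymmetry excludes. -/
theorem HomTable.hasNumSummands {T : C} {κ : Type} [Fintype κ] {X : κ → C} {R : κ → κ → Prop}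
    (H : HomTable K X R) (hR : ∀ k, R k k) (hR' : ∀ k l, R k l → R l k → k = l) (D : Decomp T X) :
    HasNumSummands T (Fintype.card κ) := by
  have h1 : ∀ k, 𝟙 (X k) ≠ 0 := fun k => by rw [← H.id]; exact H.ne_zero k k (hR k)
  have h2 : ∀ k l (φ : X k ⟶ X l), φ ≠ 0 → R k l := fun k l φ hφ => by
    by_contra hkl
    obtain ⟨c, hc⟩ := H.span k l φ
    rw [H.zero k l hkl, smul_zero] at hc
    exact hφ hc
  let σ := Fintype.equivFin κ
  refine ⟨fun i => X (σ.symm i), fun _ => 1, fun i => ?_, fun i j hij => ⟨fun e => ?_⟩,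
    fun _ => one_pos, ⟨?_⟩⟩
  · refine indecomposable_of_span (K := K) (h1 _) fun φ => ?_
    rw [← H.id]; exact H.span _ _ φ
  · refine hij (σ.symm.injective (hR' _ _ (h2 _ _ e.hom fun h => h1 (σ.symm i) ?_)
      (h2 _ _ e.inv fun h => h1 (σ.symm i) ?_)))
    · rw [← e.hom_inv_id, h, zero_comp]
    · rw [← e.hom_inv_id, h, comp_zero]
  · exact (D.reindex ((Equiv.sigmaUnique (Fin _) fun _ => Fin 1).trans σ.symm)).iso
      (Decomp.biproduct _)

end

theorem RelBasis.hasNumSummands_regular {K : Type u} [Field K] {V : Type} [Fintype V]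
    {R : V → V → Prop} {A : Type u} [Ring A] [Algebra K A] (b : RelBasis K R A) (hR : ∀ i, R i i)
    (hR' : ∀ i j, R i j → R j i → i = j) :
    HasNumSummands (ModuleCat.of Aᵐᵒᵖ A) (Fintype.card V) :=
  (b.homTableP hR).hasNumSummands hR (fun _ _ h h' => hR' _ _ h' h) (b.decompRegular hR)

theorem Decomp.finite {A : Type u} [Ring A] {T : RightMod A} {κ : Type} [Fintype κ]
    {X : κ → RightMod A} (D : Decomp T X) (h : ∀ k, Module.Finite Aᵐᵒᵖ (X k)) :
    Module.Finite Aᵐᵒᵖ T := by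
  refine Module.Finite.of_surjective
    (∑ k, (D.inc k).hom ∘ₗ LinearMap.proj k : (∀ k, X k) →ₗ[Aᵐᵒᵖ] T) fun x =>
      ⟨fun k => (D.prj k).hom x, ?_⟩
  have := congrArg (fun φ : T ⟶ T => φ.hom x) D.total
  simpa [ModuleCat.hom_sum] using this

/-- For the regular module the tilting conditions hold by projectivity, and its endomorphism algebra
has the relation of the path algebra again. This settles all listed algebras that are path algebras.
-/
theorem isTilted_regular {K : Type u} [Field K] {V : Type} [Fintype V] [DecidableEq V]
    {r R : V → V → Prop} (h : IsReach r R) (hR' : ∀ i j, R i j → R j i → i = j)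
    {B : Type v} [Ring B] [Algebra K B] {V' : Type} {R' : V' → V' → Prop} (b' : RelBasis K R' B)
    (σ : V' ≃ V) (hσ : ∀ i j, R' i j ↔ R (σ i) (σ j)) : IsTilted K (RelQuiver r) B := by
  let b := h.relBasis K
  have hP := projective_regular (PathAlgebra K (RelQuiver r))
  have : Projective (ModuleCat.of (PathAlgebra K (RelQuiver r))ᵐᵒᵖ (PathAlgebra K (RelQuiver r))) :=
    (IsProjective.iff_projective _).1 hP
  have hn := b.hasNumSummands_regular h.refl hR'
  have hfin : Module.Finite (PathAlgebra K (RelQuiver r))ᵐᵒᵖ (PathAlgebra K (RelQuiver r)) :=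
    Decomp.finite (b.decompRegular h.refl) (b.finite_P h.refl)
  obtain ⟨c⟩ := (b.homTableP h.refl).nonempty_relBasis (b.decompRegular h.refl)
  exact ⟨_, ⟨hfin, hasProjectiveDimensionLT_of_ge _ 1 2 (by decide),
    ⟨fun x y => by rw [Abelian.Ext.eq_zero_of_projective x, Abelian.Ext.eq_zero_of_projective y]⟩,
    ⟨_, hn, hn⟩⟩, b'.nonempty_algEquiv c σ hσ⟩

namespace RelBasis

variable {K : Type u} [Field K] {V : Type} {R : V → V → Prop} {A : Type u} [Ring A] [Algebra K A]
  (b : RelBasis K R A) [Fintype V] [DecidableEq V] (hR : IsPreord R) {s : Finset V}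
  (hs : IsConvex R s)

theorem coord_algebraMap_smul (c : K) (x : b.thin hR hs) (w : s) :
    b.coord w (algebraMap K Aᵐᵒᵖ c • x) = c * b.coord w x := by
  rw [coord_smul, Finset.sum_eq_single w]
  · rw [MulOpposite.algebraMap_apply, unop_op, Algebra.algebraMap_eq_smul_one, map_smul,
      b.coef_one hR.refl]
    simp [mul_comm]
  · intro v _ hv
    rw [MulOpposite.algebraMap_apply, unop_op, Algebra.algebraMap_eq_smul_one, map_smul,
      b.coef_one hR.refl, if_neg fun h => hv (Subtype.ext h)]
    simp
  · simp

theorem coord_hom_gen {i : V} (φ : b.P i ⟶ b.thin hR hs) (w : s) (h : i ≠ w) :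
    b.coord w (φ.hom (b.gen hR.refl i)) = 0 := by
  rw [← b.hom_gen hR.refl φ, coord_el_smul _ (hR.refl i), dif_neg fun h' => h h'.2]

theorem hom_thin_eq_zero {i : V} (hi : i ∉ s) (φ : b.P i ⟶ b.thin hR hs) : φ = 0 :=
  b.P_hom_ext hR.refl <| b.thin_ext fun w =>
    (b.coord_hom_gen hR hs φ w fun h => hi (h ▸ w.2)).trans (map_zero (b.coord w)).symm

theorem projThin_span {i : V} (hi : i ∈ s) (φ : b.P i ⟶ b.thin hR hs) :
    ∃ c : K, φ = c • b.projThin hR hs hi := by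
  refine ⟨b.coord ⟨i, hi⟩ (φ.hom (b.gen hR.refl i)), b.P_hom_ext hR.refl <| b.thin_ext fun w => ?_⟩
  rw [smul_hom_apply, coord_algebraMap_smul, coord_projThin, val_gen, b.coef_el _ _ _ _ (hR.refl i)]
  by_cases h : i = w
  · rw [if_pos ⟨rfl, h.symm⟩, mul_one]; congr 1; exact congrArg b.coord (Subtype.ext h.symm)
  · rw [b.coord_hom_gen hR hs φ w h, if_neg fun h' => h h'.2.symm, mul_zero]

theorem projThin_ne_zero {i : V} (hi : i ∈ s) : b.projThin hR hs hi ≠ 0 := fun h => by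
  have := b.coord_projThin (hR := hR) (hs := hs) hi (b.gen hR.refl i) ⟨i, hi⟩
  rw [h, val_gen, b.coef_el _ _ _ _ (hR.refl i), if_pos ⟨rfl, rfl⟩] at this
  exact zero_ne_one ((map_zero (b.coord _)).symm.trans this)

theorem u_injective {i j : V} (hij : R i j) :
    Function.Injective (b.u hR.refl j i).hom := by
  refine (injective_iff_map_eq_zero _).2 fun x hx => b.P_ext_coef hR.refl fun w hw => ?_
  rw [← b.coef_val_u hR hij, hx]; simp

theorem shortExact_thin {i j : V} (hi : i ∈ s) (hij : R i j)
    (hs₁ : ∀ w ∈ s, R i w) (hs₂ : ∀ w, R i w → (w ∈ s ↔ ¬ R j w)) (hs₃ : ∀ w, R j w → w ∉ s) :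
    (ShortComplex.mk _ _ (b.u_projThin (hR := hR) (hs := hs) hi hij hs₃)).ShortExact where
  exact := (ShortComplex.moduleCat_exact_iff _).2 fun x hx =>
    b.exists_of_projThin_eq_zero hi hij hs₂ x hx
  mono_f := (ModuleCat.mono_iff_injective _).2 (b.u_injective hR hij)
  epi_g := (ModuleCat.epi_iff_surjective _).2 (b.projThin_surjective hi hs₁)

end RelBasis

/-- Renaming the vertices. -/
noncomputable def RelBasis.reindex {K : Type u} [Field K] {V V' : Type} {R : V → V → Prop}
    {R' : V' → V' → Prop} {B : Type*} [Ring B] [Algebra K B] (b : RelBasis K R B) (σ : V' ≃ V)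
    (h : ∀ i j, R (σ i) (σ j) ↔ R' i j) : RelBasis K R' B where
  el i j := b.el (σ i) (σ j)
  basis := b.basis.reindex ((Equiv.prodCongr σ σ).subtypeEquiv fun p => (h p.1 p.2).symm).symm
  basis_apply p := by
    rw [Module.Basis.reindex_apply, b.basis_apply]; rfl
  el_eq_zero i j hij := b.el_eq_zero _ _ fun h' => hij ((h i j).1 h')
  mul_of_ne i j k l hjk := b.mul_of_ne _ _ _ _ fun h' => hjk (σ.injective h')
  mul_of_rel i j k h1 h2 := b.mul_of_rel _ _ _ ((h i j).2 h1) ((h j k).2 h2)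

/-- The tilting module is P 2 ⊕ P 0 ⊕ S, where S = P 0 / P 1 is the simple module at 0. The maps P 2
→ P 0 → S compose to zero since 2 is not in the support of S, which gives the zero relation. The
endomorphism algebra serves a second time as the model for the quotient algebra `RelA3`. -/
theorem isTilted_relA3 (K : Type u) [Field K] :
    ∃ (B : Type u) (_ : Ring B) (_ : Algebra K B), Nonempty (RelBasis K relRelA3 B) ∧
      IsTilted K (RelQuiver linearA3) B := by
  let b := isReach_linearA3.relBasis K
  have hR : RelBasis.IsPreord (fun i j : Fin 3 => i ≤ j) := ⟨le_refl, fun _ _ _ => le_trans⟩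
  have hs : RelBasis.IsConvex (fun i j : Fin 3 => i ≤ j) {0} := by
    unfold RelBasis.IsConvex; decide
  let S := b.thin hR hs
  let π : b.P 0 ⟶ S := b.projThin hR hs (by decide)
  have hπ : Epi π := (ModuleCat.epi_iff_surjective _).2 (b.projThin_surjective _ (by decide))
  have hex := b.shortExact_thin hR hs (i := 0) (j := 1) (by decide) (by decide) (by decide)
    (by decide) (by decide)
  have hproj := b.projective_P' hR.refl
  let X : Fin 3 → RightMod (PathAlgebra K (RelQuiver linearA3)) := ![b.P 2, b.P 0, S]
  have hu : b.u hR.refl 1 0 ≫ π = 0 := b.hom_thin_eq_zero hR hs (by decide) _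
  have hid : ∀ i, 𝟙 (b.P i) ≠ 0 := b.id_P_ne_zero hR.refl
  have h00 : ∀ i (φ : b.P i ⟶ b.P i), ∃ c : K, φ = c • 𝟙 _ := fun i φ => by
    rw [← b.u_self hR.refl]; exact b.u_span hR.refl φ
  have hS : ∀ φ : S ⟶ S, ∃ c : K, φ = c • 𝟙 _ := fun φ => by
    obtain ⟨c, hc⟩ := b.projThin_span hR hs (by decide) (π ≫ φ)
    exact ⟨c, by rw [← cancel_epi π, hc, Linear.comp_smul, Category.comp_id]⟩
  have h02 : ∀ φ : b.P 0 ⟶ b.P 2, φ = 0 := fun φ => by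
    obtain ⟨c, hc⟩ := b.u_span hR.refl φ
    rw [hc, b.u_of_not hR.refl (by decide), smul_zero]
  have h12 : ∀ φ : b.P 1 ⟶ b.P 2, φ = 0 := fun φ => by
    obtain ⟨c, hc⟩ := b.u_span hR.refl φ
    rw [hc, b.u_of_not hR.refl (by decide), smul_zero]
  have h10 : ∀ φ : b.P 1 ⟶ b.P 0, ∃ g : b.P 0 ⟶ b.P 0, b.u hR.refl 1 0 ≫ g = φ := fun φ => by
    obtain ⟨c, hc⟩ := b.u_span hR.refl φ
    exact ⟨c • 𝟙 _, by rw [hc, Linear.comp_smul, Category.comp_id]⟩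
  -- Composed with P 0 → S, such a map is a scalar that kills the image of P 1, hence zero.
  have hS0 : ∀ φ : S ⟶ b.P 0, φ = 0 := fun φ => by
    obtain ⟨c, hc⟩ := h00 0 (π ≫ φ)
    have h1 : c • b.u hR.refl 1 0 = 0 := by
      rw [← Category.comp_id (b.u hR.refl 1 0), ← Linear.comp_smul, ← hc, ← Category.assoc, hu,
        zero_comp]
    rw [← cancel_epi π, hc,
      (smul_eq_zero.1 h1).resolve_right (b.u_ne_zero hR.refl (by decide)), zero_smul, comp_zero]
  have H : HomTable K X (fun k l => relRelA3 k l) :=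
    { f := fun
        | 0, 0 => 𝟙 (b.P 2)
        | 0, 1 => b.u hR.refl 2 0
        | 0, 2 => (0 : b.P 2 ⟶ S)
        | 1, 0 => (0 : b.P 0 ⟶ b.P 2)
        | 1, 1 => 𝟙 (b.P 0)
        | 1, 2 => π
        | 2, 0 => (0 : S ⟶ b.P 2)
        | 2, 1 => (0 : S ⟶ b.P 0)
        | 2, 2 => 𝟙 S
      span := fun
        | 0, 0 => h00 2
        | 0, 1 => b.u_span hR.refl
        | 0, 2 => fun φ => ⟨0, (b.hom_thin_eq_zero hR hs (by decide) φ).trans (zero_smul K _).symm⟩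
        | 1, 0 => fun φ => ⟨0, (h02 φ).trans (zero_smul K _).symm⟩
        | 1, 1 => h00 0
        | 1, 2 => b.projThin_span hR hs (by decide)
        | 2, 0 => fun φ => ⟨0, ((cancel_epi π).1 ((h02 (π ≫ φ)).trans comp_zero.symm)).trans
            (zero_smul K _).symm⟩
        | 2, 1 => fun φ => ⟨0, (hS0 φ).trans (zero_smul K _).symm⟩
        | 2, 2 => hS
      zero := fun
        | 0, 0 => fun h => absurd (by decide) h
        | 0, 1 => fun h => absurd (by decide) h
        | 0, 2 => fun _ => rfl
        | 1, 0 => fun _ => rfl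
        | 1, 1 => fun h => absurd (by decide) h
        | 1, 2 => fun h => absurd (by decide) h
        | 2, 0 => fun _ => rfl
        | 2, 1 => fun _ => rfl
        | 2, 2 => fun h => absurd (by decide) h
      ne_zero := fun
        | 0, 0 => fun _ => hid 2
        | 0, 1 => fun _ => b.u_ne_zero hR.refl (by decide)
        | 0, 2 => fun h => absurd h (by decide)
        | 1, 0 => fun h => absurd h (by decide)
        | 1, 1 => fun _ => hid 0
        | 1, 2 => fun _ => b.projThin_ne_zero hR hs (by decide)
        | 2, 0 => fun h => absurd h (by decide)
        | 2, 1 => fun h => absurd h (by decide)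
        | 2, 2 => fun _ h => b.projThin_ne_zero hR hs (i := 0) (by decide)
            ((Category.comp_id π).symm.trans ((congrArg (π ≫ ·) h).trans comp_zero))
      id := fun
        | 0 => rfl
        | 1 => rfl
        | 2 => rfl
      comp := fun
        | 0, 0, _ => fun _ _ _ => Category.id_comp _
        | 1, 1, _ => fun _ _ _ => Category.id_comp _
        | 2, 2, _ => fun _ _ _ => Category.id_comp _
        | 0, 1, 1 => fun _ _ _ => Category.comp_id _
        | 1, 2, 2 => fun _ _ _ => Category.comp_id _
        | 0, 1, 0 => fun _ h _ => absurd h (by decide)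
        | 0, 1, 2 => fun _ _ h => absurd h (by decide)
        | 0, 2, _ => fun h _ _ => absurd h (by decide)
        | 1, 0, _ => fun h _ _ => absurd h (by decide)
        | 1, 2, 0 => fun _ h _ => absurd h (by decide)
        | 1, 2, 1 => fun _ h _ => absurd h (by decide)
        | 2, 0, _ => fun h _ _ => absurd h (by decide)
        | 2, 1, _ => fun h _ _ => absurd h (by decide) }
  let D := Decomp.biproduct X
  have hfin : ∀ k, Module.Finite _ (X k) := fun
    | 0 => b.finite_P hR.refl 2
    | 1 => b.finite_P hR.refl 0
    | 2 => have := b.finite_P hR.refl 0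
      Module.Finite.of_surjective π.hom (b.projThin_surjective _ (by decide))
  have hpd : ∀ k, HasProjectiveDimensionLT (X k) 2 := fun
    | 0 => hasProjectiveDimensionLT_of_ge (b.P 2) 1 2 (by decide)
    | 1 => hasProjectiveDimensionLT_of_ge (b.P 0) 1 2 (by decide)
    | 2 => hex.hasProjectiveDimensionLT_X₃ 1
      (hasProjectiveDimensionLT_of_ge (b.P 1) 1 1 (by decide))
      (hasProjectiveDimensionLT_of_ge (b.P 0) 1 2 (by decide))
  have hext : ∀ k, ∀ e : Abelian.Ext (X k) (⨁ X) 1, e = 0 := fun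
    | 0 => fun e => Abelian.Ext.eq_zero_of_projective (P := b.P 2) e
    | 1 => fun e => Abelian.Ext.eq_zero_of_projective (P := b.P 0) e
    | 2 => fun e => by
      -- In view of the resolution 0 → P 1 → P 0 → S → 0, the vanishing of Ext¹(S, X k) means that
      -- every map from P 1 extends to P 0. Only P 0 receives nonzero maps from P 1, and these are
      -- multiples of the inclusion.
      have h1 : ∀ k (f : b.P 1 ⟶ X k), ∃ g : b.P 0 ⟶ X k, b.u hR.refl 1 0 ≫ g = f := fun
        | 0 => fun f => ⟨0, comp_zero.trans (h12 f).symm⟩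
        | 1 => h10
        | 2 => fun f => ⟨0, comp_zero.trans (b.hom_thin_eq_zero hR hs (by decide) f).symm⟩
      have : Projective (ShortComplex.mk _ _ hu).X₂ := hproj 0
      refine ext_eq_zero_of_presentation hex (fun f => ?_) e
      choose g hg using fun k => h1 k (f ≫ D.prj k)
      refine ⟨∑ k, g k ≫ D.inc k, ?_⟩
      change b.u hR.refl 1 0 ≫ _ = f
      rw [Preadditive.comp_sum, ← Category.comp_id f, ← D.total, Preadditive.comp_sum]
      exact Finset.sum_congr rfl fun k _ => by rw [← Category.assoc, hg, Category.assoc]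
  obtain ⟨c⟩ := H.nonempty_relBasis D
  -- The table transposes the relation of the chain P 2 → P 0 → S; reversing the numbering of the
  -- vertices restores it.
  refine ⟨End (⨁ X), _, _, ⟨c.reindex Fin.revPerm (R' := relRelA3) (by decide)⟩, ⨁ X, ⟨D.finite hfin, D.hasProjectiveDimensionLT 2 hpd,
    ⟨fun x y => (D.ext_eq_zero hext x).trans (D.ext_eq_zero hext y).symm⟩,
    ⟨3, H.hasNumSummands (by decide) (by decide) D,
      b.hasNumSummands_regular hR.refl fun i j => le_antisymm⟩⟩, ⟨AlgEquiv.refl⟩⟩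
end Silted

namespace Silted
open CategoryTheory CategoryTheory.Limits MulOpposite

/-! ### The algebras in the lists -/

section

variable (K : Type u) [Field K]

/-- Path algebras have the basis of their paths. For the quotient algebra the basis is pulled back
from the endomorphism algebra of a tilting module, which shows that no path other than the one of
length two is killed. -/
theorem nonempty_relBasis_listSink (k : Fin 6) : Nonempty (RelBasis K (listRel k) (listSink K k)) := by
  revert k
  refine fun
    | 0 => ⟨(isReach_linearA3.relBasis K).congr (by decide)⟩
    | 1 => ⟨(isReach_sinkA3.relBasis K).congr (by decide)⟩
    | 2 => ⟨(isReach_sourceA3.relBasis K).congr (by decide)⟩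
    | 3 => ?_
    | 4 => ⟨(isReach_arrowAndPoint.relBasis K).congr (by decide)⟩
    | 5 => ⟨(isReach_threePoints.relBasis K).congr (by decide)⟩
  obtain ⟨B, _, _, ⟨b⟩, -⟩ := isTilted_relA3 K
  obtain ⟨c⟩ := nonempty_relBasis_relA3 K b
  exact ⟨c.congr (by decide)⟩

theorem listLinear_eq (k : Fin 5) : listLinear K k = listSink K k.castSucc := by
  fin_cases k <;> rfl

variable {K} in
theorem isTilted_congr {V : Type} [Quiver.{0} V] [Fintype V] [DecidableEq V] {B : Type v} [Ring B]
    [Algebra K B] {B' : Type w} [Ring B'] [Algebra K B'] (e : B' ≃ₐ[K] B) (h : IsTilted K V B) :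
    IsTilted K V B' :=
  let ⟨T, hT, ⟨e'⟩⟩ := h
  ⟨T, hT, ⟨e.trans e'⟩⟩

variable {K} in
theorem nonempty_algEquiv_listSink {B : Type v} [Ring B] [Algebra K B] {k : Fin 6} {V : Type}
    {R : V → V → Prop} (b : RelBasis K R B) (σ : V ≃ Fin 3)
    (h : ∀ i j, R i j ↔ listRel k (σ i) (σ j)) : Nonempty (B ≃ₐ[K] listSink K k) :=
  let ⟨c⟩ := nonempty_relBasis_listSink K k
  b.nonempty_algEquiv c σ h

theorem isEmpty_listSink_algEquiv {k l : Fin 6} (h : k ≠ l) :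
    IsEmpty (listSink K k ≃ₐ[K] listSink K l) := ⟨fun e => by
  obtain ⟨b⟩ := nonempty_relBasis_listSink K k
  obtain ⟨b'⟩ := nonempty_relBasis_listSink K l
  exact h (eq_of_relBasis (b.map e) b')⟩

/-- Tilted algebras given by the regular module over the path algebra of an orientation. -/
theorem isTiltedOfGraph_listSink {V : Type} [Fintype V] [DecidableEq V] {G : SimpleGraph V}
    {r R : V → V → Prop} (hr : IsOrientation G r) (h : IsReach r R)
    (hR : ∀ i j, R i j → R j i → i = j) {k : Fin 6} (σ : Fin 3 ≃ V)
    (hσ : ∀ i j, listRel k i j ↔ R (σ i) (σ j)) : IsTiltedOfGraph K G (listSink K k) := by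
  obtain ⟨b⟩ := nonempty_relBasis_listSink K k
  exact ⟨r, hr, isTilted_regular h hR b σ hσ⟩

theorem isTiltedOfGraph_graphA3 {k : Fin 6} (hk : k < 4) :
    IsTiltedOfGraph K graphA3 (listSink K k) := by
  have hl : IsOrientation graphA3 linearA3 := by
    simp only [IsOrientation, SimpleGraph.pathGraph_adj]; decide
  match k, hk with
  | 0, _ => exact isTiltedOfGraph_listSink K hl isReach_linearA3 (by decide) (Equiv.refl _) (by decide)
  | 1, _ =>
    -- The middle vertex of the path graph is 1, whereas the sink in the list is 2; the
    -- transposition matches them.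
    exact isTiltedOfGraph_listSink K (r := fun a b => (a = 0 ∧ b = 1) ∨ (a = 2 ∧ b = 1))
      (R := fun i j => i = j ∨ j = 1) (by simp only [IsOrientation, SimpleGraph.pathGraph_adj]; decide)
      ⟨by decide, by decide, by decide, by decide, by decide⟩ (by decide) (Equiv.swap 1 2) (by decide)
  | 2, _ =>
    exact isTiltedOfGraph_listSink K (r := fun a b => (a = 1 ∧ b = 0) ∨ (a = 1 ∧ b = 2))
      (R := fun i j => i = j ∨ i = 1) (by simp only [IsOrientation, SimpleGraph.pathGraph_adj]; decide)
      ⟨by decide, by decide, by decide, by decide, by decide⟩ (by decide) (Equiv.swap 1 2) (by decide)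
  | 3, _ =>
    obtain ⟨B, _, _, ⟨b⟩, h⟩ := isTilted_relA3 K
    obtain ⟨c⟩ := nonempty_relBasis_listSink K 3
    obtain ⟨e⟩ := c.nonempty_algEquiv b (Equiv.refl _) (by decide)
    exact ⟨linearA3, hl, isTilted_congr e h⟩

theorem isTiltedOfGraph_graphA2A1 : IsTiltedOfGraph K graphA2A1 (listSink K 4) :=
  isTiltedOfGraph_listSink K (r := fun a b => a = Sum.inl 0 ∧ b = Sum.inl 1)
    (R := fun i j => i = j ∨ (i = Sum.inl 0 ∧ j = Sum.inl 1))
    ⟨by simp [SimpleGraph.pathGraph_adj], by decide⟩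
    ⟨by decide, by decide, by decide, by decide, fun _ _ _ _ _ _ h h' => h.1.trans h'.1.symm⟩
    (by decide) (finSumFinEquiv (m := 2) (n := 1)).symm (by decide)

theorem isTiltedOfGraph_graphA1A1A1 : IsTiltedOfGraph K graphA1A1A1 (listSink K 5) :=
  isTiltedOfGraph_listSink K (r := fun _ _ => False) (R := fun i j => i = j)
    ⟨by simp [SimpleGraph.pathGraph_adj], by decide⟩
    ⟨by decide, by decide, by decide, by decide, by decide⟩ (by decide)
    ((finSumFinEquiv (m := 2) (n := 1)).symm.trans
      (Equiv.sumCongr (finSumFinEquiv (m := 1) (n := 1)).symm (Equiv.refl _))) (by decide)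

end
end Silted

namespace Silted
open CategoryTheory CategoryTheory.Limits MulOpposite

/-! ### Generators and the universal property of path algebras -/

namespace PathAlgebra

set_option linter.unusedSectionVars false

variable {K : Type u} [Field K] {V : Type} [Quiver.{0} V]

variable (K) in
/-- The trivial path at a vertex. -/
noncomputable def vert (i : V) : PathAlgebra K V := ofPath K ⟨i, i, Quiver.Path.nil⟩

variable (K) in
/-- The path given by an arrow. -/
noncomputable def arrow {i j : V} (a : i ⟶ j) : PathAlgebra K V := ofPath K ⟨i, j, a.toPath⟩

theorem span_range_ofPath : Submodule.span K (Set.range (ofPath K (V := V))) = ⊤ := by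
  refine eq_top_iff.2 fun x _ => ?_
  refine Finsupp.induction_linear (motive := fun x => x ∈ Submodule.span K _) x
    (Submodule.zero_mem _) (fun _ _ => Submodule.add_mem _) fun q c => ?_
  have h : (Finsupp.single q c : QPath V →₀ K) = c • (Finsupp.single q 1 : QPath V →₀ K) := by
    rw [Finsupp.smul_single, smul_eq_mul, mul_one]
  rw [h]
  exact Submodule.smul_mem _ c (Submodule.subset_span ⟨q, rfl⟩)

variable [Fintype V] [DecidableEq V]

theorem ofPath_mul_ofPath_comp {i j k : V} (p : Quiver.Path i j) (q : Quiver.Path j k) :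
    ofPath K ⟨i, j, p⟩ * ofPath K ⟨j, k, q⟩ = ofPath K ⟨i, k, p.comp q⟩ := by
  simp [ofPath_mul_ofPath, concat]

theorem ofPath_mul_ofPath_of_ne {i j k l : V} (p : Quiver.Path i j) (q : Quiver.Path k l)
    (h : j ≠ k) : ofPath K ⟨i, j, p⟩ * ofPath K ⟨k, l, q⟩ = 0 := by
  simp [ofPath_mul_ofPath, concat, h]

theorem vert_mul_vert (i : V) : vert K i * vert K i = vert K i :=
  ofPath_mul_ofPath_comp Quiver.Path.nil Quiver.Path.nil

theorem vert_mul_vert_of_ne {i j : V} (h : i ≠ j) : vert K i * vert K j = 0 :=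
  ofPath_mul_ofPath_of_ne _ _ h

theorem sum_vert : ∑ i : V, vert K i = 1 := rfl

theorem vert_mul_arrow {i j : V} (a : i ⟶ j) : vert K i * arrow K a = arrow K a :=
  (ofPath_mul_ofPath_comp _ _).trans (by rw [Quiver.Path.nil_comp]; rfl)

theorem arrow_mul_vert {i j : V} (a : i ⟶ j) : arrow K a * vert K j = arrow K a :=
  ofPath_mul_ofPath_comp _ _

theorem ofPath_cons {i j k : V} (p : Quiver.Path i j) (a : j ⟶ k) :
    ofPath K ⟨i, k, p.cons a⟩ = ofPath K ⟨i, j, p⟩ * arrow K a :=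
  (ofPath_mul_ofPath_comp p a.toPath).symm

/-- The path algebra is generated by the trivial paths and the arrows. -/
theorem induction_on {p : PathAlgebra K V → Prop} (h0 : p 0) (hadd : ∀ x y, p x → p y → p (x + y))
    (hsmul : ∀ (c : K) x, p x → p (c • x)) (hmul : ∀ x y, p x → p y → p (x * y))
    (hvert : ∀ i, p (vert K i)) (harrow : ∀ {i j : V} (a : i ⟶ j), p (arrow K a))
    (x : PathAlgebra K V) : p x := by
  have h1 : ∀ {i j : V} (q : Quiver.Path i j), p (ofPath K ⟨i, j, q⟩) := fun {i j} q => by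
    induction q with
    | nil => exact hvert i
    | cons q a ih => rw [ofPath_cons]; exact hmul _ _ ih (harrow a)
  refine Finsupp.induction_linear (motive := p) x h0 hadd fun q c => ?_
  have h2 : (Finsupp.single q c : QPath V →₀ K) = c • (Finsupp.single q 1 : QPath V →₀ K) := by
    rw [Finsupp.smul_single, smul_eq_mul, mul_one]
  rw [h2]
  exact hsmul c _ (h1 q.path)

section lift

variable {E : Type*} [Ring E] [Algebra K E] (e : V → E) (φ : ∀ {i j : V}, (i ⟶ j) → E)

/-- The product of the images of the arrows of a path. -/
def evalPath {i : V} : ∀ {j : V}, Quiver.Path i j → E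
  | _, Quiver.Path.nil => e i
  | _, Quiver.Path.cons p a => evalPath p * φ a
theorem evalPath_mul_self (he : ∀ i, e i * e i = e i)
    (hφ' : ∀ {i j : V} (a : i ⟶ j), φ a * e j = φ a) {i j : V} (p : Quiver.Path i j) :
    evalPath e φ p * e j = evalPath e φ p := by
  cases p with
  | nil => exact he i
  | cons p a => simp only [evalPath, mul_assoc, hφ']

theorem evalPath_comp (he : ∀ i, e i * e i = e i)
    (hφ' : ∀ {i j : V} (a : i ⟶ j), φ a * e j = φ a) {i j k : V} (p : Quiver.Path i j)
    (q : Quiver.Path j k) : evalPath e φ (p.comp q) = evalPath e φ p * evalPath e φ q := by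
  induction q with
  | nil => exact (evalPath_mul_self e φ he hφ' p).symm
  | cons q a ih => simp only [Quiver.Path.comp_cons, evalPath, ih, mul_assoc]

theorem self_mul_evalPath (he : ∀ i, e i * e i = e i) {i j : V} (p : Quiver.Path i j) :
    e i * evalPath e φ p = evalPath e φ p := by
  induction p with
  | nil => exact he i
  | cons p a ih => simp only [evalPath, ← mul_assoc, ih]

/-- The universal property of the path algebra. -/
noncomputable def lift (he : ∀ i, e i * e i = e i) (he' : ∀ i j, i ≠ j → e i * e j = 0)
    (he1 : ∑ i, e i = 1)
    (hφ' : ∀ {i j : V} (a : i ⟶ j), φ a * e j = φ a) : PathAlgebra K V →ₐ[K] E :=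
  let L : PathAlgebra K V →ₗ[K] E :=
    Finsupp.linearCombination K (M := E) fun p : QPath V => evalPath e φ p.path
  have hL : ∀ p, L (ofPath K p) = evalPath e φ p.path := fun p =>
    (Finsupp.linearCombination_single K (1 : K) p).trans (one_smul K _)
  AlgHom.ofLinearMap L
    (by
      rw [← sum_vert, map_sum, ← he1]
      exact Finset.sum_congr rfl fun i _ => hL _)
    (fun x y => by
      have : (LinearMap.mul K _).compr₂ L = (LinearMap.mul K E).compl₁₂ L L :=
        hom_ext K fun p => hom_ext K fun q => by
          simp only [LinearMap.compr₂_apply, LinearMap.mul_apply', LinearMap.compl₁₂_apply, hL]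
          obtain ⟨i, j, p⟩ := p
          obtain ⟨k, l, q⟩ := q
          by_cases h : j = k
          · subst h
            rw [ofPath_mul_ofPath_comp, hL]
            exact evalPath_comp e φ he hφ' p q
          · rw [ofPath_mul_ofPath_of_ne _ _ h, map_zero]
            change 0 = evalPath e φ p * evalPath e φ q
            rw [← evalPath_mul_self e φ he hφ' p, ← self_mul_evalPath e φ he q, mul_assoc,
              ← mul_assoc (e j), he' j k h, zero_mul, mul_zero]
      exact LinearMap.congr_fun (LinearMap.congr_fun this x) y)

theorem lift_vert (he he' he1 hφ') (i : V) :
    lift (K := K) e φ he he' he1 hφ' (vert K i) = e i :=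
  (Finsupp.linearCombination_single K (1 : K) _).trans (one_smul K _)

theorem lift_arrow (he he' he1 hφ') (hφ : ∀ {i j : V} (a : i ⟶ j), e i * φ a = φ a) {i j : V}
    (a : i ⟶ j) : lift (K := K) e φ he he' he1 hφ' (arrow K a) = φ a :=
  ((Finsupp.linearCombination_single K (1 : K) _).trans (one_smul K _)).trans (hφ a)

end lift

end PathAlgebra
end Silted

namespace Silted
open CategoryTheory CategoryTheory.Limits MulOpposite

/-! ### The Euler form -/

section

variable {K : Type*} [Field K] {M N : Type*} [AddCommGroup M] [Module K M] [AddCommGroup N]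
  [Module K N]

/-- The linear maps `g` with `q ∘ g ∘ p = g`. -/
def corner (p : M →ₗ[K] M) (q : N →ₗ[K] N) : Submodule K (M →ₗ[K] N) where
  carrier := {g | q ∘ₗ g ∘ₗ p = g}
  zero_mem' := by simp
  add_mem' {f g} hf hg := by
    change q ∘ₗ (f + g) ∘ₗ p = f + g
    rw [LinearMap.add_comp, LinearMap.comp_add, hf, hg]
  smul_mem' c f hf := by
    change q ∘ₗ (c • f) ∘ₗ p = c • f
    rw [LinearMap.smul_comp, LinearMap.comp_smul, hf]

theorem finrank_corner [FiniteDimensional K M] [FiniteDimensional K N] {p : M →ₗ[K] M}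
    {q : N →ₗ[K] N} (hp : p ∘ₗ p = p) (hq : q ∘ₗ q = q) :
    Module.finrank K (corner p q) =
      Module.finrank K (LinearMap.range p) * Module.finrank K (LinearMap.range q) := by
  have hp' : ∀ x, p (p x) = p x := LinearMap.congr_fun hp
  have hq' : ∀ x, q (q x) = q x := LinearMap.congr_fun hq
  rw [← Module.finrank_linearMap K K]
  refine LinearEquiv.finrank_eq
    { toFun := fun g => q.rangeRestrict ∘ₗ g.1 ∘ₗ (LinearMap.range p).subtype
      invFun := fun f => ⟨(LinearMap.range q).subtype ∘ₗ f ∘ₗ p.rangeRestrict, ?_⟩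
      map_add' := fun f g => by
        ext x; simp
      map_smul' := fun c f => by
        ext x; simp
      left_inv := fun g => Subtype.ext g.2
      right_inv := fun f => ?_ }
  · refine LinearMap.ext fun x => ?_
    have h1 : p.rangeRestrict (p x) = p.rangeRestrict x := Subtype.ext (hp' x)
    change q (f (p.rangeRestrict (p x)) : N) = (f (p.rangeRestrict x) : N)
    obtain ⟨y, hy⟩ := (f (p.rangeRestrict x)).2
    rw [h1, ← hy, hq']
  · refine LinearMap.ext fun x => Subtype.ext ?_
    have h1 : p.rangeRestrict x = x := Subtype.ext <| by
      obtain ⟨y, hy⟩ := x.2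
      change p x = x
      rw [← hy, hp']
    change q (f (p.rangeRestrict x) : N) = (f x : N)
    obtain ⟨y, hy⟩ := (f x).2
    rw [h1, ← hy, hq']

end

/-- The obstruction to lifting the identity of the quotient lies in the Ext group that is assumed to
vanish. -/
theorem exists_section_of_ext_eq_zero {C : Type*} [Category C] [Abelian C] [HasExt.{w} C]
    {S : ShortComplex C} (hS : S.ShortExact) (h : ∀ e : Abelian.Ext S.X₃ S.X₁ 1, e = 0) :
    ∃ σ, σ ≫ S.g = 𝟙 S.X₃ := by
  obtain ⟨x, hx⟩ := Abelian.Ext.covariant_sequence_exact₃ S.X₃ hS (Abelian.Ext.mk₀ (𝟙 S.X₃))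
    (n₁ := 1) rfl (h _)
  obtain ⟨σ, rfl⟩ := Abelian.Ext.addEquiv₀.symm.surjective x
  refine ⟨σ, Abelian.Ext.addEquiv₀.symm.injective ?_⟩
  exact (Abelian.Ext.mk₀_comp_mk₀ σ S.g).symm.trans hx

namespace PathAlgebra

open scoped ModuleCat

variable {K : Type u} [Field K] {V : Type} [Quiver.{0} V] [Fintype V] [DecidableEq V]

/-- The right module given by an action of the path algebra on a vector space. -/
noncomputable def ofRep (W : Type u) [AddCommGroup W] [Module K W]
    (ρ : PathAlgebra K V →ₐ[K] (Module.End K W)ᵐᵒᵖ) : RightMod (PathAlgebra K V) :=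
  letI : Module (PathAlgebra K V)ᵐᵒᵖ W :=
    { smul := fun a w => (ρ a.unop).unop w
      one_smul := fun w => by change (ρ 1).unop w = w; rw [map_one]; rfl
      mul_smul := fun a a' w => by
        change (ρ (a'.unop * a.unop)).unop w = _; rw [map_mul]; rfl
      smul_zero := fun a => map_zero (ρ a.unop).unop
      smul_add := fun a => map_add (ρ a.unop).unop
      add_smul := fun a a' w => by
        change (ρ (a.unop + a'.unop)).unop w = _; rw [map_add]; rfl
      zero_smul := fun w => by change (ρ 0).unop w = 0; rw [map_zero]; rfl }
  ModuleCat.of _ W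

section

variable {M N : RightMod (PathAlgebra K V)}

theorem op_smul_smul {M : RightMod (PathAlgebra K V)} (c : K) (x : PathAlgebra K V) (m : M) : op (c • x) • m = c • op x • m := by
  rw [MulOpposite.op_smul, smul_assoc]

/-- Homomorphisms of modules are the linear maps that commute with the generators of the path
algebra. -/
noncomputable def homOfGens (g : M →+ N) (hK : ∀ (c : K) m, g (c • m) = c • g m)
    (hv : ∀ (i : V) m, g (op (vert K i) • m) = op (vert K i) • g m)
    (ha : ∀ {i j : V} (a : i ⟶ j) m, g (op (arrow K a) • m) = op (arrow K a) • g m) : M ⟶ N :=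
  ModuleCat.ofHom
    { g with
      map_smul' := fun x m => by
        refine induction_on (p := fun x : PathAlgebra K V => ∀ m, g (op x • m) = op x • g m) ?_ ?_ ?_ ?_ hv ha x.unop m
        · simp
        · intro x y hx hy m
          rw [MulOpposite.op_add, add_smul, add_smul, map_add, hx, hy]
        · intro c x hx m
          rw [op_smul_smul, op_smul_smul, hK, hx]
        · intro x y hx hy m
          rw [op_mul, mul_smul, mul_smul, hy, hx] }

variable (M) in
/-- The action of an element of the path algebra on a right module. -/
noncomputable def act (x : PathAlgebra K V) : M →ₗ[K] M where
  toFun m := op x • m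
  map_add' := smul_add _
  map_smul' c m := smul_comm (op x) c m

theorem act_comp_act (x y : PathAlgebra K V) : act M y ∘ₗ act M x = act M (x * y) :=
  LinearMap.ext fun m => by
    change op y • op x • m = op (x * y) • m
    rw [op_mul, mul_smul]

theorem act_zero : act M 0 = 0 := LinearMap.ext fun m => by
  change op (0 : PathAlgebra K V) • m = 0
  rw [MulOpposite.op_zero, zero_smul]

theorem sum_act_vert : ∑ i, act M (vert K i) = LinearMap.id := LinearMap.ext fun m => by
  rw [LinearMap.sum_apply]
  change ∑ i, op (vert K i) • m = m
  rw [← Finset.sum_smul, ← Finset.op_sum, sum_vert, MulOpposite.op_one, one_smul]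

/-- The linear map underlying a homomorphism of modules. -/
noncomputable def toLin : (M ⟶ N) →ₗ[K] (M →ₗ[K] N) where
  toFun φ := φ.hom.restrictScalars K
  map_add' _ _ := rfl
  map_smul' _ _ := rfl

theorem act_comp_toLin (φ : M ⟶ N) (x : PathAlgebra K V) :
    act N x ∘ₗ toLin φ = toLin φ ∘ₗ act M x :=
  LinearMap.ext fun m => (map_smul φ.hom (op x) m).symm

variable (M) in
/-- The dimension of a module at a vertex. -/
noncomputable def dimAt (i : V) : ℕ := Module.finrank K (LinearMap.range (act M (vert K i)))

end

variable (M N : RightMod (PathAlgebra K V))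

/-- The extension of modules given by linear maps at the arrows. -/
noncomputable def extRep (g : ∀ {i j : V} (_ : i ⟶ j), M →ₗ[K] N)
    (hg : ∀ {i j : V} (a : i ⟶ j), act N (vert K j) ∘ₗ g a ∘ₗ act M (vert K i) = g a) :
    PathAlgebra K V →ₐ[K] (Module.End K (N × M))ᵐᵒᵖ :=
  lift (fun i => op ((act N (vert K i)).prodMap (act M (vert K i))))
    (fun {i j} a => op ((act N (arrow K a)).prodMap (act M (arrow K a)) +
      LinearMap.inl K N M ∘ₗ g a ∘ₗ LinearMap.snd K N M))
    (fun i => by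
      rw [← op_mul]
      congr 1
      change (LinearMap.prodMap _ _) ∘ₗ (LinearMap.prodMap _ _) = _
      rw [LinearMap.prodMap_comp, act_comp_act, act_comp_act, vert_mul_vert])
    (fun i j h => by
      rw [← op_mul, ← MulOpposite.op_zero]
      congr 1
      change (LinearMap.prodMap _ _) ∘ₗ (LinearMap.prodMap _ _) = _
      rw [LinearMap.prodMap_comp, act_comp_act, act_comp_act, vert_mul_vert_of_ne h, act_zero,
        act_zero, LinearMap.prodMap_zero])
    (by
      rw [← Finset.op_sum, ← MulOpposite.op_one]
      congr 1
      refine LinearMap.ext fun x => Prod.ext ?_ ?_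
      · simpa [Prod.fst_sum, LinearMap.sum_apply] using LinearMap.congr_fun (sum_act_vert (M := N)) x.1
      · simpa [Prod.snd_sum, LinearMap.sum_apply] using LinearMap.congr_fun (sum_act_vert (M := M)) x.2)
    (fun {i j} a => by
      rw [← op_mul]
      congr 1
      refine LinearMap.ext fun x => ?_
      have h1 := LinearMap.congr_fun (act_comp_act (M := N) (arrow K a) (vert K j)) x.1
      have h2 := LinearMap.congr_fun (act_comp_act (M := M) (arrow K a) (vert K j)) x.2
      have h3 : act N (vert K j) (g a x.2) = g a x.2 := by
        have h4 := LinearMap.congr_fun (act_comp_act (M := N) (vert K j) (vert K j))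
          (g a (act M (vert K i) x.2))
        have h5 := LinearMap.congr_fun (hg a) x.2
        rw [vert_mul_vert] at h4
        simp only [LinearMap.comp_apply] at h4 h5
        rw [← h5, h4]
      rw [arrow_mul_vert] at h1 h2
      simp only [LinearMap.comp_apply] at h1 h2
      refine Prod.ext ?_ ?_
      · simp [h1, h3]
      · simp [h2])

variable {M N} in
/-- If there are no nontrivial extensions, every system of linear maps at the arrows is an inner
derivation. -/
theorem exists_of_ext_eq_zero (hE : ∀ e : Abelian.Ext M N 1, e = 0)
    (g : ∀ {i j : V} (_ : i ⟶ j), M →ₗ[K] N)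
    (hg : ∀ {i j : V} (a : i ⟶ j), act N (vert K j) ∘ₗ g a ∘ₗ act M (vert K i) = g a) :
    ∃ h : M →ₗ[K] N, (∀ i, h ∘ₗ act M (vert K i) = act N (vert K i) ∘ₗ h) ∧
      ∀ {i j : V} (a : i ⟶ j), h ∘ₗ act M (arrow K a) = act N (arrow K a) ∘ₗ h + g a := by
  -- On N × M an arrow acts by a triangular matrix with off-diagonal entry `g`, so this is an
  -- extension of M by N. A section has the form m ↦ (h m, m), and its linearity over the path
  -- algebra amounts to the two identities for `h`.
  let ρ := extRep M N g hg
  let E := ofRep (N × M) ρ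
  have hsmul : ∀ (x : PathAlgebra K V) (w : E), op x • w = ((ρ x).unop w : N × M) := fun _ _ => rfl
  have hv : ∀ i (w : N × M), (ρ (vert K i)).unop w =
      (act N (vert K i) w.1, act M (vert K i) w.2) := fun i w => by
    simp only [ρ, extRep, lift_vert]; rfl
  have ha : ∀ {i j : V} (a : i ⟶ j) (w : N × M), (ρ (arrow K a)).unop w =
      (act N (arrow K a) w.1 + g a w.2, act M (arrow K a) w.2) := fun {i j} a w => by
    have : ρ (arrow K a) = op ((act N (arrow K a)).prodMap (act M (arrow K a)) +
      LinearMap.inl K N M ∘ₗ g a ∘ₗ LinearMap.snd K N M) := lift_arrow _ _ _ _ _ _ (fun {i j} a => by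
        rw [← op_mul]
        congr 1
        refine LinearMap.ext fun x => ?_
        have h1 := LinearMap.congr_fun (act_comp_act (M := N) (vert K i) (arrow K a)) x.1
        have h2 := LinearMap.congr_fun (act_comp_act (M := M) (vert K i) (arrow K a)) x.2
        have h3 : g a (act M (vert K i) x.2) = g a x.2 := by
          have h4 := LinearMap.congr_fun (act_comp_act (M := M) (vert K i) (vert K i)) x.2
          have h5 := LinearMap.congr_fun (hg a) x.2
          have h6 := LinearMap.congr_fun (hg a) (act M (vert K i) x.2)
          rw [vert_mul_vert] at h4
          simp only [LinearMap.comp_apply] at h4 h5 h6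
          rw [← h6, h4, h5]
        rw [vert_mul_arrow] at h1 h2
        simp only [LinearMap.comp_apply] at h1 h2
        refine Prod.ext ?_ ?_
        · simp [h1, h3]
        · simp [h2]) a
    rw [this]
    refine Prod.ext ?_ ?_ <;> simp
  have hc : ∀ (c : K) (w : E), c • w = (c • (show N × M from w) : N × M) := fun c w => by
    change (ρ (algebraMap K _ c)).unop w = _
    rw [AlgHom.commutes]; rfl
  let f : N ⟶ E := homOfGens (LinearMap.inl K N M).toAddMonoidHom
    (fun c m => (map_smul (LinearMap.inl K N M) c m).trans (hc c _).symm)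
    (fun i m => ((hsmul _ _).trans ((hv i (m, 0)).trans (by rw [map_zero]; rfl))).symm)
    (fun a m => ((hsmul _ _).trans ((ha a (m, 0)).trans (by rw [map_zero, map_zero, add_zero]; rfl))).symm)
  let p : E ⟶ M := homOfGens (LinearMap.snd K N M).toAddMonoidHom
    (fun c m => congrArg Prod.snd (hc c m))
    (fun i m => congrArg Prod.snd ((hsmul _ _).trans (hv i m)))
    (fun a m => congrArg Prod.snd ((hsmul _ _).trans (ha a m)))
  have hfp : f ≫ p = 0 := ModuleCat.hom_ext (LinearMap.ext fun _ => rfl)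
  have hS : (ShortComplex.mk f p hfp).ShortExact :=
    { exact := (ShortComplex.moduleCat_exact_iff _).2 fun (x : N × M) (hx : x.2 = 0) =>
        ⟨x.1, Prod.ext rfl hx.symm⟩
      mono_f := (ModuleCat.mono_iff_injective _).2 fun x y h => congrArg Prod.fst h
      epi_g := (ModuleCat.epi_iff_surjective _).2 fun y => ⟨((0, y) : N × M), rfl⟩ }
  obtain ⟨σ, hσ⟩ := exists_section_of_ext_eq_zero hS hE
  have hσ2 : ∀ m, (show N × M from σ.hom m).2 = m := fun m =>
    congrArg (fun φ : M ⟶ M => φ.hom m) hσ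
  refine ⟨{ toFun := fun m => (show N × M from σ.hom m).1
            map_add' := fun m n => congrArg Prod.fst (map_add σ.hom m n)
            map_smul' := fun c m => congrArg Prod.fst
              ((map_smul σ.hom (algebraMap K _ c) m).trans (hc c _)) },
    fun i => LinearMap.ext fun m => ?_, fun a => LinearMap.ext fun m => ?_⟩
  · exact congrArg Prod.fst ((map_smul σ.hom (op (vert K i)) m).trans (hv i _))
  · refine (congrArg Prod.fst ((map_smul σ.hom (op (arrow K a)) m).trans (ha a _))).trans ?_
    rw [hσ2]; rfl

variable {M N} in
/-- The formula for the Euler form. -/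
theorem finrank_hom_add [Fintype (Σ p : V × V, p.1 ⟶ p.2)] [FiniteDimensional K M]
    [FiniteDimensional K N] (hE : ∀ e : Abelian.Ext M N 1, e = 0) :
    Module.finrank K (M ⟶ N) + ∑ a : Σ p : V × V, p.1 ⟶ p.2, dimAt M a.1.1 * dimAt N a.1.2 =
      ∑ i, dimAt M i * dimAt N i := by
  have hid : ∀ (M : RightMod (PathAlgebra K V)) i, act M (vert K i) ∘ₗ act M (vert K i) =
      act M (vert K i) := fun M i => by rw [act_comp_act, vert_mul_vert]
  have hva : ∀ (M : RightMod (PathAlgebra K V)) {i j : V} (a : i ⟶ j),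
      act M (arrow K a) ∘ₗ act M (vert K i) = act M (arrow K a) := fun M {i j} a => by
    rw [act_comp_act, vert_mul_arrow]
  have hav : ∀ (M : RightMod (PathAlgebra K V)) {i j : V} (a : i ⟶ j),
      act M (vert K j) ∘ₗ act M (arrow K a) = act M (arrow K a) := fun M {i j} a => by
    rw [act_comp_act, arrow_mul_vert]
  let H : V → V → Submodule K (M →ₗ[K] N) := fun i j => corner (act M (vert K i)) (act N (vert K j))
  have hH : ∀ i j, Module.finrank K (H i j) = dimAt M i * dimAt N j := fun i j =>
    finrank_corner (hid M i) (hid N j)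
  have hH1 : ∀ {i j} (g : H i j), g.1 ∘ₗ act M (vert K i) = g.1 := fun {i j} g => by
    have := g.2
    change _ ∘ₗ _ ∘ₗ _ = _ at this
    rw [← this, LinearMap.comp_assoc, LinearMap.comp_assoc, hid]
  have hH2 : ∀ {i j} (g : H i j), act N (vert K j) ∘ₗ g.1 = g.1 := fun {i j} g => by
    have := g.2
    change _ ∘ₗ _ ∘ₗ _ = _ at this
    rw [← this, ← LinearMap.comp_assoc, hid]
  -- The maps `ι` and `Δ` form the sequence 0 → Hom(M, N) → ∏ Hom(M_i, N_i) → ∏ Hom(M_i, N_j), with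
  -- the last product over the arrows i → j. Its exactness at the right end is the vanishing of
  -- Ext¹, and counting dimensions gives the formula.
  let Δ : (∀ i, H i i) →ₗ[K] (∀ a : Σ p : V × V, p.1 ⟶ p.2, H a.1.1 a.1.2) :=
    LinearMap.pi fun a =>
      { toFun := fun f => ⟨(f a.1.2).1 ∘ₗ act M (arrow K a.2) - act N (arrow K a.2) ∘ₗ (f a.1.1).1, by
          change _ ∘ₗ _ ∘ₗ _ = _
          rw [LinearMap.sub_comp, LinearMap.comp_sub, LinearMap.comp_assoc, LinearMap.comp_assoc,
            hva, hH1, ← LinearMap.comp_assoc, ← LinearMap.comp_assoc, hH2, hav]⟩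
        map_add' := fun f g => Subtype.ext <| LinearMap.ext fun x => by simp; abel
        map_smul' := fun c f => Subtype.ext <| LinearMap.ext fun x => by simp [smul_sub] }
  let ι : (M ⟶ N) →ₗ[K] (∀ i, H i i) := LinearMap.pi fun i =>
    { toFun := fun φ => ⟨act N (vert K i) ∘ₗ toLin φ, by
        change _ ∘ₗ _ ∘ₗ _ = _
        rw [LinearMap.comp_assoc, ← act_comp_toLin, ← LinearMap.comp_assoc, ← LinearMap.comp_assoc,
          hid, hid]⟩
      map_add' := fun f g => Subtype.ext <| by simp [LinearMap.comp_add]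
      map_smul' := fun c f => Subtype.ext <| by simp [LinearMap.comp_smul] }
  have hι : Function.Injective ι := fun φ ψ h => by
    have h1 : ∀ i, act N (vert K i) ∘ₗ toLin φ = act N (vert K i) ∘ₗ toLin ψ := fun i =>
      congrArg Subtype.val (congrFun h i)
    have h2 : toLin φ = toLin ψ := by
      refine LinearMap.ext fun x => ?_
      have h3 := fun y => LinearMap.congr_fun (sum_act_vert (M := N)) y
      simp only [LinearMap.sum_apply, LinearMap.id_apply] at h3
      rw [← h3 (toLin φ x), ← h3 (toLin ψ x)]
      exact Finset.sum_congr rfl fun i _ => LinearMap.congr_fun (h1 i) x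
    exact ModuleCat.hom_ext (LinearMap.ext fun x => LinearMap.congr_fun h2 x)
  have hΔ : Function.Surjective Δ := fun g => by
    obtain ⟨h, hv, ha⟩ := exists_of_ext_eq_zero hE (fun {i j} a => (g ⟨(i, j), a⟩).1)
      (fun {i j} a => (g ⟨(i, j), a⟩).2)
    refine ⟨fun i => ⟨h ∘ₗ act M (vert K i), ?_⟩, ?_⟩
    · change _ ∘ₗ _ ∘ₗ _ = _
      rw [LinearMap.comp_assoc, hid, hv, ← LinearMap.comp_assoc, hid]
    · refine funext fun a => Subtype.ext ?_
      change (h ∘ₗ _) ∘ₗ _ - _ ∘ₗ h ∘ₗ _ = _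
      rw [LinearMap.comp_assoc, hav, ha, hv, ← LinearMap.comp_assoc h, hva, add_sub_cancel_left]
  have hker : LinearMap.ker Δ = LinearMap.range ι := by
    ext f
    constructor
    · intro hf
      have hf' : ∀ {i j : V} (a : i ⟶ j), (f j).1 ∘ₗ act M (arrow K a) =
          act N (arrow K a) ∘ₗ (f i).1 := fun {i j} a =>
        sub_eq_zero.1 (congrArg Subtype.val (congrFun hf ⟨(i, j), a⟩))
      let s : M →ₗ[K] N := ∑ i, (f i).1
      have hs1 : ∀ i m, s (act M (vert K i) m) = (f i).1 m := fun i m => by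
        rw [LinearMap.sum_apply, Finset.sum_eq_single i _ (by simp)]
        · exact LinearMap.congr_fun (hH1 (f i)) m
        · intro j _ hj
          have h1 := LinearMap.congr_fun (act_comp_act (M := M) (vert K i) (vert K j)) m
          rw [vert_mul_vert_of_ne hj.symm, act_zero] at h1
          rw [← hH1 (f j), LinearMap.comp_apply]
          exact (congrArg _ h1).trans (map_zero _)
      have hs2 : ∀ i m, act N (vert K i) (s m) = (f i).1 m := fun i m => by
        rw [LinearMap.sum_apply, map_sum, Finset.sum_eq_single i _ (by simp)]
        · exact LinearMap.congr_fun (hH2 (f i)) m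
        · intro j _ hj
          have h1 := LinearMap.congr_fun (act_comp_act (M := N) (vert K j) (vert K i)) ((f j).1 m)
          rw [vert_mul_vert_of_ne hj, act_zero] at h1
          rw [← hH2 (f j)]
          exact h1
      refine ⟨homOfGens s.toAddMonoidHom (map_smul s) (fun i m => (hs1 i m).trans (hs2 i m).symm)
        (fun {i j} a m => ?_), funext fun i => Subtype.ext (LinearMap.ext (hs2 i))⟩
      change s (act M (arrow K a) m) = act N (arrow K a) (s m)
      rw [← hav M a, LinearMap.comp_apply, hs1, ← hva N a, LinearMap.comp_apply, hs2]
      exact LinearMap.congr_fun (hf' a) m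
    · rintro ⟨φ, rfl⟩
      refine funext fun a => Subtype.ext ?_
      change (_ ∘ₗ toLin φ) ∘ₗ _ - _ ∘ₗ _ ∘ₗ toLin φ = 0
      rw [LinearMap.comp_assoc, ← act_comp_toLin, ← LinearMap.comp_assoc, ← LinearMap.comp_assoc,
        hav, hva, sub_self]
  have h1 := LinearMap.finrank_range_add_finrank_ker Δ
  rw [LinearMap.range_eq_top.2 hΔ, finrank_top, hker, LinearMap.finrank_range_of_inj hι,
    Module.finrank_pi_fintype, Module.finrank_pi_fintype] at h1
  simp only [hH] at h1
  rw [← h1, add_comm]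

end PathAlgebra
end Silted

namespace Silted
open CategoryTheory CategoryTheory.Limits MulOpposite

/-! ### The type of a tilted algebra -/

section

variable {K : Type u} [Field K]

/-- The hypothesis forbids three consecutive arrows, so the vertices, the arrows and the products of
two arrows span. -/
theorem PathAlgebra.finiteDimensional {V : Type} [Fintype V] [DecidableEq V] {r : V → V → Prop}
    (h : ∀ a b c d, r a b → r b c → ¬ r c d) :
    FiniteDimensional K (PathAlgebra K (RelQuiver r)) := by
  let A := PathAlgebra K (RelQuiver r)
  let ar : (Σ p : V × V, PLift (r p.1 p.2)) → A := fun p =>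
    arrow K (V := RelQuiver r) (i := p.1.1) (j := p.1.2) p.2
  let s : Set A := Set.range (fun i : V => vert K (V := RelQuiver r) i) ∪ Set.range ar ∪
    Set.range fun q : (Σ p : V × V, PLift (r p.1 p.2)) × (Σ p : V × V, PLift (r p.1 p.2)) =>
      ar q.1 * ar q.2
  have hs : s.Finite :=
    ((Set.finite_range _).union (Set.finite_range _)).union (Set.finite_range _)
  refine Module.Finite.of_fg_top ⟨hs.toFinset, ?_⟩
  rw [hs.coe_toFinset, eq_top_iff]
  have h1 : ∀ {i j : RelQuiver r} (p : Quiver.Path i j), ofPath K ⟨i, j, p⟩ ∈ s := fun {i j} p =>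
    match p with
    | .nil => Or.inl (Or.inl ⟨i, rfl⟩)
    | .cons .nil a => Or.inl (Or.inr ⟨⟨(i, j), a⟩, rfl⟩)
    | .cons (b := k) (.cons .nil a) a' => Or.inr ⟨(⟨(i, k), a⟩, ⟨(k, j), a'⟩),
        (ofPath_cons _ _).symm⟩
    | .cons (.cons (.cons _ a) a') a'' => absurd a''.down (h _ _ _ _ a.down a'.down)
  rw [← PathAlgebra.span_range_ofPath]
  refine Submodule.span_mono ?_
  rintro _ ⟨q, rfl⟩
  exact h1 q.path

/-- The diagonal units are orthogonal idempotents with sum 1; splitting them yields the summands. -/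
theorem exists_decomp_of_relBasis {C : Type*} [Category C] [Preadditive C] [Linear K C]
    [IsIdempotentComplete C] {T : C} {V : Type} [Fintype V] {R : V → V → Prop}
    (b : RelBasis K R (End T)) (hR : ∀ i, R i i) :
    ∃ (X : V → C) (D : Decomp T X), ∀ k, D.prj k ≫ D.inc k = b.el k k := by
  have hmul : ∀ i j, (show T ⟶ T from b.el i i) ≫ b.el j j = b.el j j * b.el i i := fun _ _ => rfl
  choose X i e h1 h2 using fun k => IsIdempotentComplete.idempotents_split T (b.el k k)
    ((hmul k k).trans (b.mul_of_rel _ _ _ (hR k) (hR k)))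
  refine ⟨X, ⟨i, e, h1, fun k l hkl => ?_, ?_⟩, h2⟩
  · have h3 : (e k ≫ i k) ≫ e l ≫ i l = 0 := by
      rw [h2, h2]
      exact (hmul k l).trans (b.mul_of_ne _ _ _ _ hkl.symm)
    calc i k ≫ e l = i k ≫ ((e k ≫ i k) ≫ e l ≫ i l) ≫ e l := by
          simp only [Category.assoc, h1, Category.comp_id]
          rw [← Category.assoc (i k) (e k), h1, Category.id_comp]
      _ = 0 := by rw [h3, zero_comp, comp_zero]
  · simp only [h2]
    exact b.sum_el_self hR

/-- Morphisms from `X k` to `X l` correspond to the corner of `End T` between `el l l` and `el k k`,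
which is spanned by `el l k`. -/
theorem finrank_hom_of_relBasis {C : Type*} [Category C] [Preadditive C] [Linear K C]
    {T : C} {V : Type} [Fintype V] {R : V → V → Prop} [∀ i j, Decidable (R i j)]
    (b : RelBasis K R (End T)) (hR : ∀ i, R i i) {X : V → C} (D : Decomp T X)
    (hD : ∀ k, D.prj k ≫ D.inc k = b.el k k) (k l : V) :
    Module.finrank K (X k ⟶ X l) = if R l k then 1 else 0 := by
  let L : (X k ⟶ X l) →ₗ[K] K :=
    { toFun := fun φ => b.coef l k (D.prj k ≫ φ ≫ D.inc l : T ⟶ T)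
      map_add' := fun φ ψ => by
        rw [Preadditive.add_comp, Preadditive.comp_add]; exact map_add (b.coef l k) _ _
      map_smul' := fun c φ => by
        rw [Linear.smul_comp, Linear.comp_smul]; exact map_smul (b.coef l k) _ _ }
  have hL : ∀ φ, (D.prj k ≫ φ ≫ D.inc l : T ⟶ T) = L φ • (b.el l k : End T) := fun φ => by
    refine Eq.trans ?_ (b.el_mul_mul_el hR l k _)
    change _ = b.el k k ≫ (D.prj k ≫ φ ≫ D.inc l) ≫ b.el l l
    rw [← hD, ← hD]
    simp only [Category.assoc, D.inc_prj_self_assoc]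
  have hinj : Function.Injective L := (injective_iff_map_eq_zero L).2 fun φ hφ => by
    have h1 := hL φ
    rw [hφ, zero_smul] at h1
    have h2 : φ = D.inc k ≫ (D.prj k ≫ φ ≫ D.inc l) ≫ D.prj l := by
      simp [D.inc_prj_self_assoc, D.inc_prj_self]
    rw [h2, h1]
    exact (congrArg (D.inc k ≫ ·) zero_comp).trans comp_zero
  split_ifs with h
  · have hsurj : Function.Surjective L := fun c => by
      refine ⟨c • (D.inc k ≫ (b.el l k : T ⟶ T) ≫ D.prj l), ?_⟩
      rw [map_smul]
      change c • b.coef l k (D.prj k ≫ (D.inc k ≫ (b.el l k : T ⟶ T) ≫ D.prj l) ≫ D.inc l : T ⟶ T) = c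
      have h1 : (D.prj k ≫ (D.inc k ≫ (b.el l k : T ⟶ T) ≫ D.prj l) ≫ D.inc l : T ⟶ T) =
          (b.el l k : End T) := by
        simp only [Category.assoc, hD]
        rw [← Category.assoc, hD]
        change b.el l l * b.el l k * b.el k k = b.el l k
        rw [b.mul_of_rel _ _ _ (hR l) h, b.mul_of_rel _ _ _ h (hR k)]
      rw [h1, b.coef_el _ _ _ _ h, if_pos ⟨rfl, rfl⟩, smul_eq_mul, mul_one]
    rw [(LinearEquiv.ofBijective L ⟨hinj, hsurj⟩).finrank_eq, Module.finrank_self]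
  · have : Subsingleton (X k ⟶ X l) := ⟨fun φ ψ => hinj (by
      change b.coef l k _ = b.coef l k _
      rw [b.coef_of_not h, LinearMap.zero_apply, LinearMap.zero_apply])⟩
    exact Module.finrank_zero_of_subsingleton

theorem Decomp.ext_eq_zero' {C : Type*} [Category C] [Abelian C] [HasExt.{w} C] {T : C} {κ : Type}
    [Fintype κ] {X : κ → C} (D : Decomp T X) {n : ℕ} (h : ∀ e : Abelian.Ext T T n, e = 0) (k l : κ)
    (e : Abelian.Ext (X k) (X l) n) : e = 0 := by
  have h1 := h (((Abelian.Ext.mk₀ (D.prj k)).comp e (zero_add n)).comp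
    (Abelian.Ext.mk₀ (D.inc l)) (add_zero n))
  have h2 := congrArg (fun x => ((Abelian.Ext.mk₀ (D.inc k)).comp x (zero_add n)).comp
    (Abelian.Ext.mk₀ (D.prj l)) (add_zero n)) h1
  simpa [D.inc_prj_self, Abelian.Ext.comp_assoc_of_third_deg_zero] using h2

/-- The symmetric bilinear forms of the algebras in the lists. -/
def gram (k : Fin 6) : Matrix (Fin 3) (Fin 3) ℤ := Matrix.of fun i j =>
  (if listBool k i j then 1 else 0) + if listBool k j i then 1 else 0

/-- The symmetric bilinear form of a graph. -/
def graphForm (S : Fin 3 → Fin 3 → Bool) : Matrix (Fin 3) (Fin 3) ℤ := Matrix.of fun i j =>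
  (if i = j then 2 else 0) - if S i j then 1 else 0

/-- Let x be the matrix of dimension vectors of the summands of a tilting module. Since Ext¹
vanishes between them, the Cartan matrix of the endomorphism algebra is x c xᵀ, where c is the
matrix of the Euler form. The symmetrization of c no longer depends on the orientation but only on
the graph, and determinants turn x into the factor `x.det ^ 2`. -/
theorem exists_det_gram_eq {V : Type} [Fintype V] [DecidableEq V] {G : SimpleGraph V}
    (hG : ∀ a b c d, G.Adj a b → G.Adj b c → G.Adj c d → a = c ∨ b = d) (σ : Fin 3 ≃ V)
    {S : Fin 3 → Fin 3 → Bool} (hS : ∀ i j, G.Adj (σ i) (σ j) ↔ S i j = true)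
    {B : Type v} [Ring B] [Algebra K B] (hB : IsTiltedOfGraph K G B) {k : Fin 6}
    (b : RelBasis K (listRel k) B) : ∃ x : ℤ, (gram k).det = x ^ 2 * (graphForm S).det := by
  classical
  obtain ⟨r, hr, T, hT, ⟨e⟩⟩ := hB
  let A := PathAlgebra K (RelQuiver r)
  have hadj : ∀ {a b}, r a b → G.Adj a b := fun h => (hr.1 _ _).2 (Or.inl h)
  -- Three consecutive arrows would have to turn back along an edge by `hG`, but each edge is
  -- oriented in one direction only.
  have hA : FiniteDimensional K A := PathAlgebra.finiteDimensional fun a b c d h1 h2 h3 => by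
    rcases hG a b c d (hadj h1) (hadj h2) (hadj h3) with rfl | rfl
    · exact hr.2 _ _ h1 h2
    · exact hr.2 _ _ h2 h3
  obtain ⟨X, D, hD⟩ := exists_decomp_of_relBasis (b.map e) (listRel_refl k)
  have hfin : ∀ k, @Module.Finite K (X k) _ _ (ModuleCat.moduleOfAlgebraModule (X k)) := fun k => by
    let := ModuleCat.moduleOfAlgebraModule (k := K) (X k)
    have := ModuleCat.isScalarTower_of_algebra_moduleCat (k := K) (X k)
    have := hT.finite
    have : Module.Finite Aᵐᵒᵖ (X k) := Module.Finite.of_surjective (D.prj k).hom fun x =>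
      ⟨(D.inc k).hom x, congrArg (fun φ : X k ⟶ X k => φ.hom x) (D.inc_prj_self k)⟩
    have : Module.Finite K Aᵐᵒᵖ := Module.Finite.equiv (MulOpposite.opLinearEquiv K)
    exact Module.Finite.trans Aᵐᵒᵖ (X k)
  have hE : ∀ k l, ∀ e : Abelian.Ext (X k) (X l) 1, e = 0 :=
    D.ext_eq_zero' fun e => hT.ext_one.elim _ _
  let (p : RelQuiver r × RelQuiver r) : Fintype (p.1 ⟶ p.2) :=
    inferInstanceAs (Fintype (PLift (r p.1 p.2)))
  let τ : Fin 3 ≃ RelQuiver r := σ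
  let x : Matrix (Fin 3) (Fin 3) ℤ := Matrix.of fun m i => (PathAlgebra.dimAt (X m) (σ i) : ℤ)
  let c : Matrix (Fin 3) (Fin 3) ℤ := Matrix.of fun i j =>
    (if i = j then 1 else 0) - if r (σ i) (σ j) then 1 else 0
  let g : Matrix (Fin 3) (Fin 3) ℤ := Matrix.of fun i j => if listBool k j i then 1 else 0
  -- The entry at (m, n) is the Euler form formula for the summands `X m` and `X n`; the sum over
  -- the arrows is rewritten as a sum over pairs of vertices.
  have key : g = x * c * x.transpose := by
    ext m n
    have h1 := PathAlgebra.finrank_hom_add (hE m n)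
    rw [finrank_hom_of_relBasis (b.map e) (listRel_refl k) D hD] at h1
    have h2 : ∑ a : Σ p : RelQuiver r × RelQuiver r, p.1 ⟶ p.2,
        (PathAlgebra.dimAt (X m) a.1.1 * PathAlgebra.dimAt (X n) a.1.2 : ℤ) =
        ∑ i, ∑ j, x m i * (if r (σ i) (σ j) then 1 else 0) * x n j := by
      rw [Fintype.sum_sigma]
      refine (Fintype.sum_prod_type _).trans ?_
      refine (Equiv.sum_comp τ _).symm.trans (Finset.sum_congr rfl fun i _ => ?_)
      refine (Equiv.sum_comp τ _).symm.trans (Finset.sum_congr rfl fun j _ => ?_)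
      change ∑ _a : ((τ i, τ j) : RelQuiver r × RelQuiver r).1 ⟶ (τ i, τ j).2, x m i * x n j = _
      rw [Finset.sum_const]
      have h3 : (Finset.univ :
          Finset (((τ i, τ j) : RelQuiver r × RelQuiver r).1 ⟶ (τ i, τ j).2)).card = if r (σ i) (σ j) then 1 else 0 := by
        change Fintype.card (PLift (r (σ i) (σ j))) = _
        split_ifs with hij
        · exact Fintype.card_eq_one_iff.2 ⟨⟨hij⟩, fun _ => rfl⟩
        · exact Fintype.card_eq_zero_iff.2 ⟨fun a => hij a.down⟩
      rw [h3, nsmul_eq_mul]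
      simp only [x, Matrix.of_apply]
      split_ifs
      · simp
      · simp
    have h3 : ∑ i, (PathAlgebra.dimAt (X m) i * PathAlgebra.dimAt (X n) i : ℤ) =
        ∑ i, x m i * x n i :=
      (Equiv.sum_comp τ _).symm
    have h4 : g m n + ∑ i, ∑ j, x m i * (if r (σ i) (σ j) then 1 else 0) * x n j =
        ∑ i, x m i * x n i := by
      have h5 := congrArg (Nat.cast : ℕ → ℤ) h1
      push_cast at h5
      rw [← h2, ← h3, ← h5]
      rfl
    rw [← add_left_inj, h4]
    simp only [Matrix.mul_apply, Matrix.transpose_apply, Finset.sum_mul, c, Matrix.of_apply]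
    rw [Finset.sum_comm, ← Finset.sum_add_distrib]
    refine Finset.sum_congr rfl fun i _ => ?_
    simp [mul_sub, sub_mul]
  refine ⟨x.det, ?_⟩
  have h1 : gram k = g + g.transpose := by
    ext i j; simp [gram, g, add_comm]
  have h2 : graphForm S = c + c.transpose := by
    ext i j
    have h3 := hr.2 (σ i) (σ j)
    have h4 := hr.1 (σ i) (σ j)
    rw [hS] at h4
    simp only [graphForm, c, Matrix.of_apply, Matrix.add_apply, Matrix.transpose_apply,
      eq_comm (a := j)]
    rcases eq_or_ne i j with rfl | hij
    · have h5 : ¬ r (σ i) (σ i) := fun h => h3 h h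
      simp [h4, h5]
    · by_cases h5 : r (σ i) (σ j)
      · simp [h4, h5, h3 h5, hij]
      · simp [h4, h5, hij]
  have h3 : gram k = x * graphForm S * x.transpose := by
    rw [h1, key, h2]
    simp only [Matrix.transpose_mul, Matrix.transpose_transpose, Matrix.mul_add, Matrix.add_mul,
      Matrix.mul_assoc]
  rw [h3, Matrix.det_mul, Matrix.det_mul, Matrix.det_transpose]
  ring

theorem lt_four_of_isTiltedOfGraph_graphA3 {k : Fin 6}
    (h : IsTiltedOfGraph K graphA3 (listSink K k)) : k < 4 := by
  obtain ⟨b⟩ := nonempty_relBasis_listSink K k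
  obtain ⟨x, hx⟩ := exists_det_gram_eq (by simp only [SimpleGraph.pathGraph_adj]; decide)
    (Equiv.refl _) (S := fun i j => i.val + 1 = j.val ∨ j.val + 1 = i.val)
    (by simp only [SimpleGraph.pathGraph_adj]; decide) h b
  rw [show (graphForm _).det = 4 by decide] at hx
  -- Neither 6 nor 8 is four times the square of an integer.
  have h1 : ∀ k, (gram k).det = 4 ∧ k < 4 ∨ (gram k).det = 6 ∨ (gram k).det = 8 := by decide
  rcases h1 k with h1 | h1 | h1
  · exact h1.2
  · rw [h1] at hx; omega
  · have h2 : x.natAbs ^ 2 = 2 := by zify; rw [sq_abs]; omega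
    have h3 : x.natAbs < 2 := by nlinarith
    interval_cases x.natAbs <;> simp at h2

theorem eq_four_of_isTiltedOfGraph_graphA2A1 {k : Fin 6}
    (h : IsTiltedOfGraph K graphA2A1 (listSink K k)) : k = 4 := by
  obtain ⟨b⟩ := nonempty_relBasis_listSink K k
  obtain ⟨x, hx⟩ := exists_det_gram_eq (by simp [SimpleGraph.pathGraph_adj])
    (finSumFinEquiv (m := 2) (n := 1)).symm
    (S := fun i j => (i = 0 ∧ j = 1) ∨ (i = 1 ∧ j = 0))
    (by
      have h1 : ∀ u v : Fin 2 ⊕ Fin 1, graphA2A1.Adj u v ↔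
          (u = Sum.inl 0 ∧ v = Sum.inl 1) ∨ (u = Sum.inl 1 ∧ v = Sum.inl 0) := by
        rintro (u | u) (v | v)
        · simp only [SimpleGraph.sum_adj, SimpleGraph.pathGraph_adj]; revert u v; decide
        · simp
        · simp
        · simp [SimpleGraph.pathGraph_adj]
      simp only [h1]
      decide) h b
  rw [show (graphForm _).det = 6 by decide] at hx
  have h1 : ∀ k, (gram k).det = 4 ∨ (gram k).det = 6 ∧ k = 4 ∨ (gram k).det = 8 := by decide
  rcases h1 k with h1 | h1 | h1
  · rw [h1] at hx; omega
  · exact h1.2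
  · rw [h1] at hx; omega

theorem eq_five_of_isTiltedOfGraph_graphA1A1A1 {k : Fin 6}
    (h : IsTiltedOfGraph K graphA1A1A1 (listSink K k)) : k = 5 := by
  obtain ⟨b⟩ := nonempty_relBasis_listSink K k
  obtain ⟨x, hx⟩ := exists_det_gram_eq (by simp [SimpleGraph.pathGraph_adj])
    ((finSumFinEquiv (m := 2) (n := 1)).symm.trans
      (Equiv.sumCongr (finSumFinEquiv (m := 1) (n := 1)).symm (Equiv.refl _)))
    (S := fun _ _ => false)
    (by
      have h1 : ∀ u v : (Fin 1 ⊕ Fin 1) ⊕ Fin 1, ¬ graphA1A1A1.Adj u v := by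
        rintro ((u | u) | u) ((v | v) | v) <;> simp [SimpleGraph.pathGraph_adj]
      exact fun i j => iff_of_false (h1 _ _) (by decide)) h b
  rw [show (graphForm _).det = 8 by decide] at hx
  have h1 : ∀ k, (gram k).det = 4 ∨ (gram k).det = 6 ∨ (gram k).det = 8 ∧ k = 5 := by decide
  rcases h1 k with h1 | h1 | h1
  · rw [h1] at hx; omega
  · rw [h1] at hx; omega
  · exact h1.2

end
end Silted

namespace Silted
open CategoryTheory CategoryTheory.Limits MulOpposite

/-! ### Complexes concentrated in the degrees -1 and 0 -/

section

variable {C : Type*} [Category C] [Preadditive C]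

variable (C) in
/-- The functor to the homotopy category. -/
abbrev qHo := HomotopyCategory.quotient C (ComplexShape.up ℤ)

open CochainComplex.HomComplex in
/-- All morphisms to a shift vanish if this holds degreewise. -/
theorem eq_zero_of_shift {P Q : CochainComplex C ℤ} {n : ℤ}
    (h : ∀ z : Cocycle P Q n, ∃ β : Cochain P Q (n - 1), δ (n - 1) n β = z)
    (f : (qHo C).obj P ⟶ ((qHo C).obj Q)⟦n⟧) : f = 0 := by
  rw [← cancel_mono (((qHo C).commShiftIso n).inv.app Q), zero_comp]
  obtain ⟨g, hg⟩ := (CohomologyClass.toHom_bijective P Q n).2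
    (f ≫ ((qHo C).commShiftIso n).inv.app Q)
  obtain ⟨z, rfl⟩ := g.mk_surjective
  obtain ⟨β, hβ⟩ := h z
  change _ = f ≫ ((qHo C).commShiftIso n).inv.app Q at hg
  rw [← hg, CohomologyClass.toHom_mk_eq_zero_iff, mem_coboundaries_iff z (n - 1) (by omega)]
  exact ⟨β, hβ⟩

open CochainComplex.HomComplex in
theorem exists_of_shift_eq_zero {P Q : CochainComplex C ℤ} {n : ℤ}
    (h : ∀ f : (qHo C).obj P ⟶ ((qHo C).obj Q)⟦n⟧, f = 0) (z : Cocycle P Q n) :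
    ∃ β : Cochain P Q (n - 1), δ (n - 1) n β = z := by
  rw [← mem_coboundaries_iff z (n - 1) (by omega), ← CohomologyClass.toHom_mk_eq_zero_iff,
    ← cancel_mono (((qHo C).commShiftIso n).hom.app Q), zero_comp]
  exact h _

theorem hom_ext_of_twoTerm {P Q : CochainComplex C ℤ}
    (hP : ∀ i : ℤ, i ≠ -1 → i ≠ 0 → IsZero (P.X i)) {f g : P ⟶ Q} (h1 : f.f (-1) = g.f (-1))
    (h0 : f.f 0 = g.f 0) : f = g := by
  refine HomologicalComplex.hom_ext _ _ fun i => ?_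
  by_cases hi : i = -1
  · rw [hi]; exact h1
  · by_cases hi' : i = 0
    · rw [hi']; exact h0
    · exact (hP i hi hi').eq_of_src _ _

section

open CochainComplex.HomComplex

variable {P Q : CochainComplex C ℤ}

/-- A homotopy lowers the degree by one, so between complexes in the degrees -1 and 0 it has a
single component, from degree 0 to degree -1. -/
theorem quotient_map_eq_zero_iff (hP : ∀ i : ℤ, i ≠ -1 → i ≠ 0 → IsZero (P.X i))
    (hQ : ∀ i : ℤ, i ≠ -1 → i ≠ 0 → IsZero (Q.X i)) (f : P ⟶ Q) :
    (qHo C).map f = 0 ↔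
    ∃ s : P.X 0 ⟶ Q.X (-1), f.f (-1) = P.d (-1) 0 ≫ s ∧ f.f 0 = s ≫ Q.d (-1) 0 := by
  rw [HomotopyCategory.quotient_map_eq_zero_iff]
  have hδ : ∀ (z : Cochain P Q (-1)), (δ (-1) 0 z).v (-1) (-1) rfl = P.d (-1) 0 ≫ z.v 0 (-1) rfl ∧
      (δ (-1) 0 z).v 0 0 rfl = z.v 0 (-1) rfl ≫ Q.d (-1) 0 := fun z => by
    constructor
    · rw [δ_v (-1) 0 rfl z (-1) (-1) rfl (-2) 0 rfl rfl,
        (hQ (-2) (by omega) (by omega)).eq_of_tgt (z.v (-1) (-2) _) 0]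
      simp
    · rw [δ_v (-1) 0 rfl z 0 0 rfl (-1) 1 rfl rfl,
        (hP 1 (by omega) (by omega)).eq_of_src (z.v 1 0 _) 0]
      simp
  constructor
  · rintro ⟨H⟩
    obtain ⟨z, hz⟩ := Cochain.equivHomotopy _ _ H
    rw [Cochain.ofHom_zero, add_zero] at hz
    refine ⟨z.v 0 (-1) rfl, ?_, ?_⟩
    · rw [← (hδ z).1, ← hz, Cochain.ofHom_v]
    · rw [← (hδ z).2, ← hz, Cochain.ofHom_v]
  · rintro ⟨s, h1, h0⟩
    refine ⟨(Cochain.equivHomotopy _ _).symm ⟨Cochain.single s (-1), ?_⟩⟩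
    rw [Cochain.ofHom_zero, add_zero]
    have hs := hδ (Cochain.single s (-1))
    rw [Cochain.single_v, ← h1, ← h0] at hs
    ext p
    by_cases hp : p = -1
    · subst hp; rw [hs.1, Cochain.ofHom_v]
    · by_cases hp' : p = 0
      · subst hp'; rw [hs.2, Cochain.ofHom_v]
      · exact (hP p hp hp').eq_of_src _ _

/-- Morphisms to the shift of a two-term complex. -/
theorem shift_one_iff (hP : ∀ i : ℤ, i ≠ -1 → i ≠ 0 → IsZero (P.X i))
    (hQ : ∀ i : ℤ, i ≠ -1 → i ≠ 0 → IsZero (Q.X i)) :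
    (∀ f : (qHo C).obj P ⟶ ((qHo C).obj Q)⟦(1 : ℤ)⟧, f = 0) ↔
    ∀ h : P.X (-1) ⟶ Q.X 0, ∃ (s : P.X (-1) ⟶ Q.X (-1)) (t : P.X 0 ⟶ Q.X 0),
      h = s ≫ Q.d (-1) 0 + P.d (-1) 0 ≫ t := by
  constructor
  · intro H h
    obtain ⟨β, hβ⟩ := exists_of_shift_eq_zero H (Cocycle.mk (Cochain.single h 1) 2 rfl (by
      ext p q hpq
      by_cases hp : p = -1
      · exact (hQ q (by omega) (by omega)).eq_of_tgt _ _
      · by_cases hp' : p = 0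
        · exact (hQ q (by omega) (by omega)).eq_of_tgt _ _
        · exact (hP p hp hp').eq_of_src _ _))
    refine ⟨β.v (-1) (-1) rfl, -β.v 0 0 rfl, ?_⟩
    have h1 := congrArg (fun z => z.v (-1) 0 rfl) hβ
    change (δ 0 1 β).v (-1) 0 rfl = (Cochain.single h 1).v (-1) 0 rfl at h1
    rw [δ_zero_cochain_v, Cochain.single_v] at h1
    rw [← h1, Preadditive.comp_neg, sub_eq_add_neg]
  · intro H
    refine eq_zero_of_shift fun z => ?_
    obtain ⟨s, t, hst⟩ := H (z.1.v (-1) 0 rfl)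
    -- The coboundary of a cochain β of degree 0 is β ≫ d - d ≫ β, so the component in degree 0 has
    -- to be -t.
    refine ⟨(Cochain.single s 0 - Cochain.single t 0 : Cochain P Q 0), ?_⟩
    ext p q hpq
    by_cases hp : p = -1
    · subst hp
      obtain rfl : q = 0 := by omega
      change (δ 0 1 _).v (-1) 0 rfl = _
      rw [δ_zero_cochain_v, hst]
      simp [Cochain.sub_v, Cochain.single_v, Cochain.single_v_eq_zero]
    · by_cases hp' : p = 0
      · exact (hQ q (by omega) (by omega)).eq_of_tgt _ _
      · exact (hP p hp hp').eq_of_src _ _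

end

open CochainComplex.HomComplex in
/-- Morphisms to a shift vanish if there are no nonzero homomorphisms of this degree. -/
theorem shift_eq_zero {P Q : CochainComplex C ℤ} {n : ℤ}
    (hn : ∀ p q : ℤ, p + n = q → IsZero (P.X p) ∨ IsZero (Q.X q))
    (f : (qHo C).obj P ⟶ ((qHo C).obj Q)⟦n⟧) : f = 0 := by
  refine eq_zero_of_shift (fun z => ⟨0, ?_⟩) f
  ext p q hpq
  rcases hn p q hpq with h | h
  · exact h.eq_of_src _ _
  · exact h.eq_of_tgt _ _

variable [HasZeroObject C]

open ZeroObject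

/-- The complex with the differential `d` from degree `-1` to degree `0`. -/
noncomputable def tw {Y X : C} (d : Y ⟶ X) : CochainComplex C ℤ where
  -- The match is on the constructors of ℤ, with `.negSucc 0` for -1, so that the two terms and the
  -- differential are given by reduction and components can be compared by `rfl`.
  X
    | .negSucc 0 => Y
    | .ofNat 0 => X
    | _ => 0
  d
    | .negSucc 0, .ofNat 0 => d
    | _, _ => 0
  shape i j h := by
    match i, j, h with
    | .negSucc 0, .ofNat 0, h => exact absurd rfl h
    | .negSucc 0, .ofNat (_ + 1), _ => rfl
    | .negSucc 0, .negSucc _, _ => rfl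
    | .negSucc (_ + 1), _, _ => rfl
    | .ofNat _, _, _ => rfl
  d_comp_d' i j k _ _ := by
    match i, j, k with
    | _, .ofNat _, _ => exact comp_zero
    | _, .negSucc (_ + 1), _ => exact comp_zero
    | .negSucc 0, .negSucc 0, _ => exact zero_comp
    | .negSucc (_ + 1), .negSucc 0, _ => exact zero_comp
    | .ofNat _, .negSucc 0, _ => exact zero_comp

theorem isZero_tw {Y X : C} (d : Y ⟶ X) : ∀ i : ℤ, i ≠ -1 → i ≠ 0 → IsZero ((tw d).X i)
  | .negSucc 0, h, _ => absurd rfl h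
  | .ofNat 0, _, h => absurd rfl h
  | .negSucc (_ + 1), _, _ => isZero_zero C
  | .ofNat (_ + 1), _, _ => isZero_zero C

/-- A chain map between complexes in the degrees `-1` and `0`. -/
noncomputable def homOfTwoTerm {P Q : CochainComplex C ℤ}
    (hP : ∀ i : ℤ, i ≠ -1 → i ≠ 0 → IsZero (P.X i)) (hQ : ∀ i : ℤ, i ≠ -1 → i ≠ 0 → IsZero (Q.X i))
    (x : P.X (-1) ⟶ Q.X (-1)) (y : P.X 0 ⟶ Q.X 0) (h : P.d (-1) 0 ≫ y = x ≫ Q.d (-1) 0) : P ⟶ Q where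
  f
    | .negSucc 0 => x
    | .ofNat 0 => y
    | .negSucc (_ + 1) => 0
    | .ofNat (_ + 1) => 0
  comm' i j hij := by
    match i, j, hij with
    | .negSucc 0, .ofNat 0, _ => exact h.symm
    | .negSucc 0, .ofNat (_ + 1), hij => exact absurd hij (by simp; omega)
    | .negSucc 0, .negSucc _, hij => exact absurd hij (by simp)
    | .negSucc (_ + 1), _, _ => exact (hP _ (by omega) (by omega)).eq_of_src _ _
    | .ofNat n, j, hij =>
      have hij' : (n : ℤ) + 1 = j := hij
      exact (hQ j (by omega) (by omega)).eq_of_tgt _ _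

/-- Two-term complexes are given by their differentials. -/
noncomputable def isoTw {P : CochainComplex C ℤ}
    (hP : ∀ i : ℤ, i ≠ -1 → i ≠ 0 → IsZero (P.X i)) : P ≅ tw (P.d (-1) 0) where
  hom := homOfTwoTerm hP (isZero_tw _) (𝟙 _) (𝟙 _) ((Category.comp_id _).trans (Category.id_comp _).symm)
  inv := homOfTwoTerm (isZero_tw _) hP (𝟙 _) (𝟙 _) ((Category.comp_id _).trans (Category.id_comp _).symm)
  hom_inv_id := hom_ext_of_twoTerm hP (Category.comp_id _) (Category.comp_id _)
  inv_hom_id := hom_ext_of_twoTerm (isZero_tw _) (Category.comp_id _) (Category.comp_id _)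

section

variable {Y X Y' X' Y'' X'' : C} {d : Y ⟶ X} {d' : Y' ⟶ X'} {d'' : Y'' ⟶ X''}

/-- The chain map given by a commutative square. -/
noncomputable def twHom (x : Y ⟶ Y') (y : X ⟶ X') (h : d ≫ y = x ≫ d') : tw d ⟶ tw d' :=
  homOfTwoTerm (isZero_tw d) (isZero_tw d') x y h

theorem tw_hom_ext {f g : tw d ⟶ tw d'} (h1 : f.f (-1) = g.f (-1)) (h0 : f.f 0 = g.f 0) : f = g := hom_ext_of_twoTerm (isZero_tw d) h1 h0

theorem twHom_comp (x : Y ⟶ Y') (y : X ⟶ X') (h : d ≫ y = x ≫ d') (x' : Y' ⟶ Y'') (y' : X' ⟶ X'')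
    (h' : d' ≫ y' = x' ≫ d'') : twHom x y h ≫ twHom x' y' h' = twHom (x ≫ x') (y ≫ y')
      (by rw [← Category.assoc, h, Category.assoc, h', Category.assoc]) :=
  tw_hom_ext rfl rfl

theorem twHom_id : twHom (𝟙 Y) (𝟙 X) (by simp) = 𝟙 (tw d) := tw_hom_ext rfl rfl

theorem exists_twHom (f : tw d ⟶ tw d') : ∃ x y h, f = twHom x y h := by
  have h1 := f.f (-1)
  have h := (f.comm (-1) 0).symm
  exact ⟨_, _, h, tw_hom_ext rfl rfl⟩

/-- The morphism in the homotopy category given by a commutative square. -/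
noncomputable def hoHom (x : Y ⟶ Y') (y : X ⟶ X') (h : d ≫ y = x ≫ d') :
    (qHo C).obj (tw d) ⟶ (qHo C).obj (tw d') := (qHo C).map (twHom x y h)

theorem hoHom_comp (x : Y ⟶ Y') (y : X ⟶ X') (h : d ≫ y = x ≫ d') (x' : Y' ⟶ Y'') (y' : X' ⟶ X'')
    (h' : d' ≫ y' = x' ≫ d'') : hoHom x y h ≫ hoHom x' y' h' = hoHom (x ≫ x') (y ≫ y')
      (by rw [← Category.assoc, h, Category.assoc, h', Category.assoc]) := by
  rw [hoHom, hoHom, ← Functor.map_comp, twHom_comp]; rfl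

theorem hoHom_id : hoHom (𝟙 Y) (𝟙 X) (by simp) = 𝟙 ((qHo C).obj (tw d)) := by
  rw [hoHom, twHom_id, CategoryTheory.Functor.map_id]

theorem exists_hoHom (f : (qHo C).obj (tw d) ⟶ (qHo C).obj (tw d')) :
    ∃ x y h, f = hoHom x y h := by
  obtain ⟨g, rfl⟩ := (qHo C).map_surjective f
  obtain ⟨x, y, h, rfl⟩ := exists_twHom g
  exact ⟨x, y, h, rfl⟩

theorem smul_hoHom {K : Type*} [Field K] [Linear K C] (c : K) (x : Y ⟶ Y') (y : X ⟶ X')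
    (h : d ≫ y = x ≫ d') :
    c • hoHom x y h = hoHom (c • x) (c • y) (by rw [Linear.comp_smul, h, Linear.smul_comp]) := by
  have : twHom (c • x) (c • y) (by rw [Linear.comp_smul, h, Linear.smul_comp]) =
    c • twHom x y h := tw_hom_ext rfl rfl
  rw [hoHom, hoHom, this, Functor.map_smul]

theorem hoHom_eq_zero_iff (x : Y ⟶ Y') (y : X ⟶ X') (h : d ≫ y = x ≫ d') :
    hoHom x y h = 0 ↔ ∃ s : X ⟶ Y', x = d ≫ s ∧ y = s ≫ d' :=
  quotient_map_eq_zero_iff (isZero_tw d) (isZero_tw d') (twHom x y h)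

/-- Morphisms to the shift of a two-term complex. -/
theorem tw_shift_one_iff :
    (∀ f : (qHo C).obj (tw d) ⟶ ((qHo C).obj (tw d'))⟦(1 : ℤ)⟧, f = 0) ↔
      ∀ h : Y ⟶ X', ∃ (s : Y ⟶ Y') (t : X ⟶ X'), h = s ≫ d' + d ≫ t :=
  shift_one_iff (isZero_tw d) (isZero_tw d')

end

end
end Silted

namespace Silted
open CategoryTheory CategoryTheory.Limits MulOpposite

/-! ### Triangulated subcategories of the homotopy category -/

theorem Decomp.prop {C : Type*} [Category C] [Preadditive C] [HasFiniteBiproducts C]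
    (S : ObjectProperty C) [S.IsClosedUnderIsomorphisms] [S.IsClosedUnderFiniteProducts] {T : C} {κ : Type} [Fintype κ]
    {X : κ → C} (D : Decomp T X) (h : ∀ k, S (X k)) : S T := by
  have h1 : S (∏ᶜ X) := S.prop_pi _ h
  exact S.prop_of_iso (D.iso (Decomp.biproduct X) ≪≫ biproduct.isoProduct X).symm h1

section

variable {C : Type u} [Category.{v} C] [Abelian C] (S : ObjectProperty (HomotopyCategory C (ComplexShape.up ℤ)))

open Pretriangulated

theorem distinguished_of_splitting (T : ShortComplex (CochainComplex C ℤ))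
    (σ : ∀ n, (T.map (HomologicalComplex.eval C _ n)).Splitting) :
    CochainComplex.trianglehOfDegreewiseSplit T σ ∈ distTriang _ :=
  (HomotopyCategory.distinguished_iff_iso_trianglehOfDegreewiseSplit _).2 ⟨T, σ, ⟨Iso.refl _⟩⟩

open ZeroObject

/-- An object in degree `0`, as a two-term complex. -/
noncomputable abbrev st (X : C) : CochainComplex C ℤ := tw (0 : 0 ⟶ X)

/-- An object in degree `-1`, as a two-term complex. -/
noncomputable abbrev sh (Y : C) : CochainComplex C ℤ := tw (0 : Y ⟶ 0)

/-- The triangle given by the two terms of a two-term complex. -/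
theorem exists_distinguished_tw {Y X : C} (d : Y ⟶ X) :
    ∃ T ∈ distTriang (HomotopyCategory C (ComplexShape.up ℤ)), T.obj₁ = (qHo C).obj (st X) ∧
      T.obj₂ = (qHo C).obj (tw d) ∧ T.obj₃ = (qHo C).obj (sh Y) := by
  let T : ShortComplex (CochainComplex C ℤ) := ShortComplex.mk
    (twHom (d := (0 : (0 : C) ⟶ X)) (d' := d) 0 (𝟙 X) (by simp))
    (twHom (d' := (0 : Y ⟶ (0 : C))) (𝟙 Y) (0 : X ⟶ (0 : C)) (by simp))
    (tw_hom_ext ((isZero_zero C).eq_of_src _ _) ((isZero_zero C).eq_of_tgt _ _))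
  refine ⟨_, distinguished_of_splitting T fun n => ?_, rfl, rfl, rfl⟩
  match n with
  | .negSucc 0 => exact
    { r := (0 : Y ⟶ 0)
      s := 𝟙 Y
      f_r := (isZero_zero C).eq_of_src _ _
      s_g := Category.id_comp (𝟙 Y)
      id := by
        change (0 : Y ⟶ 0) ≫ (0 : 0 ⟶ Y) + 𝟙 Y ≫ 𝟙 Y = 𝟙 Y
        simp }
  | .ofNat 0 => exact
    { r := 𝟙 X
      s := (0 : 0 ⟶ X)
      f_r := Category.id_comp (𝟙 X)
      s_g := (isZero_zero C).eq_of_src _ _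
      id := by
        change 𝟙 X ≫ 𝟙 X + (0 : X ⟶ 0) ≫ (0 : 0 ⟶ X) = 𝟙 X
        simp }
  | .negSucc (_ + 1) => exact
    { r := 0, s := 0
      f_r := (isZero_zero C).eq_of_src _ _
      s_g := (isZero_zero C).eq_of_src _ _
      id := (isZero_zero C).eq_of_src _ _ }
  | .ofNat (_ + 1) => exact
    { r := 0, s := 0
      f_r := (isZero_zero C).eq_of_src _ _
      s_g := (isZero_zero C).eq_of_src _ _
      id := (isZero_zero C).eq_of_src _ _ }

variable [S.IsTriangulated] [S.IsStableUnderRetracts]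

variable {S}

theorem prop_st_of_tw {Y X : C} {d : Y ⟶ X} (h : S ((qHo C).obj (tw d)))
    (hY : S ((qHo C).obj (sh Y))) : S ((qHo C).obj (st X)) := by
  obtain ⟨T, hT, h1, h2, h3⟩ := exists_distinguished_tw d
  exact h1 ▸ S.ext_of_isTriangulatedClosed₁ T hT (h2 ▸ h) (h3 ▸ hY)

theorem prop_sh_of_tw {Y X : C} {d : Y ⟶ X} (h : S ((qHo C).obj (tw d)))
    (hX : S ((qHo C).obj (st X))) : S ((qHo C).obj (sh Y)) := by
  obtain ⟨T, hT, h1, h2, h3⟩ := exists_distinguished_tw d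
  exact h3 ▸ S.ext_of_isTriangulatedClosed₃ T hT (h1 ▸ hX) (h2 ▸ h)

theorem isZero_tw_of_isIso {Y X : C} (d : Y ⟶ X) [IsIso d] : IsZero ((qHo C).obj (tw d)) := by
  rw [IsZero.iff_id_eq_zero, ← hoHom_id, hoHom_eq_zero_iff]
  exact ⟨inv d, by simp, by simp⟩

/-- The complex with differential `𝟙 X` is contractible, so it belongs to S; its triangle links the
two placements of X. -/
theorem prop_st_iff_sh (X : C) : S ((qHo C).obj (st X)) ↔ S ((qHo C).obj (sh X)) := by
  have h : S ((qHo C).obj (tw (𝟙 X))) := S.prop_of_isZero (isZero_tw_of_isIso _)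
  exact ⟨prop_sh_of_tw h, prop_st_of_tw h⟩

/-- Together with the next lemma this is two-out-of-three for a two-term complex and its terms, both
placed in degree 0. Generation of silting complexes is derived from it. -/
theorem prop_st_of_tw' {Y X : C} {d : Y ⟶ X} (h : S ((qHo C).obj (tw d)))
    (hY : S ((qHo C).obj (st Y))) : S ((qHo C).obj (st X)) :=
  prop_st_of_tw h ((prop_st_iff_sh Y).1 hY)

theorem prop_st_of_tw'' {Y X : C} {d : Y ⟶ X} (h : S ((qHo C).obj (tw d)))
    (hX : S ((qHo C).obj (st X))) : S ((qHo C).obj (st Y)) :=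
  (prop_st_iff_sh Y).2 (prop_sh_of_tw h hX)

theorem prop_shift_iff (Q : CochainComplex C ℤ) (n : ℤ) :
    S ((qHo C).obj (Q⟦n⟧)) ↔ S ((qHo C).obj Q) := by
  have e := ((qHo C).commShiftIso n).app Q
  refine Iff.trans ⟨S.prop_of_iso e, S.prop_of_iso e.symm⟩ ⟨fun h => ?_, S.le_shift n _⟩
  have h2 : S ((((qHo C).obj Q)⟦n⟧)⟦-n⟧) := S.le_shift (-n) _ h
  exact S.prop_of_iso ((shiftEquiv _ n).unitIso.app _).symm h2

/-- Dévissage for bounded complexes. -/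
theorem prop_of_bounded {p : ObjectProperty C} (hp : p ≤ isProjective C) [p.IsClosedUnderIsomorphisms]
    [p.ContainsZero]
    (h : ∀ X, p X → S ((qHo C).obj ((HomologicalComplex.single C (ComplexShape.up ℤ) 0).obj X))) (n : ℕ) :
    ∀ Q : CochainComplex C ℤ, (∀ i, p (Q.X i)) → (∀ i : ℤ, i ≤ -n → IsZero (Q.X i)) →
      (∀ i : ℤ, 0 < i → IsZero (Q.X i)) → S ((qHo C).obj Q) := by
  induction n with
  | zero =>
    intro Q _ h1 h2
    refine S.prop_of_isZero (Functor.map_isZero (qHo C) ?_)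
    rw [IsZero.iff_id_eq_zero]
    ext i
    by_cases hi : i ≤ 0
    · exact (h1 i (by simpa using hi)).eq_of_src _ _
    · exact (h2 i (by omega)).eq_of_src _ _
  | succ n ih =>
    intro Q hQ h1 h2
    -- The top term is a subcomplex; the quotient lives in negative degrees and, shifted by -1, is
    -- one term shorter. The sequence splits degreewise by projectivity and so gives a triangle.
    let f : (HomologicalComplex.single C (ComplexShape.up ℤ) 0).obj (Q.X 0) ⟶ Q :=
      HomologicalComplex.mkHomFromSingle (𝟙 _) fun k hk => by
        obtain rfl : 1 = k := by simpa using hk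
        exact (h2 1 one_pos).eq_of_tgt _ _
    have hf : IsIso (f.f 0) := by
      rw [HomologicalComplex.mkHomFromSingle_f]; infer_instance
    have hz : ∀ i : ℤ, i ≠ 0 → IsZero (((HomologicalComplex.single C (ComplexShape.up ℤ) 0).obj (Q.X 0)).X i) :=
      fun i hi => HomologicalComplex.isZero_single_obj_X _ _ _ _ hi
    have hm : ∀ i, Mono (f.f i) := fun i => by
      by_cases hi : i = 0
      · subst hi; infer_instance
      · exact ⟨fun _ _ _ => (hz i hi).eq_of_tgt _ _⟩
    have : Mono f := HomologicalComplex.mono_of_mono_f _ hm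
    let T := ShortComplex.mk f (cokernel.π f) (cokernel.condition f)
    have hT : T.ShortExact :=
      { exact := ShortComplex.exact_cokernel f
        mono_f := this
        epi_g := inferInstanceAs (Epi (cokernel.π f)) }
    have hTn : ∀ i, (T.map (HomologicalComplex.eval C _ i)).ShortExact := fun i =>
      hT.map_of_exact (HomologicalComplex.eval C _ i)
    have hX0 : IsZero ((cokernel f).X 0) := by
      have h3 := (hTn 0).exact.epi_f_iff
      have h4 : (cokernel.π f).f 0 = 0 := by
        rw [← cancel_epi (f.f 0), comp_zero]
        exact congrArg (fun z => z.f 0) (cokernel.condition f)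
      have := (hTn 0).epi_g
      exact IsZero.of_epi_eq_zero ((cokernel.π f).f 0) h4
    have hX0' : ∀ i : ℤ, i = 0 → IsZero ((cokernel f).X i) := by rintro i rfl; exact hX0
    have hXi : ∀ i : ℤ, i ≠ 0 → Nonempty (Q.X i ≅ (cokernel f).X i) := fun i hi => by
      have : IsIso (T.map (HomologicalComplex.eval C _ i)).g := (hTn i).isIso_g_iff.2 (hz i hi)
      exact ⟨@asIso _ _ _ _ _ this⟩
    have hpX : ∀ i, p ((cokernel f).X i) := fun i => by
      by_cases hi : i = 0
      · subst hi; exact p.prop_of_isZero hX0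
      · obtain ⟨e⟩ := hXi i hi
        exact p.prop_of_iso e (hQ i)
    have h3 : S ((qHo C).obj (cokernel f)) := by
      refine (prop_shift_iff _ (-1)).1 ?_
      refine ih _ (fun i => hpX _) (fun i hi => ?_) fun i hi => ?_
      · by_cases hi' : i + (-1) = 0
        · exact hX0' _ hi'
        · obtain ⟨e⟩ := hXi (i + (-1)) hi'
          exact (h1 _ (by push_cast; omega)).of_iso e.symm
      · by_cases hi' : i + (-1) = 0
        · exact hX0' _ hi'
        · obtain ⟨e⟩ := hXi (i + (-1)) hi'
          exact (h2 _ (by omega)).of_iso e.symm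
    have h4 := distinguished_of_splitting T fun i =>
      have : Projective (T.map (HomologicalComplex.eval C _ i)).X₃ := hp _ (hpX i)
      (hTn i).splittingOfProjective
    exact S.ext_of_isTriangulatedClosed₂ _ h4 (h _ (hQ 0)) h3

end

/-- The objects without nonzero morphisms to the shifts of `Z`. -/
def IsOrth {C : Type*} [Category C] [HasShift C ℤ] [HasZeroMorphisms C] (Z : C) :
    ObjectProperty C := fun T => ∀ (n : ℤ) (f : T ⟶ Z⟦n⟧), f = 0

section

variable {C : Type*} [Category C] [HasShift C ℤ] [Preadditive C] (Z : C)

/-- As the left orthogonal of a class stable under shifts, the property inherits the structure of a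
triangulated subcategory. -/
theorem isOrth_eq : IsOrth Z =
    ObjectProperty.leftOrthogonal (fun Y : C => ∃ n : ℤ, Nonempty (Y ≅ Z⟦n⟧)) := by
  ext T
  refine ⟨fun h Y f ⟨n, ⟨e⟩⟩ => ?_, fun h n f => h f ⟨n, ⟨Iso.refl _⟩⟩⟩
  rw [← cancel_mono e.hom, zero_comp]
  exact h n _

instance [HasZeroObject C] [∀ n : ℤ, (shiftFunctor C n).Additive] [Pretriangulated C] :
    (IsOrth Z).IsTriangulated := by
  rw [isOrth_eq]
  have : ObjectProperty.IsStableUnderShift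
      (fun Y : C => ∃ n : ℤ, Nonempty (Y ≅ Z⟦n⟧)) ℤ :=
    { isStableUnderShiftBy := fun m => ⟨fun Y ⟨n, ⟨e⟩⟩ =>
        ⟨n + m, ⟨(shiftFunctor C m).mapIso e ≪≫ ((shiftFunctorAdd C n m).app Z).symm⟩⟩⟩ }
  infer_instance

instance : (IsOrth Z).IsStableUnderRetracts where
  of_retract r h n f := by
    rw [← Category.id_comp f, ← r.retract, Category.assoc, h n (r.r ≫ f), comp_zero]

end

end Silted

namespace Silted
open CategoryTheory CategoryTheory.Limits MulOpposite

set_option linter.unusedSectionVars false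

/-! ### Direct summands of two-term complexes -/

section

variable {C : Type u} [Category.{v} C] [Abelian C]

/-- A complex has a summand given by a projective resolution, if its cohomology allows this. -/
theorem nonempty_retract_tw {Q₁ Q₀ S Y X M : C} {d₀ : Q₁ ⟶ Q₀} {c : Q₀ ⟶ S} (w : d₀ ≫ c = 0)
    (hS : (ShortComplex.mk d₀ c w).ShortExact) [Projective Q₁] [Projective Q₀] [Projective X]
    (h0 : ∀ f : Q₀ ⟶ Q₁, f = 0) {d : Y ⟶ X} {π : X ⟶ M} (w' : d ≫ π = 0)
    (hM : (ShortComplex.mk d π w').Exact) [Epi π] (ξ : Q₀ ⟶ M) (β : M ⟶ S) (h1 : d₀ ≫ ξ = 0)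
    (h2 : ξ ≫ β = c) : Nonempty (Retract (tw d₀) (tw d)) := by
  have := hS.mono_f
  have := hS.epi_g
  have : Mono d₀ := hS.mono_f
  have : Epi c := hS.epi_g
  obtain ⟨i₀, hi₀⟩ : ∃ i₀ : Q₀ ⟶ X, i₀ ≫ π = ξ := ⟨_, Projective.factorThru_comp ξ π⟩
  obtain ⟨i₁, hi₁⟩ : ∃ i₁ : Q₁ ⟶ Y, i₁ ≫ d = d₀ ≫ i₀ :=
    ⟨_, hM.liftFromProjective_comp (d₀ ≫ i₀) (by
      change (d₀ ≫ i₀) ≫ π = 0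
      rw [Category.assoc, hi₀, h1])⟩
  obtain ⟨p₀, hp₀⟩ : ∃ p₀ : X ⟶ Q₀, p₀ ≫ c = π ≫ β := ⟨_, Projective.factorThru_comp (π ≫ β) c⟩
  obtain ⟨p₁, hp₁⟩ : ∃ p₁ : Y ⟶ Q₁, p₁ ≫ d₀ = d ≫ p₀ :=
    ⟨_, hS.exact.lift_f (d ≫ p₀) (by
      change (d ≫ p₀) ≫ c = 0
      rw [Category.assoc, hp₀, reassoc_of% w', zero_comp])⟩
  -- The composite induces the identity on S, so it differs from the identity by a map that factors
  -- through a morphism from Q₀ to Q₁; by `h0` there are none but zero.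
  have h3 : i₀ ≫ p₀ = 𝟙 _ := by
    have h4 : (i₀ ≫ p₀ - 𝟙 _) ≫ c = 0 := by
      rw [Preadditive.sub_comp, Category.assoc, hp₀, reassoc_of% hi₀, h2, Category.id_comp,
        sub_self]
    have h5 := hS.exact.lift_f (i₀ ≫ p₀ - 𝟙 _) h4
    rw [h0 (hS.exact.lift _ h4), zero_comp] at h5
    exact (sub_eq_zero.1 h5.symm)
  have h4 : i₁ ≫ p₁ = 𝟙 _ := by
    rw [← cancel_mono d₀, Category.assoc, hp₁, reassoc_of% hi₁, h3, Category.comp_id,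
      Category.id_comp]
  exact ⟨{ i := twHom i₁ i₀ hi₁.symm, r := twHom p₁ p₀ hp₁.symm,
           retract := (twHom_comp _ _ _ _ _ _).trans (tw_hom_ext h4 h3) }⟩

/-- An epimorphism onto a projective object splits, so the complex is its kernel in degree -1 plus a
contractible complex. -/
theorem nonempty_retract_of_epi {Z O Y X : C} (hO : IsZero O) (f : Z ⟶ O) (d : Y ⟶ X) [Epi d] [Projective X]
    (r : Retract Z (kernel d)) : Nonempty (Retract (tw f) (tw d)) := by
  let T := ShortComplex.mk (kernel.ι d) d (kernel.condition d)
  have hT : T.ShortExact :=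
    { exact := ShortComplex.exact_kernel d
      mono_f := inferInstanceAs (Mono (kernel.ι d))
      epi_g := inferInstanceAs (Epi d) }
  have : Projective T.X₃ := inferInstanceAs (Projective X)
  let σ := hT.splittingOfProjective
  have h1 : kernel.ι d ≫ σ.r = 𝟙 (kernel d) := σ.f_r
  refine ⟨{ i := twHom (r.i ≫ kernel.ι d) 0 (by simp [hO.eq_of_tgt f 0]),
            r := twHom (σ.r ≫ r.r) 0 (hO.eq_of_tgt _ _),
            retract := (twHom_comp _ _ _ _ _ _).trans (tw_hom_ext ?_ (hO.eq_of_tgt _ _)) }⟩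
  change (r.i ≫ kernel.ι d) ≫ σ.r ≫ r.r = 𝟙 Z
  rw [Category.assoc, reassoc_of% h1, r.retract]

end

section

variable {A : Type u} [Ring A]

/-- The total length of a two-term complex. -/
noncomputable def twoTermLength (P : CochainComplex (RightMod A) ℤ) : ℕ∞ :=
  Module.length Aᵐᵒᵖ (P.X (-1)) + Module.length Aᵐᵒᵖ (P.X 0)

/-- Each retract that is split off is nonzero, so the total length drops, and the kernel of the
retraction is again a perfect two-term complex. The process stops at a contractible complex, which
has the empty decomposition in the homotopy category. -/
theorem exists_decomp_of_retract [IsArtinianRing Aᵐᵒᵖ] {ι : Type}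
    (δ : ι → CochainComplex (RightMod A) ℤ) (hδ : ∀ i, ¬ IsZero (δ i))
    (H : ∀ P, IsPerfect P → IsTwoTerm P → IsZero (toHo P) ∨ ∃ i, Nonempty (Retract (δ i) P))
    (n : ℕ) : ∀ P, IsPerfect P → IsTwoTerm P → twoTermLength P = n →
      ∃ (κ : Type) (_ : Fintype κ) (a : κ → ι),
        Nonempty (Decomp (toHo P) fun k => toHo (δ (a k))) := by
  induction n using Nat.strong_induction_on with
  | _ n ih =>
  intro P hP hP' hn
  obtain h | ⟨i, ⟨ρ⟩⟩ := H P hP hP'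
  · exact ⟨Empty, inferInstance, nofun, ⟨Decomp.ofIsZero h _⟩⟩
  let T := ShortComplex.mk (kernel.ι ρ.r) ρ.r (kernel.condition ρ.r)
  let σ : T.Splitting := ShortComplex.Splitting.ofExactOfSection T (ShortComplex.exact_kernel ρ.r)
    ρ.i ρ.retract (inferInstanceAs (Mono (kernel.ι ρ.r)))
  let σ' := fun j => σ.map (HomologicalComplex.eval (RightMod A) (ComplexShape.up ℤ) j)
  have hlen : ∀ j, Module.length Aᵐᵒᵖ (P.X j) =
      Module.length Aᵐᵒᵖ ((kernel ρ.r).X j) + Module.length Aᵐᵒᵖ ((δ i).X j) := fun j => by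
    have h := (σ' j).shortExact
    exact Module.length_eq_add_of_exact ((kernel.ι ρ.r).f j).hom (ρ.r.f j).hom
      ((ModuleCat.mono_iff_injective _).1 h.mono_f) ((ModuleCat.epi_iff_surjective _).1 h.epi_g)
      ((ShortComplex.ShortExact.moduleCat_exact_iff_function_exact _).1 h.exact)
  have hret : ∀ j x, ((σ' j).r).hom (((kernel.ι ρ.r).f j).hom x) = x := fun j x =>
    congrArg (fun φ : (kernel ρ.r).X j ⟶ (kernel ρ.r).X j => φ.hom x) (σ' j).f_r
  have h1 : IsPerfect (kernel ρ.r) :=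
    { finite := fun j => by
        have : Module.Finite Aᵐᵒᵖ
          (T.map (HomologicalComplex.eval (RightMod A) (ComplexShape.up ℤ) j)).X₂ := hP.finite j
        exact Module.Finite.of_surjective ((σ' j).r).hom fun x => ⟨_, hret j x⟩
      projective := fun j => by
        have := hP.projective j
        exact Module.Projective.of_split ((kernel.ι ρ.r).f j).hom ((σ' j).r).hom
          (LinearMap.ext (hret j))
      bounded := by
        obtain ⟨N, hN⟩ := hP.bounded
        refine ⟨N, fun j hj => ?_⟩
        have := (σ' j).shortExact.mono_f
        exact IsZero.of_mono ((kernel.ι ρ.r).f j) (hN j hj) }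
  have h2 : IsTwoTerm (kernel ρ.r) := fun j hj hj' => by
    have := (σ' j).shortExact.mono_f
    exact IsZero.of_mono ((kernel.ι ρ.r).f j) (hP' j hj hj')
  have h3 : twoTermLength P = twoTermLength (kernel ρ.r) + twoTermLength (δ i) := by
    rw [twoTermLength, twoTermLength, twoTermLength, hlen, hlen]
    exact add_add_add_comm _ _ _ _
  have h4 : twoTermLength (δ i) ≠ 0 := fun h0 => by
    rw [twoTermLength, add_eq_zero, Module.length_eq_zero_iff, Module.length_eq_zero_iff] at h0
    refine hδ i ((IsZero.iff_id_eq_zero _).2 (HomologicalComplex.hom_ext _ _ fun j => ?_))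
    by_cases hj : j = -1
    · subst hj
      exact (ModuleCat.isZero_of_iff_subsingleton.2 h0.1).eq_of_src _ _
    by_cases hj' : j = 0
    · subst hj'
      exact (ModuleCat.isZero_of_iff_subsingleton.2 h0.2).eq_of_src _ _
    have := (σ' j).shortExact.epi_g
    exact (IsZero.of_epi (ρ.r.f j) (hP' j hj hj')).eq_of_src _ _
  obtain ⟨m, hm⟩ : ∃ m : ℕ, twoTermLength (kernel ρ.r) = m := by
    have : twoTermLength (kernel ρ.r) ≠ ⊤ := fun h => by
      rw [hn, h, top_add] at h3
      exact ENat.natCast_ne_top n h3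
    exact ⟨_, (ENat.natCast_toNat this).symm⟩
  have hmn : m < n := by
    obtain ⟨l, hl⟩ : ∃ l : ℕ, twoTermLength (δ i) = l := by
      have : twoTermLength (δ i) ≠ ⊤ := fun h => by
        rw [hn, h, add_top] at h3
        exact ENat.natCast_ne_top n h3
      exact ⟨_, (ENat.natCast_toNat this).symm⟩
    rw [hn, hm, hl] at h3
    rw [hl] at h4
    norm_cast at h3 h4
    omega
  obtain ⟨κ, _, a, ⟨D⟩⟩ := ih m hmn _ h1 h2 hm
  have := preservesBinaryBiproducts_of_preservesBiproducts (qHo (RightMod A))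
  let e : toHo P ≅ toHo (δ i) ⊞ toHo (kernel ρ.r) :=
    (qHo (RightMod A)).mapIso σ.isoBinaryBiproduct ≪≫ (qHo (RightMod A)).mapBiprod _ _ ≪≫
      biprod.braiding _ _
  exact ⟨Option κ, inferInstance, _, ⟨Decomp.cons (X := fun i => toHo (δ i)) i e D⟩⟩

theorem twoTermLength_ne_top [IsArtinianRing Aᵐᵒᵖ] {P : CochainComplex (RightMod A) ℤ} (hP : IsPerfect P) :
    ∃ n : ℕ, twoTermLength P = n := by
  have h : ∀ j, Module.length Aᵐᵒᵖ (P.X j) ≠ ⊤ := fun j => by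
    have := hP.finite j
    exact Module.length_ne_top_iff.2 (isFiniteLength_iff_isNoetherian_isArtinian.2
      ⟨inferInstance, inferInstance⟩)
  have : twoTermLength P ≠ ⊤ := by
    rw [twoTermLength]
    exact WithTop.add_ne_top.2 ⟨h _, h _⟩
  exact ⟨_, (ENat.natCast_toNat this).symm⟩

end

namespace RelBasis

variable {K : Type u} [Field K] {V : Type} {R : V → V → Prop} {A : Type u} [Ring A] [Algebra K A]
  (b : RelBasis K R A)

/-- The indecomposable projective modules, and the zero module. -/
def P' : Option V → RightMod A
  | none => ModuleCat.of Aᵐᵒᵖ PUnit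
  | some i => b.P i

theorem isZero_P' : IsZero (b.P' none) :=
  ModuleCat.isZero_of_iff_subsingleton.2 (inferInstanceAs (Subsingleton PUnit))

/-- The canonical homomorphisms between these modules. -/
def u' (hR : ∀ i, R i i) : ∀ j i, b.P' j ⟶ b.P' i
  | some j, some i => b.u hR j i
  | none, _ => 0
  | some _, none => 0

instance projective_P'' [Fact (∀ i, R i i)] (i : Option V) : Projective (b.P' i) :=
  match i with
  | none => b.isZero_P'.projective
  | some i => b.projective_P' Fact.out i

section

variable [Fintype V] [DecidableEq V] (hR : IsPreord R) {s : Finset V} (hs : IsConvex R s)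

/-- The homomorphism to a thin module given by a linear form. -/
theorem exists_toThin {M : RightMod A} (Λ : M →+ K)
    (hΛ : ∀ (c : K) m, Λ (algebraMap K Aᵐᵒᵖ c • m) = c * Λ m) {t : V} (ht : ∀ w ∈ s, R w t)
    (h : ∀ v, v ∉ s → R v t → ∀ m, Λ (op (b.el v t) • m) = 0) :
    ∃ β : M ⟶ b.thin hR hs, ∀ m w, b.coord w (β.hom m) = Λ (op (b.el w t) • m) := by
  refine ⟨b.toThin hs hR (fun w => Λ.comp (DistribSMul.toAddMonoidHom M (op (b.el w t))))
    (fun w c m => ?_) fun v w m hvw => ?_, fun m w => b.coord_toThin _ _ _ _ _⟩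
  · change Λ (op (b.el w t) • algebraMap K Aᵐᵒᵖ c • m) = c * Λ (op (b.el w t) • m)
    rw [← hΛ, smul_smul, smul_smul, Algebra.commutes]
  · change Λ (op (b.el w t) • op (b.el v w) • m) = dite _ (fun _ => Λ (op (b.el v t) • m)) _
    rw [smul_smul, ← op_mul, b.mul_of_rel _ _ _ hvw (ht w w.2)]
    split_ifs with hv
    · rfl
    · exact h v hv (hR.trans _ _ _ hvw (ht w w.2)) m

end

/-- A linear form which vanishes on the multiples of `e` and maps `z` to `1`. -/
theorem exists_linearForm {M : RightMod A} (e : A) (z : M) (hz : ∀ m : M, op e • m ≠ z) :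
    ∃ Λ : M →+ K, (∀ (c : K) m, Λ (algebraMap K Aᵐᵒᵖ c • m) = c * Λ m) ∧ Λ z = 1 ∧
      ∀ m, Λ (op e • m) = 0 := by
  let := Module.compHom M (algebraMap K Aᵐᵒᵖ)
  have hsm : ∀ (c : K) (m : M), c • m = algebraMap K Aᵐᵒᵖ c • m := fun _ _ => rfl
  let f : M →ₗ[K] M :=
    { toFun := fun m => op e • m
      map_add' := smul_add _
      map_smul' := fun c m => by
        rw [RingHom.id_apply, hsm, hsm, smul_smul, smul_smul, Algebra.commutes] }
  obtain ⟨g, hg, hg'⟩ := Submodule.exists_le_ker_of_notMem (p := LinearMap.range f) (v := z)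
    (by rintro ⟨m, hm⟩; exact hz m hm)
  refine ⟨((g z)⁻¹ • g).toAddMonoidHom, fun c m => ?_, ?_, fun m => ?_⟩
  · exact (congrArg ((g z)⁻¹ • g) (hsm c m).symm).trans (map_smul _ _ _)
  · exact inv_mul_cancel₀ hg
  · have : g (f m) = 0 := hg' ⟨m, rfl⟩
    change (g z)⁻¹ * g (f m) = 0
    rw [this, mul_zero]

section

variable [Fintype V] [DecidableEq V] {hR : IsPreord R} {s : Finset V}

/-- The support consists of what is reached from `a` but not from the vertex in `j`; if there is
none, the thin module is P a itself. -/
theorem shortExact_thin' (hs : IsConvex R s) {a : V} {j : Option V} (ha : a ∈ s) (hs₁ : ∀ w ∈ s, R a w)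
    (hs₂ : ∀ w, R a w → (w ∈ s ↔ ∀ v ∈ j, ¬ R v w)) (hs₃ : ∀ v ∈ j, R a v ∧ ∀ w, R v w → w ∉ s) :
    ∃ w, (ShortComplex.mk (b.u' hR.refl j (some a)) (b.projThin hR hs ha) w).ShortExact := by
  cases j with
  | none =>
    refine ⟨zero_comp, ?_⟩
    have h0 : b.u' hR.refl none (some a) = 0 := rfl
    exact
      { exact := (ShortComplex.moduleCat_exact_iff _).2 fun x hx => ⟨0, by
          rw [map_zero]
          exact (b.projThin_injective ha (fun w hw => (hs₂ w hw).2 (by simp)) x hx).symm⟩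
        mono_f := ⟨fun _ _ _ => b.isZero_P'.eq_of_tgt _ _⟩
        epi_g := (ModuleCat.epi_iff_surjective _).2 (b.projThin_surjective ha hs₁) }
  | some v =>
    have h := hs₃ v rfl
    exact ⟨b.u_projThin ha h.1 h.2, b.shortExact_thin hR hs ha h.1 hs₁
      (fun w hw => (hs₂ w hw).trans (by simp)) h.2⟩

theorem hom_P'_eq_zero (hR : ∀ i, R i i) {i j : Option V} (h : ∀ v ∈ i, ∀ w ∈ j, ¬ R w v) (f : b.P' i ⟶ b.P' j) :
    f = 0 := by
  match i, j with
  | none, _ => exact b.isZero_P'.eq_of_src _ _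
  | some _, none => exact b.isZero_P'.eq_of_tgt _ _
  | some v, some w =>
    obtain ⟨c, hc⟩ := b.u_span hR (f : b.P v ⟶ b.P w)
    rw [b.u_of_not hR (h v rfl w rfl), smul_zero] at hc
    exact hc

theorem fromP_comp_eq_projThin (hs : IsConvex R s) {a t : V} (ha : a ∈ s) (hat : R a t) {M : RightMod A} (Λ : M →+ K)
    (β : M ⟶ b.thin hR hs) (hβ : ∀ m w, b.coord w (β.hom m) = Λ (op (b.el w t) • m)) {x : M}
    (hx : Λ (op (b.el a t) • x) = 1) : b.fromP a x ≫ β = b.projThin hR hs ha := by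
  refine b.P_hom_ext hR.refl (b.thin_ext fun v => ?_)
  rw [coord_projThin, val_gen, b.coef_el _ _ _ _ (hR.refl a)]
  refine (hβ (op (b.el a a) • x) v).trans ?_
  rw [smul_smul, ← op_mul]
  split_ifs with hv
  · rw [hv.2, b.mul_of_rel _ _ _ (hR.refl a) hat, hx]
  · rw [b.mul_of_ne _ _ _ _ fun h' => hv ⟨rfl, h'.symm⟩, MulOpposite.op_zero, zero_smul, map_zero]

/-- This is the tool that splits off a thin module with source `a` and sink `t`. The element `x`
gives a map P a → M, which descends to the thin module by `hj`. In the other direction, a linear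
form that is 1 on the image of `x` under the path from `a` to `t` and vanishes on the multiples of
`e` gives a map from M; `h` guarantees that the vertices outside the support do not disturb it. The
retraction is then lifted to the presentations. -/
theorem nonempty_retract_thin (hs : IsConvex R s) {a t : V} {j : Option V} (ha : a ∈ s) (hs₁ : ∀ w ∈ s, R a w)
    (hs₂ : ∀ w, R a w → (w ∈ s ↔ ∀ v ∈ j, ¬ R v w)) (hs₃ : ∀ v ∈ j, R a v ∧ ∀ w, R v w → w ∉ s)
    (ht : ∀ w ∈ s, R w t)
    {Y X M : RightMod A} [Projective X] {d : Y ⟶ X} {π : X ⟶ M} (w' : d ≫ π = 0)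
    (hM : (ShortComplex.mk d π w').Exact) [Epi π] (x : M) (e : A)
    (hx : ∀ m : M, op e • m ≠ op (b.el a t) • x)
    (h : ∀ v, v ∉ s → R v t → ∀ m : M, ∃ m' : M, op (b.el v t) • m = op e • m')
    (hj : ∀ v ∈ j, op (b.el a v) • x = 0) :
    Nonempty (Retract (tw (b.u' hR.refl j (some a))) (tw d)) := by
  have : Fact (∀ i, R i i) := ⟨hR.refl⟩
  obtain ⟨Λ, hΛ, hΛ1, hΛ0⟩ := exists_linearForm (K := K) e _ hx
  obtain ⟨β, hβ⟩ := b.exists_toThin hR hs Λ hΛ ht fun v hv hv' m => by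
    obtain ⟨m', hm'⟩ := h v hv hv' m
    rw [hm', hΛ0]
  obtain ⟨w, hw⟩ := b.shortExact_thin' hs ha hs₁ hs₂ hs₃
  refine nonempty_retract_tw w hw (b.hom_P'_eq_zero hR.refl ?_) w' hM (b.fromP a x) β ?_ ?_
  · intro v hv w hw hwv
    obtain rfl : a = v := by simpa using hv
    exact (hs₃ w hw).2 a hwv ha
  · cases j with
    | none => exact b.isZero_P'.eq_of_src _ _
    | some v =>
      refine b.P_hom_ext hR.refl ?_
      change op (b.val ((b.u hR.refl v a).hom (b.gen hR.refl v))) • x = 0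
      rw [b.val_u_gen]
      exact hj v rfl
  · exact b.fromP_comp_eq_projThin hs ha (ht a ha) Λ β hβ hΛ1

end

end RelBasis

end Silted

/-! ### Reduction to modules, and two-term complexes over `0 → 1 → 2` -/

namespace Silted
open CategoryTheory CategoryTheory.Limits MulOpposite

/-- The components of a retract. -/
theorem exists_retract_of_tw {C : Type*} [Category C] [Preadditive C] [HasZeroObject C] {Y X Y' X' : C}
    {d : Y ⟶ X} {d' : Y' ⟶ X'} (r : Retract (tw d) (tw d')) :
    Nonempty (Retract Y Y') ∧ Nonempty (Retract X X') := by
  obtain ⟨x, y, h, hi⟩ := exists_twHom r.i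
  obtain ⟨x', y', h', hr⟩ := exists_twHom r.r
  have h1 : twHom x y h ≫ twHom x' y' h' = 𝟙 _ := by rw [← hi, ← hr, r.retract]
  have h2 := congrArg (fun φ : tw d ⟶ tw d => φ.f (-1)) h1
  have h3 := congrArg (fun φ : tw d ⟶ tw d => φ.f 0) h1
  exact ⟨⟨{ i := x, r := x', retract := h2 }⟩, ⟨{ i := y, r := y', retract := h3 }⟩⟩

theorem isZero_of_retract {C : Type*} [Category C] [Preadditive C] {X Y : C} (r : Retract X Y)
    (h : IsZero Y) : IsZero X := by
  rw [IsZero.iff_id_eq_zero, ← r.retract, h.eq_of_tgt r.i 0, zero_comp]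

open ZeroObject

namespace RelBasis

section

variable {K : Type u} [Field K] {V : Type} {R : V → V → Prop} {A : Type u} [Ring A] [Algebra K A]
  (b : RelBasis K R A)

/-- The two-term complex `P j ⟶ P i`. -/
noncomputable abbrev cplx (hR : ∀ i, R i i) (p : Option V × Option V) : CochainComplex (RightMod A) ℤ :=
  tw (b.u' hR p.1 p.2)

theorem not_isZero_P' (hR : ∀ i, R i i) {j : Option V} (h : j ≠ none) : ¬ IsZero (b.P' j) := by
  obtain ⟨i, rfl⟩ := Option.ne_none_iff_exists'.1 h
  exact fun h' => b.id_P_ne_zero hR i (h'.eq_of_src _ _)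

theorem not_isZero_cplx (hR : ∀ i, R i i) {p : Option V × Option V} (hp : p ≠ (none, none)) :
    ¬ IsZero (b.cplx hR p) := fun h => by
  obtain ⟨⟨r⟩, ⟨r'⟩⟩ := exists_retract_of_tw (d' := 𝟙 (0 : RightMod A))
    { i := (0 : b.cplx hR p ⟶ _), r := 0, retract := h.eq_of_src _ _ }
  refine hp (Prod.ext ?_ ?_)
  · by_contra hj
    exact b.not_isZero_P' hR hj (isZero_of_retract r (isZero_zero _))
  · by_contra hj
    exact b.not_isZero_P' hR hj (isZero_of_retract r' (isZero_zero _))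

/-- A criterion for every two-term complex to have a summand in a given list. -/
theorem isZero_or_exists_retract {ι : Type} (δ : ι → CochainComplex (RightMod A) ℤ)
    (h₁ : ∀ {Y X M : RightMod A} [Projective X] (d : Y ⟶ X) (π : X ⟶ M) (w' : d ≫ π = 0)
      (_ : (ShortComplex.mk d π w').Exact) [Epi π], ¬ IsZero M → ∃ i, Nonempty (Retract (δ i) (tw d)))
    (h₂ : ∀ {Y X : RightMod A} [Projective X] (d : Y ⟶ X) [Epi d] (i), Retract (δ i) (st (kernel d)) →
      ∃ i, Nonempty (Retract (δ i) (tw d)))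
    (P : CochainComplex (RightMod A) ℤ) (hP : IsPerfect P) (hP' : IsTwoTerm P) :
    IsZero (toHo P) ∨ ∃ i, Nonempty (Retract (δ i) P) := by
  let e : P ≅ tw (P.d (-1) 0) := isoTw hP'
  have hpr : ∀ i, Projective (P.X i) := fun i => (IsProjective.iff_projective _).1 (hP.projective i)
  suffices h : IsZero (toHo (tw (P.d (-1) 0))) ∨ ∃ i, Nonempty (Retract (δ i) (tw (P.d (-1) 0))) by
    refine h.imp (fun h => h.of_iso ((qHo _).mapIso e)) fun ⟨i, ⟨r⟩⟩ =>
      ⟨i, ⟨r.trans e.symm.retract⟩⟩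
  generalize P.d (-1) 0 = d
  have := hpr 0
  -- A nonzero cokernel provides a summand directly. Otherwise the differential is a split
  -- epimorphism, and a summand of its kernel, found in degree 0, is moved to degree -1 by `h₂`; a
  -- zero kernel means that the complex is contractible.
  by_cases hc : IsZero (cokernel d)
  · have hd : Epi d := Preadditive.epi_of_isZero_cokernel d hc
    by_cases hk : IsZero (kernel d)
    · have hm : Mono d := Preadditive.mono_of_isZero_kernel d hk
      have : IsIso d := isIso_of_mono_of_epi d
      exact Or.inl (isZero_tw_of_isIso d)
    · right
      let T := ShortComplex.mk (kernel.ι d) d (kernel.condition d)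
      have hT : T.ShortExact :=
        { exact := ShortComplex.exact_kernel d
          mono_f := inferInstanceAs (Mono (kernel.ι d))
          epi_g := inferInstanceAs (Epi d) }
      have : Projective T.X₃ := inferInstanceAs (Projective (P.X 0))
      let r : Retract (kernel d) (P.X (-1)) :=
        { i := kernel.ι d, r := hT.splittingOfProjective.r, retract := hT.splittingOfProjective.f_r }
      have := hpr (-1)
      have : Projective (kernel d) := r.projective
      obtain ⟨i, ⟨ρ⟩⟩ := h₁ (0 : (0 : RightMod A) ⟶ kernel d) (𝟙 (kernel d)) zero_comp
        (ShortComplex.Splitting.exact { r := 0, s := 𝟙 _, f_r := (isZero_zero _).eq_of_src _ _ }) hk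
      exact h₂ d i ρ
  · right
    exact h₁ d (cokernel.π d) (cokernel.condition d) (ShortComplex.exact_cokernel d) hc

/-- A listed summand of a complex concentrated in degree 0 has zero term in degree -1, so it is some
P a, and the list contains its shift by `hL`. -/
theorem exists_retract_of_retract_st (hR : ∀ i, R i i) {ι : Type} (L : ι → Option V × Option V)
    (hL : ∀ i a, L i = (none, some a) → ∃ i', L i' = (some a, none)) (hL' : ∀ i, L i ≠ (none, none))
    {Y X : RightMod A} [Projective X] (d : Y ⟶ X) [Epi d] (i : ι)
    (r : Retract (b.cplx hR (L i)) (st (kernel d))) :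
    ∃ i, Nonempty (Retract (b.cplx hR (L i)) (tw d)) := by
  obtain ⟨⟨r₁⟩, ⟨r'⟩⟩ := exists_retract_of_tw r
  have h1 := isZero_of_retract r₁ (isZero_zero _)
  clear r r₁
  generalize hp : L i = p at *
  obtain ⟨j, a⟩ := p
  obtain rfl : j = none := by
    by_contra hj
    exact b.not_isZero_P' hR hj h1
  cases a with
  | none => exact absurd hp (hL' i)
  | some a =>
    obtain ⟨i', hi'⟩ := hL i a hp
    refine ⟨i', ?_⟩
    rw [hi']
    exact nonempty_retract_of_epi b.isZero_P' _ d r'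

end

theorem exists_el_self_smul_ne_zero {K : Type u} [Field K] {V : Type} [Fintype V] {R : V → V → Prop} {A : Type u}
    [Ring A] [Algebra K A] (b : RelBasis K R A) (hR : ∀ i, R i i) {M : RightMod A} (hM : ¬ IsZero M) :
    ∃ i, ∃ x : M, op (b.el i i) • x ≠ 0 := by
  by_contra! h
  refine hM (ModuleCat.isZero_of_iff_subsingleton.2 ⟨fun x y => ?_⟩)
  have h0 : ∀ x : M, x = 0 := fun x => by
    rw [← one_smul Aᵐᵒᵖ x, ← op_one, ← b.sum_el_self hR, Finset.op_sum, Finset.sum_smul]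
    exact Finset.sum_eq_zero fun i _ => h i x
  rw [h0 x, h0 y]

section

variable {K : Type u} [Field K] {A : Type u} [Ring A] [Algebra K A]

/-- The reachability relation of `0 → 1 → 2`. -/
abbrev leA3 : Fin 3 → Fin 3 → Prop := fun i j => i ≤ j

theorem isPreord_leA3 : IsPreord leA3 := ⟨le_refl, fun _ _ _ => le_trans⟩

/-- The indecomposable two-term complexes over `0 → 1 → 2`. -/
def indecLinear : Fin 9 → Option (Fin 3) × Option (Fin 3) :=
  ![(none, some 0), (none, some 1), (none, some 2), (some 1, some 0), (some 2, some 0),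
    (some 2, some 1), (some 0, none), (some 1, none), (some 2, none)]

/-- The paths 0 → 2, 0 → 1, 1 → 2 and finally the trivial ones are tried in this order. The first
that acts nontrivially has an interval module as a retract, because the paths extending it at either
end have already been seen to act as zero. -/
theorem exists_retract_linear (b : RelBasis K leA3 A)
    {Y X M : RightMod A} [Projective X] (d : Y ⟶ X) (π : X ⟶ M) (w' : d ≫ π = 0)
    (hM : (ShortComplex.mk d π w').Exact) [Epi π] (h : ¬ IsZero M) :
    ∃ i, Nonempty (Retract (b.cplx isPreord_leA3.refl (indecLinear i)) (tw d)) := by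
  have key : ∀ (s : Finset (Fin 3)) (hs : IsConvex leA3 s) (a t : Fin 3) (j : Option (Fin 3)) (ha : a ∈ s)
      (_ : ∀ w ∈ s, leA3 a w) (_ : ∀ w, leA3 a w → (w ∈ s ↔ ∀ v ∈ j, ¬ leA3 v w))
      (_ : ∀ v ∈ j, leA3 a v ∧ ∀ w, leA3 v w → w ∉ s) (_ : ∀ w ∈ s, leA3 w t)
      (x : M) (_ : op (b.el a t) • x ≠ 0) (_ : ∀ v, v ∉ s → leA3 v t → ∀ m : M, op (b.el v t) • m = 0)
      (_ : ∀ v ∈ j, op (b.el a v) • x = 0), Nonempty (Retract (b.cplx isPreord_leA3.refl (j, some a)) (tw d)) :=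
    fun s hs a t j ha h1 h2 h3 h4 x hx h5 h6 =>
      b.nonempty_retract_thin (hR := isPreord_leA3) hs ha h1 h2 h3 h4 w' hM x 0
        (fun m => by rw [MulOpposite.op_zero, zero_smul]; exact hx.symm)
        (fun v hv hv' m => ⟨m, by rw [MulOpposite.op_zero, zero_smul]; exact h5 v hv hv' m⟩) h6
  have hc : ∀ s : Finset (Fin 3), s = {0, 1, 2} ∨ s = {0, 1} ∨ s = {1, 2} ∨ (∃ i, s = {i}) →
      IsConvex leA3 s := by
    unfold IsConvex; decide
  by_cases h02 : ∃ x : M, op (b.el 0 2) • x ≠ 0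
  · obtain ⟨x, hx⟩ := h02
    exact ⟨0, key {0, 1, 2} (hc _ (by simp)) 0 2 none (by decide) (by decide) (by decide) (by decide)
      (by decide) x hx (fun v hv => absurd hv (by revert v; decide)) (by simp)⟩
  push Not at h02
  by_cases h01 : ∃ x : M, op (b.el 0 1) • x ≠ 0
  · obtain ⟨x, hx⟩ := h01
    exact ⟨4, key {0, 1} (hc _ (by simp)) 0 1 (some 2) (by decide) (by decide) (by decide) (by decide)
      (by decide) x hx (fun v hv hv' => absurd hv' (by revert v; decide)) (by simpa using h02 x)⟩
  push Not at h01
  by_cases h12 : ∃ x : M, op (b.el 1 2) • x ≠ 0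
  · obtain ⟨x, hx⟩ := h12
    refine ⟨1, key {1, 2} (hc _ (by simp)) 1 2 none (by decide) (by decide) (by decide) (by decide)
      (by decide) x hx (fun v hv hv' => ?_) (by simp)⟩
    obtain rfl : v = 0 := by revert v; decide
    exact h02
  push Not at h12
  obtain ⟨i, x, hx⟩ := b.exists_el_self_smul_ne_zero isPreord_leA3.refl h
  revert i
  refine fun
    | 0 => fun hx => ⟨3, key {0} (hc _ (by simp)) 0 0 (some 1) (by decide) (by decide) (by decide) (by decide)
      (by decide) x hx (fun v hv hv' => absurd hv (by revert v; decide)) (by simpa using h01 x)⟩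
    | 1 => fun hx => ⟨5, key {1} (hc _ (by simp)) 1 1 (some 2) (by decide) (by decide) (by decide) (by decide)
      (by decide) x hx (fun v hv hv' => ?_) (by simpa using h12 x)⟩
    | 2 => fun hx => ⟨2, key {2} (hc _ (by simp)) 2 2 none (by decide) (by decide) (by decide) (by decide)
      (by decide) x hx (fun v hv hv' => ?_) (by simp)⟩
  · obtain rfl : v = 0 := by revert v; decide
    exact h01
  · obtain rfl | rfl : v = 0 ∨ v = 1 := by revert v; decide
    · exact h02
    · exact h12

end

end RelBasis

end Silted

/-! ### Two-term complexes over `0 → 2 ← 1` -/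

namespace Silted
open CategoryTheory CategoryTheory.Limits MulOpposite

namespace RelBasis

variable {K : Type u} [Field K] {A : Type u} [Ring A] [Algebra K A]

/-- The reachability relation of `0 → 2 ← 1`. -/
abbrev leSink : Fin 3 → Fin 3 → Prop := fun i j => i = j ∨ j = 2

theorem isPreord_leSink : IsPreord leSink := ⟨by decide, by decide⟩

theorem isConvex_leSink : ∀ s : Finset (Fin 3), IsConvex leSink s := by
  unfold IsConvex; decide

/-- The differential of the two-term complex with three indecomposable terms. -/
noncomputable def dN (b : RelBasis K leSink A) : b.P 2 ⟶ b.P 0 ⊞ b.P 1 :=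
  biprod.lift (b.u isPreord_leSink.refl 2 0) (b.u isPreord_leSink.refl 2 1)

/-- The cokernel of this differential. -/
noncomputable def cN (b : RelBasis K leSink A) :
    b.P 0 ⊞ b.P 1 ⟶ b.thin isPreord_leSink (isConvex_leSink Finset.univ) :=
  biprod.desc (b.projThin isPreord_leSink _ (Finset.mem_univ 0)) (-b.projThin isPreord_leSink _ (Finset.mem_univ 1))

theorem dN_comp_cN (b : RelBasis K leSink A) : b.dN ≫ b.cN = 0 := by
  rw [dN, cN, biprod.lift_desc]
  refine b.P_hom_ext isPreord_leSink.refl (b.thin_ext fun w => ?_)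
  have h0 := b.coord_projThin (hR := isPreord_leSink) (hs := isConvex_leSink Finset.univ) (Finset.mem_univ 0)
    ((b.u isPreord_leSink.refl 2 0).hom (b.gen isPreord_leSink.refl 2)) w
  have h1 := b.coord_projThin (hR := isPreord_leSink) (hs := isConvex_leSink Finset.univ) (Finset.mem_univ 1)
    ((b.u isPreord_leSink.refl 2 1).hom (b.gen isPreord_leSink.refl 2)) w
  rw [b.val_u_gen, b.coef_el _ _ _ _ (by decide)] at h0 h1
  rw [Preadditive.comp_neg]
  change b.coord w (_ + -_) = b.coord w 0
  rw [map_add, map_neg, map_zero]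
  refine (congrArg₂ (fun x y => x + -y) h0 h1).trans ?_
  simp

/-- For a kernel element (x, y) the coefficients of x and y agree at every vertex. Only the vertex 2
is reached from both 0 and 1, so both components are images of one element of P 2. -/
theorem shortExact_N (b : RelBasis K leSink A) : (ShortComplex.mk b.dN b.cN b.dN_comp_cN).ShortExact where
  exact := (ShortComplex.moduleCat_exact_iff _).2 fun z hz => by
    let x := (biprod.fst (X := b.P 0) (Y := b.P 1)).hom z
    let y := (biprod.snd (X := b.P 0) (Y := b.P 1)).hom z
    have hc : ∀ w : Fin 3, b.coef 0 w (b.val x) = b.coef 1 w (b.val y) := fun w => by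
      have h0 := b.coord_projThin (hR := isPreord_leSink) (hs := isConvex_leSink Finset.univ) (Finset.mem_univ 0)
        x ⟨w, Finset.mem_univ w⟩
      have h1 := b.coord_projThin (hR := isPreord_leSink) (hs := isConvex_leSink Finset.univ) (Finset.mem_univ 1)
        y ⟨w, Finset.mem_univ w⟩
      have h2 : b.cN = biprod.fst ≫ b.projThin isPreord_leSink _ (Finset.mem_univ 0) -
          biprod.snd ≫ b.projThin isPreord_leSink _ (Finset.mem_univ 1) := by
        rw [cN]; apply biprod.hom_ext' <;> simp
      have h3 : b.cN.hom z = (b.projThin isPreord_leSink _ (Finset.mem_univ 0)).hom x -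
        (b.projThin isPreord_leSink _ (Finset.mem_univ 1)).hom y := by rw [h2]; rfl
      have h4 : b.cN.hom z = 0 := hz
      rw [← h0, ← h1, sub_eq_zero.1 (h3.symm.trans h4)]
    have h00 : b.coef 0 0 (b.val x) = 0 := by
      rw [hc, b.coef_of_not (by decide)]; rfl
    have h11 : b.coef 1 1 (b.val y) = 0 := by
      rw [← hc, b.coef_of_not (by decide)]; rfl
    let q := b.ofCoef isPreord_leSink.refl 2 fun _ => b.coef 0 2 (b.val x)
    have hq : b.coef 2 2 (b.val q) = b.coef 0 2 (b.val x) :=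
      b.coef_val_ofCoef isPreord_leSink.refl (by decide) _
    have hx : (b.u isPreord_leSink.refl 2 0).hom q = x := by
      refine b.P_ext_coef isPreord_leSink.refl fun w hw => ?_
      obtain rfl | rfl : 0 = w ∨ w = 2 := hw
      · rw [b.coef_val_u_of_not isPreord_leSink (by decide) (by decide), h00]
      · rw [b.coef_val_u isPreord_leSink (by decide), hq]
    have hy : (b.u isPreord_leSink.refl 2 1).hom q = y := by
      refine b.P_ext_coef isPreord_leSink.refl fun w hw => ?_
      obtain rfl | rfl : 1 = w ∨ w = 2 := hw
      · rw [b.coef_val_u_of_not isPreord_leSink (by decide) (by decide), h11]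
      · rw [b.coef_val_u isPreord_leSink (by decide), hq, hc]
    refine ⟨q, ?_⟩
    have h5 : ∀ z' : (b.P 0 ⊞ b.P 1 : RightMod A), z' = (biprod.inl (X := b.P 0) (Y := b.P 1)).hom ((biprod.fst (X := b.P 0) (Y := b.P 1)).hom z') +
          (biprod.inr (X := b.P 0) (Y := b.P 1)).hom ((biprod.snd (X := b.P 0) (Y := b.P 1)).hom z') :=
      fun z' => congrArg (fun φ : b.P 0 ⊞ b.P 1 ⟶ b.P 0 ⊞ b.P 1 => φ.hom z') biprod.total.symm
    have h6 : (biprod.fst (X := b.P 0) (Y := b.P 1)).hom (b.dN.hom q) = x :=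
      (congrArg (fun φ : b.P 2 ⟶ b.P 0 => φ.hom q) (biprod.lift_fst _ _)).trans hx
    have h7 : (biprod.snd (X := b.P 0) (Y := b.P 1)).hom (b.dN.hom q) = y :=
      (congrArg (fun φ : b.P 2 ⟶ b.P 1 => φ.hom q) (biprod.lift_snd _ _)).trans hy
    exact ((h5 _).trans (by rw [h6, h7])).trans (h5 z).symm
  mono_f := by
    have : Mono (b.u isPreord_leSink.refl 2 0) :=
      (ModuleCat.mono_iff_injective _).2 (b.u_injective isPreord_leSink (by decide))
    have h : b.dN ≫ biprod.fst = b.u isPreord_leSink.refl 2 0 := biprod.lift_fst _ _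
    exact mono_of_mono_fac h
  epi_g := (ModuleCat.epi_iff_surjective _).2 fun y => by
    let c : Fin 3 → K := fun w => b.coord ⟨w, Finset.mem_univ w⟩ y
    let x₀ := b.ofCoef isPreord_leSink.refl 0 c
    let x₁ := b.ofCoef isPreord_leSink.refl 1 fun w => if w = 1 then c 1 else 0
    refine ⟨(biprod.inl (X := b.P 0) (Y := b.P 1)).hom x₀ - (biprod.inr (X := b.P 0) (Y := b.P 1)).hom x₁, ?_⟩
    have h0 : b.cN.hom ((biprod.inl (X := b.P 0) (Y := b.P 1)).hom x₀) =
        (b.projThin isPreord_leSink _ (Finset.mem_univ 0)).hom x₀ :=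
      congrArg (fun φ : b.P 0 ⟶ b.thin _ _ => φ.hom x₀) (biprod.inl_desc _ _)
    have h1 : b.cN.hom ((biprod.inr (X := b.P 0) (Y := b.P 1)).hom x₁) =
        - (b.projThin isPreord_leSink _ (Finset.mem_univ 1)).hom x₁ :=
      congrArg (fun φ : b.P 1 ⟶ b.thin _ _ => φ.hom x₁) (biprod.inr_desc _ _)
    change b.cN.hom _ = y
    rw [map_sub, h0, h1, sub_neg_eq_add]
    refine b.thin_ext fun w => ?_
    rw [map_add, coord_projThin, coord_projThin]
    obtain ⟨w, hw⟩ := w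
    have h : ∀ w : Fin 3, b.coef 0 w (b.val x₀) + b.coef 1 w (b.val x₁) = c w := fun
      | 0 => by
        rw [b.coef_val_ofCoef isPreord_leSink.refl (by decide),
          b.coef_of_not (by decide)]
        exact add_zero _
      | 1 => by
        rw [b.coef_of_not (show ¬ leSink 0 1 by decide),
          b.coef_val_ofCoef isPreord_leSink.refl (by decide)]
        exact zero_add _
      | 2 => by
        rw [b.coef_val_ofCoef isPreord_leSink.refl (by decide),
          b.coef_val_ofCoef isPreord_leSink.refl (by decide)]
        simp
    exact h w

/-- Elements at 0 and 1 with the same nonzero image at 2 define a map from the module with full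
support to M, and a linear form not vanishing on this image retracts it. -/
theorem exists_retract_N (b : RelBasis K leSink A)
    {Y X M : RightMod A} [Projective X] (d : Y ⟶ X) (π : X ⟶ M) (w' : d ≫ π = 0)
    (hM : (ShortComplex.mk d π w').Exact) [Epi π] (x₀ x₁ : M)
    (h : op (b.el 0 2) • x₀ = op (b.el 1 2) • x₁) (h' : op (b.el 0 2) • x₀ ≠ 0) :
    Nonempty (Retract (tw b.dN) (tw d)) := by
  have hR := isPreord_leSink
  have h0 := b.projective_P' hR.refl 0
  have h1 := b.projective_P' hR.refl 1
  have h2 := b.projective_P' hR.refl 2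
  obtain ⟨Λ, hΛ, hΛ1, -⟩ := exists_linearForm (K := K) (0 : A) (op (b.el 0 2) • x₀)
    fun m => by rw [MulOpposite.op_zero, zero_smul]; exact h'.symm
  obtain ⟨β, hβ⟩ := b.exists_toThin hR (isConvex_leSink Finset.univ) Λ hΛ (t := 2) (by decide)
    fun v hv => absurd (Finset.mem_univ v) hv
  refine nonempty_retract_tw b.dN_comp_cN b.shortExact_N (fun f => ?_) w' hM
    (biprod.desc (b.fromP 0 x₀) (-b.fromP 1 x₁)) β ?_ ?_
  · refine biprod.hom_ext' _ _ ?_ ?_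
    · obtain ⟨c, hc⟩ := b.u_span hR.refl (biprod.inl ≫ f)
      rw [hc, b.u_of_not hR.refl (by decide), smul_zero, comp_zero]
    · obtain ⟨c, hc⟩ := b.u_span hR.refl (biprod.inr ≫ f)
      rw [hc, b.u_of_not hR.refl (by decide), smul_zero, comp_zero]
  · rw [dN, biprod.lift_desc, Preadditive.comp_neg, ← sub_eq_add_neg, sub_eq_zero]
    refine b.P_hom_ext hR.refl ?_
    change op (b.val ((b.u hR.refl 2 0).hom (b.gen hR.refl 2))) • x₀ =
      op (b.val ((b.u hR.refl 2 1).hom (b.gen hR.refl 2))) • x₁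
    rw [b.val_u_gen, b.val_u_gen, h]
  · rw [cN]
    refine biprod.hom_ext' _ _ ?_ ?_
    · rw [biprod.inl_desc, biprod.inl_desc_assoc]
      exact b.fromP_comp_eq_projThin _ _ (by decide) Λ β hβ hΛ1
    · rw [biprod.inr_desc, biprod.inr_desc_assoc, Preadditive.neg_comp,
        b.fromP_comp_eq_projThin _ _ (by decide) Λ β hβ (h ▸ hΛ1)]

/-- The indecomposable two-term complexes over `0 → 2 ← 1` with at most two terms. -/
def indecSink : Fin 8 → Option (Fin 3) × Option (Fin 3) :=
  ![(none, some 0), (none, some 1), (none, some 2), (some 2, some 0),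
    (some 2, some 1), (some 0, none), (some 1, none), (some 2, none)]

/-- The indecomposable two-term complexes over `0 → 2 ← 1`. -/
noncomputable def cplxSink (b : RelBasis K leSink A) : Option (Fin 8) → CochainComplex (RightMod A) ℤ
  | none => tw b.dN
  | some i => b.cplx isPreord_leSink.refl (indecSink i)

/-- If the images at the vertex 2 of the two arrows meet nontrivially, the module with full support
splits off. Otherwise an arrow acting nontrivially splits off P 0 or P 1, and if both arrows act as
zero, a simple module splits off. -/
theorem exists_retract_sink (b : RelBasis K leSink A)
    {Y X M : RightMod A} [Projective X] (d : Y ⟶ X) (π : X ⟶ M) (w' : d ≫ π = 0)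
    (hM : (ShortComplex.mk d π w').Exact) [Epi π] (h : ¬ IsZero M) :
    ∃ i, Nonempty (Retract (b.cplxSink i) (tw d)) := by
  by_cases hN : ∃ x₀ x₁ : M, op (b.el 0 2) • x₀ = op (b.el 1 2) • x₁ ∧ op (b.el 0 2) • x₀ ≠ 0
  · obtain ⟨x₀, x₁, h1, h2⟩ := hN
    exact ⟨none, b.exists_retract_N d π w' hM x₀ x₁ h1 h2⟩
  push Not at hN
  have hR := isPreord_leSink
  have key := fun (s : Finset (Fin 3)) (a t : Fin 3) (j : Option (Fin 3)) (ha : a ∈ s) h1 h2 h3 h4 =>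
      b.nonempty_retract_thin (hR := hR) (j := j) (isConvex_leSink s) (t := t) ha h1 h2 h3 h4 w' hM
  have key' : ∀ (s : Finset (Fin 3)) (a : Fin 3) (j : Option (Fin 3)) (ha : a ∈ s)
      (_ : ∀ w ∈ s, leSink a w) (_ : ∀ w, leSink a w → (w ∈ s ↔ ∀ v ∈ j, ¬ leSink v w))
      (_ : ∀ v ∈ j, leSink a v ∧ ∀ w, leSink v w → w ∉ s) (_ : ∀ w ∈ s, leSink w a)
      (x : M) (_ : op (b.el a a) • x ≠ 0) (_ : ∀ v, v ∉ s → leSink v a → ∀ m : M, op (b.el v a) • m = 0)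
      (_ : ∀ v ∈ j, op (b.el a v) • x = 0), Nonempty (Retract (b.cplx hR.refl (j, some a)) (tw d)) :=
    fun s a j ha h1 h2 h3 h4 x hx h5 h6 =>
      key s a a j ha h1 h2 h3 h4 x 0
        (fun m => by rw [MulOpposite.op_zero, zero_smul]; exact hx.symm)
        (fun v hv hv' m => ⟨m, by rw [MulOpposite.op_zero, zero_smul]; exact h5 v hv hv' m⟩) h6
  by_cases h02 : ∃ x : M, op (b.el 0 2) • x ≠ 0
  · obtain ⟨x, hx⟩ := h02
    -- Since the images of the two arrows meet only in zero, the linear form may be chosen to vanish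
    -- on the image of the arrow from 1, the only vertex outside the support.
    refine ⟨some 0, key {0, 2} 0 2 none (by decide) (by decide) (by decide) (by decide)
      (by decide) x (b.el 1 2) (fun m hm => hx (hN x m hm.symm)) (fun v hv hv' m => ?_) (by simp)⟩
    obtain rfl : v = 1 := by revert v; decide
    exact ⟨m, rfl⟩
  push Not at h02
  by_cases h12 : ∃ x : M, op (b.el 1 2) • x ≠ 0
  · obtain ⟨x, hx⟩ := h12
    refine ⟨some 1, key {1, 2} 1 2 none (by decide) (by decide) (by decide) (by decide)
      (by decide) x (b.el 0 2) (fun m hm => hx (by rw [← hm, h02])) (fun v hv hv' m => ?_) (by simp)⟩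
    obtain rfl : v = 0 := by revert v; decide
    exact ⟨m, rfl⟩
  push Not at h12
  obtain ⟨i, x, hx⟩ := b.exists_el_self_smul_ne_zero hR.refl h
  revert i
  refine fun
    | 0 => fun hx => ⟨some 3, key' {0} 0 (some 2) (by decide) (by decide) (by decide) (by decide)
      (by decide) x hx (fun v hv hv' => absurd hv (by revert v; decide)) (by simpa using h02 x)⟩
    | 1 => fun hx => ⟨some 4, key' {1} 1 (some 2) (by decide) (by decide) (by decide) (by decide)
      (by decide) x hx (fun v hv hv' => absurd hv (by revert v; decide)) (by simpa using h12 x)⟩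
    | 2 => fun hx => ⟨some 2, key' {2} 2 none (by decide) (by decide) (by decide) (by decide)
      (by decide) x hx (fun v hv hv' => ?_) (by simp)⟩
  obtain rfl | rfl : v = 0 ∨ v = 1 := by revert v; decide
  · exact h02
  · exact h12

end RelBasis

end Silted

namespace Silted
open CategoryTheory CategoryTheory.Limits MulOpposite

/-! ### Homomorphisms between two-term complexes -/

/-- The restriction of a table of homomorphisms. -/
def HomTable.comap {K : Type u} [Field K] {C : Type v} [Category.{w} C] [Preadditive C] [Linear K C]
    {κ κ' : Type} {X : κ → C} {R : κ → κ → Prop} (H : HomTable K X R) (e : κ' → κ) :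
    HomTable K (fun k => X (e k)) (fun k l => R (e k) (e l)) where
  f k l := H.f (e k) (e l)
  span k l := H.span (e k) (e l)
  zero k l := H.zero (e k) (e l)
  ne_zero k l := H.ne_zero (e k) (e l)
  id k := H.id (e k)
  comp j k l := H.comp (e j) (e k) (e l)

/-- The relation between the indecomposable projective modules, and the zero module. -/
def OptRel {V : Type} (R : V → V → Prop) : Option V → Option V → Prop
  | some j, some i => R i j
  | _, _ => False

instance {V : Type} (R : V → V → Prop) [DecidableRel R] : DecidableRel (OptRel R)
  | some j, some i => inferInstanceAs (Decidable (R i j))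
  | none, _ => inferInstanceAs (Decidable False)
  | some _, none => inferInstanceAs (Decidable False)

namespace RelBasis

variable {K : Type u} [Field K] {V : Type} {R : V → V → Prop} {A : Type u} [Ring A] [Algebra K A]
  (b : RelBasis K R A)

theorem u'_of_not (hR : ∀ i, R i i) : ∀ {j i : Option V}, ¬ OptRel R j i → b.u' hR j i = 0
  | some _, some _, h => b.u_of_not hR h
  | none, _, _ => rfl
  | some _, none, _ => rfl

theorem u'_ne_zero (hR : ∀ i, R i i) : ∀ {j i : Option V}, OptRel R j i → b.u' hR j i ≠ 0
  | some _, some _, h => b.u_ne_zero hR h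

theorem u'_self (hR : ∀ i, R i i) : ∀ i : Option V, b.u' hR i i = 𝟙 _
  | some i => b.u_self hR i
  | none => b.isZero_P'.eq_of_src _ _

theorem u'_comp (hR : ∀ i, R i i) : ∀ {k j i : Option V}, OptRel R k j → OptRel R j i →
    b.u' hR k j ≫ b.u' hR j i = b.u' hR k i
  | some _, some _, some _, h, h' => b.u_comp hR h' h

theorem u'_span (hR : ∀ i, R i i) : ∀ {j i : Option V} (φ : b.P' j ⟶ b.P' i), ∃ c : K, φ = c • b.u' hR j i
  | some _, some _, φ => b.u_span hR φ
  | none, _, _ => ⟨0, b.isZero_P'.eq_of_src _ _⟩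
  | some _, none, _ => ⟨0, b.isZero_P'.eq_of_tgt _ _⟩

theorem u'_comp_of_not (hR : ∀ i, R i i) {k j i : Option V} (h : ¬ (OptRel R k j ∧ OptRel R j i)) :
    b.u' hR k j ≫ b.u' hR j i = 0 := by
  by_cases h1 : OptRel R k j
  · rw [b.u'_of_not hR fun h2 => h ⟨h1, h2⟩, comp_zero]
  · rw [b.u'_of_not hR h1, zero_comp]

end RelBasis

/-- The pairs for which there is a nonzero complex `P j ⟶ P i` with radical differential. -/
def IsValid {V : Type} (R : V → V → Prop) (p : Option V × Option V) : Prop :=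
  p.1 ≠ none → p.2 ≠ none → OptRel R p.1 p.2

/-- There are nonzero morphisms between the two-term complexes. -/
def CplxRel {V : Type} (R : V → V → Prop) (p q : Option V × Option V) : Prop :=
  (OptRel R p.1 q.1 ∨ OptRel R p.2 q.2) ∧ ¬ OptRel R p.2 q.1 ∧
    ((OptRel R p.1 q.1 ∧ OptRel R q.1 q.2) ↔ (OptRel R p.1 p.2 ∧ OptRel R p.2 q.2))

/-- There are no nonzero morphisms to the shift. -/
def CplxCompat {V : Type} (R : V → V → Prop) (p q : Option V × Option V) : Prop :=
  ¬ (OptRel R p.1 q.2 ∧ ¬ OptRel R p.1 q.1 ∧ ¬ OptRel R p.2 q.2)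

/-- The canonical morphisms between the complexes compose to the canonical ones. -/
def CplxComp {V : Type} (R : V → V → Prop) (p q r : Option V × Option V) : Prop :=
  CplxRel R p q → CplxRel R q r → CplxRel R p r →
    (OptRel R p.1 r.1 → OptRel R p.1 q.1 ∧ OptRel R q.1 r.1) ∧
      (OptRel R p.2 r.2 → OptRel R p.2 q.2 ∧ OptRel R q.2 r.2)

section

variable {V : Type} [DecidableEq V] (R : V → V → Prop) [DecidableRel R]

instance : DecidablePred (IsValid R) := fun _ => inferInstanceAs (Decidable (_ → _))
instance : DecidableRel (CplxRel R) := fun _ _ => inferInstanceAs (Decidable (_ ∧ _))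
instance : DecidableRel (CplxCompat R) := fun _ _ => inferInstanceAs (Decidable (¬ _))
instance (p q r) : Decidable (CplxComp R p q r) := inferInstanceAs (Decidable (_ → _ → _))

end

theorem OptRel.ne_none {V : Type} {R : V → V → Prop} : ∀ {j i : Option V}, OptRel R j i → j ≠ none ∧ i ≠ none
  | some _, some _, _ => ⟨nofun, nofun⟩

namespace RelBasis

section

variable {K : Type u} [Field K] {V : Type} {R : V → V → Prop} {A : Type u} [Ring A] [Algebra K A]
  (b : RelBasis K R A) (hR : IsPreord R)

/-- The object of the homotopy category. -/
noncomputable abbrev ho (p : Option V × Option V) : HoCat A := toHo (b.cplx hR.refl p)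


variable {p q r : Option V × Option V}

theorem optRel_trans (hR : IsPreord R) : ∀ {k j i : Option V}, OptRel R k j → OptRel R j i → OptRel R k i
  | some _, some _, some _, h, h' => hR.trans _ _ _ h' h

theorem cplxRel_comm (h : CplxRel R p q) :
    b.u' hR.refl p.1 p.2 ≫ b.u' hR.refl p.2 q.2 = b.u' hR.refl p.1 q.1 ≫ b.u' hR.refl q.1 q.2 := by
  by_cases h1 : OptRel R p.1 q.1 ∧ OptRel R q.1 q.2
  · have h2 := h.2.2.1 h1
    rw [b.u'_comp _ h1.1 h1.2, b.u'_comp _ h2.1 h2.2]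
  · rw [b.u'_comp_of_not _ h1, b.u'_comp_of_not _ fun h2 => h1 (h.2.2.2 h2)]

open Classical in
/-- The canonical morphism between two-term complexes. -/
noncomputable def hoU (p q : Option V × Option V) : b.ho hR p ⟶ b.ho hR q :=
  if h : CplxRel R p q then hoHom _ _ (b.cplxRel_comm hR h) else 0

theorem hoU_of_rel (h : CplxRel R p q) : b.hoU hR p q = hoHom _ _ (b.cplxRel_comm hR h) := dif_pos h

theorem hoU_ne_zero (h : CplxRel R p q) : b.hoU hR p q ≠ 0 := fun h0 => by
  rw [b.hoU_of_rel hR h, hoHom_eq_zero_iff] at h0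
  obtain ⟨s, h1, h2⟩ := h0
  obtain ⟨c, hc⟩ := b.u'_span hR.refl s
  rw [b.u'_of_not hR.refl h.2.1, smul_zero] at hc
  rw [hc, comp_zero] at h1
  rw [hc, zero_comp] at h2
  exact h.1.elim (fun h3 => b.u'_ne_zero hR.refl h3 h1) fun h3 => b.u'_ne_zero hR.refl h3 h2

theorem hoHom_congr {C : Type*} [Category C] [Preadditive C] [HasZeroObject C] {Y X Y' X' : C}
    {d : Y ⟶ X} {d' : Y' ⟶ X'} {x x₁ : Y ⟶ Y'} {y y₁ : X ⟶ X'} (h : d ≫ y = x ≫ d') (hx : x = x₁) (hy : y = y₁) :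
    hoHom x y h = hoHom x₁ y₁ (hx ▸ hy ▸ h) := by
  subst hx hy; rfl

/-- Both components are multiples of canonical maps. If there is a nonzero map from the degree 0
term of the source to the degree -1 term of the target, every morphism is null-homotopic. Otherwise
there are no homotopies, and commutativity of the square either identifies the two scalars, or
forces one of the components to vanish, or leaves at most one component nonzero. -/
theorem hoU_span (hp : IsValid R p) (hq : IsValid R q) (φ : b.ho hR p ⟶ b.ho hR q) :
    ∃ c : K, φ = c • b.hoU hR p q := by
  obtain ⟨x, y, h, rfl⟩ := exists_hoHom φ
  obtain ⟨c₁, rfl⟩ := b.u'_span hR.refl x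
  obtain ⟨c₂, rfl⟩ := b.u'_span hR.refl y
  have hcomm := h
  rw [Linear.comp_smul, Linear.smul_comp] at hcomm
  have common : OptRel R p.1 q.2 → (OptRel R p.1 p.2 ∧ OptRel R p.2 q.2) → (OptRel R p.1 q.1 ∧ OptRel R q.1 q.2) →
      c₂ = c₁ := fun h1 h2 h3 => by
    rw [b.u'_comp _ h2.1 h2.2, b.u'_comp _ h3.1 h3.2] at hcomm
    exact smul_left_injective K (b.u'_ne_zero hR.refl h1) hcomm
  by_cases hil : OptRel R p.2 q.1
  · have hi := hil.ne_none
    refine ⟨0, ?_⟩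
    rw [zero_smul, hoHom_eq_zero_iff]
    by_cases hj : p.1 = none
    · refine ⟨c₂ • b.u' hR.refl p.2 q.1, ?_, ?_⟩
      · have : IsZero (b.P' p.1) := hj ▸ b.isZero_P'
        exact this.eq_of_src _ _
      · by_cases hk : q.2 = none
        · have : IsZero (b.P' q.2) := hk ▸ b.isZero_P'
          exact this.eq_of_tgt _ _
        · rw [Linear.smul_comp, b.u'_comp hR.refl hil (hq hi.2 hk)]
    · have hji := hp hj hi.1
      refine ⟨c₁ • b.u' hR.refl p.2 q.1, ?_, ?_⟩
      · rw [Linear.comp_smul, b.u'_comp hR.refl hji hil]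
      · by_cases hk : q.2 = none
        · have : IsZero (b.P' q.2) := hk ▸ b.isZero_P'
          exact this.eq_of_tgt _ _
        · have hlk := hq hi.2 hk
          rw [Linear.smul_comp, b.u'_comp hR.refl hil hlk,
            common (optRel_trans hR hji (optRel_trans hR hil hlk)) ⟨hji, optRel_trans hR hil hlk⟩
              ⟨optRel_trans hR hji hil, hlk⟩]
  · suffices hc : ∃ c : K, c₁ • b.u' hR.refl p.1 q.1 = c • b.u' hR.refl p.1 q.1 ∧
        c₂ • b.u' hR.refl p.2 q.2 = c • b.u' hR.refl p.2 q.2 ∧ (c ≠ 0 → CplxRel R p q) by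
      obtain ⟨c, h1, h2, h3⟩ := hc
      refine ⟨c, ?_⟩
      rw [hoHom_congr _ h1 h2]
      by_cases hc : c = 0
      · subst hc
        refine Eq.trans ?_ (zero_smul K _).symm
        rw [hoHom_eq_zero_iff]
        exact ⟨0, by simp, by simp⟩
      · rw [b.hoU_of_rel hR (h3 hc), smul_hoHom]
    by_cases h1 : OptRel R p.1 q.1 ∧ OptRel R q.1 q.2
    · by_cases h2 : OptRel R p.1 p.2 ∧ OptRel R p.2 q.2
      · exact ⟨c₁, rfl, by rw [common (optRel_trans hR h1.1 h1.2) h2 h1],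
          fun _ => ⟨Or.inl h1.1, hil, iff_of_true h1 h2⟩⟩
      · rw [b.u'_comp _ h1.1 h1.2, b.u'_comp_of_not _ h2, smul_zero] at hcomm
        have hc := (smul_eq_zero.1 hcomm.symm).resolve_right
          (b.u'_ne_zero hR.refl (optRel_trans hR h1.1 h1.2))
        refine ⟨0, by rw [hc], ?_, fun h => absurd rfl h⟩
        rw [b.u'_of_not hR.refl fun h3 => h2 ⟨hp h1.1.ne_none.1 h3.ne_none.1, h3⟩, smul_zero, smul_zero]
    · by_cases h2 : OptRel R p.1 p.2 ∧ OptRel R p.2 q.2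
      · rw [b.u'_comp _ h2.1 h2.2, b.u'_comp_of_not _ h1, smul_zero] at hcomm
        have hc := (smul_eq_zero.1 hcomm).resolve_right
          (b.u'_ne_zero hR.refl (optRel_trans hR h2.1 h2.2))
        refine ⟨0, ?_, by rw [hc], fun h => absurd rfl h⟩
        rw [b.u'_of_not hR.refl fun h3 => h1 ⟨h3, hq h3.ne_none.2 h2.2.ne_none.2⟩, smul_zero, smul_zero]
      · by_cases h3 : OptRel R p.1 q.1
        · refine ⟨c₁, rfl, ?_, fun _ => ⟨Or.inl h3, hil, iff_of_false h1 h2⟩⟩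
          rw [b.u'_of_not hR.refl fun h4 => h2 ⟨hp h3.ne_none.1 h4.ne_none.1, h4⟩, smul_zero, smul_zero]
        · by_cases h4 : OptRel R p.2 q.2
          · refine ⟨c₂, ?_, rfl, fun _ => ⟨Or.inr h4, hil, iff_of_false h1 h2⟩⟩
            rw [b.u'_of_not hR.refl h3, smul_zero, smul_zero]
          · refine ⟨0, ?_, ?_, fun h => absurd rfl h⟩
            · rw [b.u'_of_not hR.refl h3, smul_zero, smul_zero]
            · rw [b.u'_of_not hR.refl h4, smul_zero, smul_zero]

/-- The table of homomorphisms between two-term complexes. -/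
noncomputable def homTableCplx {κ : Type} (a : κ → Option V × Option V) (h₁ : ∀ k, IsValid R (a k))
    (h₂ : ∀ k, CplxRel R (a k) (a k)) (h₃ : ∀ k l m, CplxComp R (a k) (a l) (a m)) :
    HomTable K (fun k => b.ho hR (a k)) (fun k l => CplxRel R (a k) (a l)) where
  f k l := b.hoU hR (a k) (a l)
  span k l := b.hoU_span hR (h₁ k) (h₁ l)
  zero k l h := dif_neg h
  ne_zero k l h := b.hoU_ne_zero hR h
  id k := by
    rw [b.hoU_of_rel hR (h₂ k), hoHom_congr _ (b.u'_self hR.refl _) (b.u'_self hR.refl _), hoHom_id]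
  comp k l m hkl hlm hkm := by
    rw [b.hoU_of_rel hR hkl, b.hoU_of_rel hR hlm, b.hoU_of_rel hR hkm, hoHom_comp]
    have hc := h₃ k l m hkl hlm hkm
    refine hoHom_congr _ ?_ ?_
    · by_cases h : OptRel R (a k).1 (a m).1
      · rw [b.u'_comp hR.refl (hc.1 h).1 (hc.1 h).2]
      · rw [b.u'_of_not hR.refl h, b.u'_comp_of_not hR.refl fun h' => h (optRel_trans hR h'.1 h'.2)]
    · by_cases h : OptRel R (a k).2 (a m).2
      · rw [b.u'_comp hR.refl (hc.2 h).1 (hc.2 h).2]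
      · rw [b.u'_of_not hR.refl h, b.u'_comp_of_not hR.refl fun h' => h (optRel_trans hR h'.1 h'.2)]

/-- A morphism to the shift is a map from the degree -1 term to the degree 0 term, modulo maps that
factor through one of the differentials. The canonical map factors as soon as one of the two
degreewise canonical maps is nonzero. -/
theorem shift_eq_zero_iff (hp : IsValid R p) (hq : IsValid R q) :
    (∀ f : b.ho hR p ⟶ (b.ho hR q)⟦(1 : ℤ)⟧, f = 0) ↔ CplxCompat R p q := by
  refine tw_shift_one_iff.trans ⟨fun h ⟨h1, h2, h3⟩ => ?_, fun h g => ?_⟩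
  · obtain ⟨s, t, hst⟩ := h (b.u' hR.refl _ _)
    obtain ⟨c, rfl⟩ := b.u'_span hR.refl s
    obtain ⟨c', rfl⟩ := b.u'_span hR.refl t
    rw [b.u'_of_not hR.refl h2, b.u'_of_not hR.refl h3] at hst
    exact b.u'_ne_zero hR.refl h1 (by simpa using hst)
  · obtain ⟨c, rfl⟩ := b.u'_span hR.refl g
    by_cases h1 : OptRel R p.1 q.2
    · by_cases h2 : OptRel R p.1 q.1
      · refine ⟨c • b.u' hR.refl p.1 q.1, 0, ?_⟩
        rw [Linear.smul_comp, b.u'_comp hR.refl h2 (hq h2.ne_none.2 h1.ne_none.2), comp_zero, add_zero]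
      · have h3 : OptRel R p.2 q.2 := by
          by_contra h3; exact h ⟨h1, h2, h3⟩
        refine ⟨0, c • b.u' hR.refl p.2 q.2, ?_⟩
        rw [Linear.comp_smul, b.u'_comp hR.refl (hp h1.ne_none.1 h3.ne_none.1) h3, zero_comp, zero_add]
    · exact ⟨0, 0, by rw [b.u'_of_not hR.refl h1]; simp⟩

end

end RelBasis

end Silted

namespace Silted
open CategoryTheory CategoryTheory.Limits MulOpposite

open ZeroObject

/-! ### Objects without morphisms to the shifts of a module -/

/-- Morphisms from the complex to the shifts of Z are computed by Hom(X, Z) → Hom(Y, Z); the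
hypotheses say that this map is injective and surjective. -/
theorem isOrth_tw {C : Type u} [Category.{v} C] [Abelian C] {Y X Z : C} (d : Y ⟶ X) (h₀ : ∀ y : X ⟶ Z, d ≫ y = 0 → y = 0)
    (h₁ : ∀ x : Y ⟶ Z, ∃ y, x = d ≫ y) : IsOrth ((qHo C).obj (st Z)) ((qHo C).obj (tw d)) := by
  intro n f
  by_cases hn : n = 1
  · subst hn
    revert f
    refine tw_shift_one_iff.2 fun g => ?_
    obtain ⟨y, hy⟩ := h₁ g
    exact ⟨0, y, by rw [zero_comp, zero_add, hy]⟩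
  by_cases hn' : n = 0
  · subst hn'
    let e := (shiftFunctorZero (HomotopyCategory C (ComplexShape.up ℤ)) ℤ).app ((qHo C).obj (st Z))
    rw [← cancel_mono e.hom, zero_comp]
    obtain ⟨x, y, h, hf⟩ := exists_hoHom (f ≫ e.hom)
    refine hf.trans ((hoHom_eq_zero_iff x y h).2 ⟨0, (isZero_zero C).eq_of_tgt _ _, ?_⟩)
    rw [zero_comp]
    exact h₀ y (h.trans comp_zero)
  · refine shift_eq_zero (fun p q hpq => ?_) f
    by_cases hp : p = -1 ∨ p = 0
    · right
      by_cases hq : q = -1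
      · have h0 : IsZero ((st Z).X (-1)) := isZero_zero C
        rw [hq]; exact h0
      · exact isZero_tw _ q hq (by omega)
    · rw [not_or] at hp
      exact Or.inl (isZero_tw d p hp.1 hp.2)

theorem not_isOrth_st {C : Type u} [Category.{v} C] [Abelian C] {X Z : C} (φ : X ⟶ Z) (hφ : φ ≠ 0) :
    ¬ IsOrth ((qHo C).obj (st Z)) ((qHo C).obj (st X)) := fun h => by
  let e := (shiftFunctorZero (HomotopyCategory C (ComplexShape.up ℤ)) ℤ).app ((qHo C).obj (st Z))
  let f : (qHo C).obj (st X) ⟶ (qHo C).obj (st Z) :=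
    hoHom (d := (0 : (0 : C) ⟶ X)) (d' := (0 : (0 : C) ⟶ Z)) 0 φ (by simp)
  have h0 : f ≫ e.inv = 0 := h 0 (f ≫ e.inv)
  have h1 : f = 0 := by rw [← cancel_mono e.inv, h0, zero_comp]
  obtain ⟨s, -, hs⟩ := (hoHom_eq_zero_iff _ _ _).1 h1
  exact hφ (hs.trans comp_zero)

theorem finite_of_isZero {A : Type u} [Ring A] {M : RightMod A} (h : IsZero M) : Module.Finite Aᵐᵒᵖ M :=
  have : Subsingleton M := (ModuleCat.isZero_of_iff_subsingleton (M := M)).1 h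
  inferInstance

theorem moduleProjective_of_isZero {A : Type u} [Ring A] {M : RightMod A} (h : IsZero M) :
    Module.Projective Aᵐᵒᵖ M :=
  have : Subsingleton M := (ModuleCat.isZero_of_iff_subsingleton (M := M)).1 h
  inferInstance

theorem isPerfect_tw {A : Type u} [Ring A] {Y X : RightMod A} (d : Y ⟶ X) (hY : Module.Finite Aᵐᵒᵖ Y)
    (hX : Module.Finite Aᵐᵒᵖ X) (hY' : Module.Projective Aᵐᵒᵖ Y) (hX' : Module.Projective Aᵐᵒᵖ X) :
    IsPerfect (tw d) := by
  refine ⟨fun i => ?_, fun i => ?_, 1, fun i hi => ?_⟩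
  · by_cases h : i = -1
    · subst h; exact hY
    by_cases h' : i = 0
    · subst h'; exact hX
    exact finite_of_isZero (isZero_tw d i h h')
  · by_cases h : i = -1
    · subst h; exact hY'
    by_cases h' : i = 0
    · subst h'; exact hX'
    exact moduleProjective_of_isZero (isZero_tw d i h h')
  · refine isZero_tw d i (fun h => ?_) fun h => ?_ <;> subst h <;> simp at hi

namespace RelBasis

section

variable {K : Type u} [Field K] {V : Type} {R : V → V → Prop} {A : Type u} [Ring A] [Algebra K A]
  (b : RelBasis K R A)

theorem finite_P' (hR : ∀ i, R i i) : ∀ i, Module.Finite Aᵐᵒᵖ (b.P' i)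
  | some i => b.finite_P hR i
  | none => finite_of_isZero b.isZero_P'

theorem moduleProjective_P' (hR : ∀ i, R i i) : ∀ i, Module.Projective Aᵐᵒᵖ (b.P' i)
  | some i => b.projective_P hR i
  | none => moduleProjective_of_isZero b.isZero_P'

theorem isPerfect_cplx (hR : ∀ i, R i i) (p : Option V × Option V) : IsPerfect (b.cplx hR p) :=
  isPerfect_tw _ (b.finite_P' hR _) (b.finite_P' hR _) (b.moduleProjective_P' hR _)
    (b.moduleProjective_P' hR _)

variable [Fintype V] [DecidableEq V] {hR : IsPreord R} {s : Finset V} (hs : IsConvex R s)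

theorem u_comp_projThin {i j : V} (hi : i ∈ s) (hj : j ∈ s) (hij : R i j) :
    b.u hR.refl j i ≫ b.projThin hR hs hi = b.projThin hR hs hj := by
  refine b.P_hom_ext hR.refl (b.thin_ext fun w => ?_)
  rw [ModuleCat.comp_apply, coord_projThin, coord_projThin, b.coef_val_u hR hij]

/-- The complex `P j ⟶ P i` is orthogonal to a thin module. -/
theorem isOrth_cplx {p : Option V × Option V} (hp : IsValid R p) (h : (∃ v ∈ p.1, v ∈ s) ↔ ∃ v ∈ p.2, v ∈ s) :
    IsOrth (toHo (st (b.thin hR hs))) (b.ho hR p) := by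
  -- A projective has Hom space K or 0 to the thin module according to whether its vertex lies in
  -- `s`. By `h` either both Hom spaces are K, and the differential identifies them, or both are 0.
  by_cases h1 : ∃ v ∈ p.1, v ∈ s
  · obtain ⟨i, hi, his⟩ := h.1 h1
    obtain ⟨j, hj, hjs⟩ := h1
    obtain ⟨p₁, p₂⟩ := p
    obtain rfl : p₁ = some j := hj
    obtain rfl : p₂ = some i := hi
    have hij : R i j := hp nofun nofun
    have hc : b.u hR.refl j i ≫ b.projThin hR hs his = b.projThin hR hs hjs := b.u_comp_projThin hs his hjs hij
    refine isOrth_tw (Y := b.P j) (X := b.P i) (b.u hR.refl j i) (fun y hy => ?_) fun x => ?_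
    · obtain ⟨c, rfl⟩ := b.projThin_span hR hs his y
      rw [Linear.comp_smul, hc] at hy
      rw [(smul_eq_zero.1 hy).resolve_right (b.projThin_ne_zero hR hs hjs), zero_smul]
    · obtain ⟨c, rfl⟩ := b.projThin_span hR hs hjs x
      exact ⟨c • b.projThin hR hs his, by rw [Linear.comp_smul, hc]⟩
  · have h2 := fun h' => h1 (h.2 h')
    have h0 : ∀ {j : Option V} (_ : ¬ ∃ v ∈ j, v ∈ s) (x : b.P' j ⟶ b.thin hR hs), x = 0 := fun {j} hj x => by
      cases j with
      | none => exact b.isZero_P'.eq_of_src _ _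
      | some j => exact b.hom_thin_eq_zero hR hs (fun h => hj ⟨j, rfl, h⟩) x
    exact isOrth_tw _ (fun y _ => h0 h2 y) fun x => ⟨0, by rw [h0 h1 x, comp_zero]⟩

theorem not_isOrth_P {i : V} (hi : i ∈ s) : ¬ IsOrth (toHo (st (b.thin hR hs))) (toHo (st (b.P i))) :=
  not_isOrth_st (b.projThin hR hs hi) (b.projThin_ne_zero hR hs hi)

/-- A silting complex is not orthogonal to a nonzero thin module. -/
theorem false_of_isOrth (hs' : s.Nonempty) {P : CochainComplex (RightMod A) ℤ} (hP : IsSilting P)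
    {κ : Type} [Fintype κ] {X : κ → HoCat A} (D : Decomp (toHo P) X)
    (h : ∀ k, IsOrth (toHo (st (b.thin hR hs))) (X k)) : False := by
  obtain ⟨i, hi⟩ := hs'
  -- The objects orthogonal to the thin module form a thick subcategory. If it contained the silting
  -- complex, it would contain every P i, but P i maps onto a basis vector of the thin module for
  -- `i` in `s`.
  have h1 : IsOrth (toHo (st (b.thin hR hs))) (toHo P) := D.prop _ h
  exact b.not_isOrth_P hs hi (hP.generates _ inferInstance inferInstance h1 _
    (isPerfect_tw _ (finite_of_isZero (isZero_zero _)) (b.finite_P hR.refl i)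
      (moduleProjective_of_isZero (isZero_zero _)) (b.projective_P hR.refl i)))

end

end RelBasis

/-! ### Silting complexes given by decompositions -/

theorem Decomp.projective {C : Type*} [Category C] [Preadditive C] {T : C} {κ : Type} [Fintype κ] {X : κ → C}
    (D : Decomp T X) (h : ∀ k, Projective (X k)) : Projective T :=
  ⟨fun f e _ => ⟨∑ k, D.prj k ≫ Projective.factorThru (D.inc k ≫ f) e, D.hom_ext fun k => by
    rw [D.inc_comp_sum_assoc, Projective.factorThru_comp]⟩⟩

theorem isPerfect_of_decomp {A : Type u} [Ring A] {P : CochainComplex (RightMod A) ℤ} {κ : Type} [Fintype κ]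
    {X : κ → CochainComplex (RightMod A) ℤ} (D : Decomp P X) (h : ∀ k, IsPerfect (X k)) : IsPerfect P := by
  let D' := fun i => D.map (HomologicalComplex.eval (RightMod A) (ComplexShape.up ℤ) i)
  choose N hN using fun k => (h k).bounded
  refine ⟨fun i => (D' i).finite fun k => (h k).finite i, fun i => ?_, ∑ k, N k, fun i hi => ?_⟩
  · have : ∀ k, Module.Projective Aᵐᵒᵖ ((X k).X i) := fun k => (h k).projective i
    have h2 : ∀ k, Projective ((HomologicalComplex.eval (RightMod A) (ComplexShape.up ℤ) i).obj (X k)) := fun k => (IsProjective.iff_projective _).1 (this k)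
    refine (IsProjective.iff_projective _).2 ?_
    exact (D' i).projective h2
  · refine (IsZero.iff_id_eq_zero (P.X i)).2 ((D' i).total.symm.trans (Finset.sum_eq_zero fun k _ => ?_))
    have : IsZero ((X k).X i) := hN k i (lt_of_le_of_lt (by
      exact_mod_cast Finset.single_le_sum (f := N) (fun _ _ => Nat.zero_le _) (Finset.mem_univ k)) hi)
    exact (congrArg (· ≫ (D' i).inc k) (this.eq_of_tgt ((D' i).prj k) 0)).trans zero_comp

theorem isTwoTerm_of_decomp {A : Type u} [Ring A] {P : CochainComplex (RightMod A) ℤ} {κ : Type} [Fintype κ]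
    {X : κ → CochainComplex (RightMod A) ℤ} (D : Decomp P X) (h : ∀ k, IsTwoTerm (X k)) : IsTwoTerm P := by
  let D' := fun i => D.map (HomologicalComplex.eval (RightMod A) (ComplexShape.up ℤ) i)
  intro i hi hi'
  refine (IsZero.iff_id_eq_zero (P.X i)).2 ((D' i).total.symm.trans (Finset.sum_eq_zero fun k _ => ?_))
  have : IsZero ((X k).X i) := h k i hi hi'
  exact (congrArg (· ≫ (D' i).inc k) (this.eq_of_tgt ((D' i).prj k) 0)).trans zero_comp

theorem shift_eq_zero_of_decomp {C : Type*} [Category C] [Preadditive C] [HasShift C ℤ]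
    [∀ n : ℤ, (shiftFunctor C n).Additive] {T : C} {κ : Type} [Fintype κ] {X : κ → C} (D : Decomp T X) {n : ℤ}
    (h : ∀ k l (f : X k ⟶ (X l)⟦n⟧), f = 0) (f : T ⟶ T⟦n⟧) : f = 0 := by
  refine D.hom_ext fun k => ?_
  let D' := D.map (shiftFunctor C n)
  rw [comp_zero, ← Category.comp_id (D.inc k ≫ f)]
  have h1 : 𝟙 (T⟦n⟧) = ∑ l, D'.prj l ≫ D'.inc l := D'.total.symm
  rw [h1, Preadditive.comp_sum]
  refine Finset.sum_eq_zero fun l _ => ?_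
  rw [← Category.assoc, h k l ((D.inc k ≫ f) ≫ D'.prj l), zero_comp]

theorem shift_eq_zero_of_isTwoTerm {A : Type u} [Ring A] {P : CochainComplex (RightMod A) ℤ} (hP : IsTwoTerm P)
    {n : ℤ} (hn : 1 < n) (f : toHo P ⟶ (toHo P)⟦n⟧) : f = 0 := by
  refine shift_eq_zero (fun p q hpq => ?_) f
  by_cases hp : p = -1 ∨ p = 0
  · exact Or.inr (hP q (by omega) (by omega))
  · rw [not_or] at hp
    exact Or.inl (hP p hp.1 hp.2)

/-- If a triangulated subcategory contains the indecomposable projective modules, then it contains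
all perfect complexes. -/
theorem RelBasis.prop_of_prop_P {K : Type u} [Field K] {V : Type} [Fintype V] {R : V → V → Prop} {A : Type u} [Ring A]
    [Algebra K A] (b : RelBasis K R A) (hR : ∀ i, R i i) (S : ObjectProperty (HoCat A)) [S.IsTriangulated]
    [S.IsStableUnderRetracts] (h : ∀ i, S (toHo (st (b.P i)))) {Q : CochainComplex (RightMod A) ℤ} (hQ : IsPerfect Q) :
    S (toHo Q) := by
  let F : RightMod A ⥤ HoCat A := HomologicalComplex.single (RightMod A) (ComplexShape.up ℤ) 0 ⋙ qHo (RightMod A)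
  have hst : ∀ X : RightMod A, st X ≅ (HomologicalComplex.single (RightMod A) (ComplexShape.up ℤ) 0).obj X := fun X => by
    let e := HomologicalComplex.singleObjXSelf (ComplexShape.up ℤ) (0 : ℤ) X
    let z : IsZero (((HomologicalComplex.single (RightMod A) (ComplexShape.up ℤ) 0).obj X).X (-1)) :=
      HomologicalComplex.isZero_single_obj_X _ _ _ _ (by decide)
    have hz : ∀ i : ℤ, i ≠ -1 → i ≠ 0 → IsZero (((HomologicalComplex.single (RightMod A) (ComplexShape.up ℤ) 0).obj X).X i) :=
      fun i _ hi => HomologicalComplex.isZero_single_obj_X _ _ _ _ hi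
    refine Iso.symm (isoTw hz ≪≫ ?_)
    exact
      { hom := twHom 0 e.hom (z.eq_of_src _ _)
        inv := twHom 0 e.inv ((isZero_zero _).eq_of_src _ _)
        hom_inv_id := (twHom_comp _ _ _ _ _ _).trans (tw_hom_ext (z.eq_of_src _ _) e.hom_inv_id)
        inv_hom_id := (twHom_comp _ _ _ _ _ _).trans (tw_hom_ext ((isZero_zero _).eq_of_src _ _) e.inv_hom_id) }
  have hP : ∀ i, S (F.obj (b.P i)) := fun i => S.prop_of_iso ((qHo _).mapIso (hst _)) (h i)
  have hA : S (F.obj (ModuleCat.of Aᵐᵒᵖ A)) := ((b.decompRegular hR).map F).prop S hP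
  let p : ObjectProperty (RightMod A) := fun X => Module.Finite Aᵐᵒᵖ X ∧ Module.Projective Aᵐᵒᵖ X
  have : p.IsClosedUnderIsomorphisms := ⟨fun e h => by
    have := h.1
    have := h.2
    exact ⟨Module.Finite.equiv e.toLinearEquiv, Module.Projective.of_equiv e.toLinearEquiv⟩⟩
  have : p.ContainsZero := ⟨0, isZero_zero _, finite_of_isZero (isZero_zero _),
    moduleProjective_of_isZero (isZero_zero _)⟩
  have hF : ∀ X, p X → S (F.obj X) := fun X hX => by
    have := hX.1
    have := (IsProjective.iff_projective X).1 hX.2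
    obtain ⟨n, f, hf⟩ := Module.Finite.exists_fin' Aᵐᵒᵖ X
    let A' := ModuleCat.of Aᵐᵒᵖ A
    let e : A' ≅ ModuleCat.of Aᵐᵒᵖ Aᵐᵒᵖ := LinearEquiv.toModuleIso
      { toFun := op, invFun := unop, left_inv := fun _ => rfl, right_inv := fun _ => rfl
        map_add' := fun _ _ => rfl, map_smul' := fun _ _ => rfl }
    let D : Decomp (ModuleCat.of Aᵐᵒᵖ (Fin n → Aᵐᵒᵖ)) fun _ : Fin n => A' :=
      { inc := fun k => e.hom ≫ ModuleCat.ofHom (LinearMap.single Aᵐᵒᵖ (fun _ : Fin n => Aᵐᵒᵖ) k)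
        prj := fun k => ModuleCat.ofHom (LinearMap.proj k) ≫ e.inv
        inc_prj_self := fun k => by
          have h : ModuleCat.ofHom (LinearMap.single Aᵐᵒᵖ (fun _ : Fin n => Aᵐᵒᵖ) k) ≫ ModuleCat.ofHom (LinearMap.proj k) = 𝟙 _ := by
            ext; simp
          rw [Category.assoc, reassoc_of% h, e.hom_inv_id]
        inc_prj_ne := fun k l hkl => by
          have h : ModuleCat.ofHom (LinearMap.single Aᵐᵒᵖ (fun _ : Fin n => Aᵐᵒᵖ) k) ≫ ModuleCat.ofHom (LinearMap.proj l) = 0 := by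
            ext; simp [hkl]
          rw [Category.assoc, reassoc_of% h, zero_comp, comp_zero]
        total := by
          simp only [Category.assoc, e.inv_hom_id_assoc]
          refine ModuleCat.hom_ext (LinearMap.ext fun x => ?_)
          rw [ModuleCat.hom_sum, LinearMap.sum_apply]
          exact (Finset.univ_sum_single x) }
    have hn : S (F.obj (ModuleCat.of Aᵐᵒᵖ (Fin n → Aᵐᵒᵖ))) := (D.map F).prop S fun _ => hA
    have hfe : Epi (ModuleCat.ofHom f) := (ModuleCat.epi_iff_surjective _).2 hf
    let r : Retract X (ModuleCat.of Aᵐᵒᵖ (Fin n → Aᵐᵒᵖ)) :=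
      { i := Projective.factorThru (𝟙 X) (ModuleCat.ofHom f), r := ModuleCat.ofHom f
        retract := Projective.factorThru_comp _ _ }
    exact S.prop_of_retract (r.map F) hn
  obtain ⟨N, hN⟩ := hQ.bounded
  refine (prop_shift_iff Q N).1 ?_
  -- The complex has terms in the degrees from -N to N at most; shifted by N it ends in degree 0 and
  -- has at most 2N + 1 terms.
  refine prop_of_bounded (p := p) (fun X hX => (IsProjective.iff_projective X).1 hX.2) hF (2 * N + 1) _
    (fun i => ⟨hQ.finite _, hQ.projective _⟩) (fun i hi => hN (i + N) ?_) fun i hi => hN (i + N) ?_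
  · rw [lt_abs]; push_cast at hi; omega
  · rw [lt_abs]; omega

end Silted

namespace Silted
open CategoryTheory CategoryTheory.Limits MulOpposite

open ZeroObject

/-! ### The silted algebras in the lists -/

/-- A triple of two-term complexes yields a silted algebra. -/
theorem isSilted_of_triple {K : Type u} [Field K] {V : Type} [Fintype V] [DecidableEq V]
    {r R : V → V → Prop} (h : IsReach r R) (hR : RelBasis.IsPreord R) {k : Fin 6}
    (e : Fin 3 → Option V × Option V) (h₁ : ∀ i, IsValid R (e i)) (h₂ : ∀ i, CplxRel R (e i) (e i))
    (h₃ : ∀ i j l, CplxComp R (e i) (e j) (e l)) (h₄ : ∀ i j, CplxCompat R (e i) (e j))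
    (h₅ : ∀ i j, CplxRel R (e j) (e i) ↔ listRel k i j)
    (h₆ : ∀ Q : Option V → Prop, Q none → (∀ i, Q (e i).1 ↔ Q (e i).2) → ∀ v, Q (some v))
    {B : Type v} [Ring B] [Algebra K B] (f : B ≃ₐ[K] listSink K k) : IsSilted K (RelQuiver r) B := by
  let b := h.relBasis K
  have := Abelian.hasFiniteBiproducts (C := CochainComplex (RightMod (PathAlgebra K (RelQuiver r))) ℤ)
  let D := Decomp.biproduct fun i => b.cplx hR.refl (e i)
  let P := ⨁ fun i => b.cplx hR.refl (e i)
  let D' : Decomp (toHo P) fun i => b.ho hR (e i) := D.map (qHo _)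
  let H := b.homTableCplx hR e h₁ h₂ h₃
  obtain ⟨c⟩ := H.nonempty_relBasis D'
  let c' := c.congr h₅
  have hP : IsTwoTerm P := isTwoTerm_of_decomp D fun i => isZero_tw _
  have hρ : ∀ k, ∃ ρ : Fin 3 → Fin 3, ∀ i j, listRel k i j → i ≠ j → ρ i < ρ j := by decide
  obtain ⟨ρ, hρ⟩ := hρ k
  obtain ⟨g⟩ := nonempty_algEquiv_listSink c' (Equiv.refl _) fun _ _ => Iff.rfl
  refine ⟨P, ⟨isPerfect_of_decomp D fun i => b.isPerfect_cplx hR.refl _, fun n hn f => ?_,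
    fun S _ _ hS Q hQ => b.prop_of_prop_P hR.refl S ?_ hQ⟩, hP,
    isBasic_of_relBasis c' (listRel_refl k) (fun i => ρ i) hρ, ⟨f.trans g.symm⟩⟩
  · by_cases hn' : n = 1
    · subst hn'
      exact shift_eq_zero_of_decomp D' (fun i j => (b.shift_eq_zero_iff hR (h₁ i) (h₁ j)).2 (h₄ i j)) f
    · exact shift_eq_zero_of_isTwoTerm hP (by omega) f
  · have h0 : IsIso (0 : 0 ⟶ b.P' none) :=
      ⟨0, (isZero_zero _).eq_of_src _ _, b.isZero_P'.eq_of_src _ _⟩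
    -- The hypothesis `h₆` is generation in combinatorial form: each complex of the triple makes its
    -- two terms equivalent for membership in S, and starting from the zero module all projectives
    -- are reached.
    refine h₆ (fun j => S (toHo (st (b.P' j)))) (S.prop_of_isZero (isZero_tw_of_isIso _)) fun i => ?_
    have hi : S (b.ho hR (e i)) := S.prop_of_retract
      { i := D'.inc i, r := D'.prj i, retract := D'.inc_prj_self i } hS
    exact ⟨prop_st_of_tw' hi, prop_st_of_tw'' hi⟩

namespace RelBasis

/-- The first triple is the regular module. The last one is P 1 ⊕ P 2 ⊕ P 0[1], where the shifted
projective has no morphisms to or from the other two. -/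
theorem isSilted_linearA3 (K : Type u) [Field K] (k : Fin 5) {B : Type v} [Ring B] [Algebra K B]
    (f : B ≃ₐ[K] listSink K k.castSucc) : IsSilted K (RelQuiver linearA3) B := by
  revert k
  refine fun
    | 0 => fun f => ?_
    | 1 => fun f => ?_
    | 2 => fun f => ?_
    | 3 => fun f => ?_
    | 4 => fun f => ?_
  · refine isSilted_of_triple isReach_linearA3 isPreord_leA3
      ![(none, some 0), (none, some 1), (none, some 2)] (by decide) (by decide) (by decide)
      (by decide) (by decide) (fun Q h0 h => ?_) f
    simp [Fin.forall_fin_succ] at h ⊢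
    tauto
  · refine isSilted_of_triple isReach_linearA3 isPreord_leA3
      ![(none, some 0), (some 2, some 1), (none, some 1)] (by decide) (by decide) (by decide)
      (by decide) (by decide) (fun Q h0 h => ?_) f
    simp [Fin.forall_fin_succ] at h ⊢
    tauto
  · refine isSilted_of_triple isReach_linearA3 isPreord_leA3
      ![(none, some 0), (some 2, some 1), (some 2, some 0)] (by decide) (by decide) (by decide)
      (by decide) (by decide) (fun Q h0 h => ?_) f
    simp [Fin.forall_fin_succ] at h ⊢
    tauto
  · refine isSilted_of_triple isReach_linearA3 isPreord_leA3
      ![(some 1, some 0), (none, some 0), (none, some 2)] (by decide) (by decide) (by decide)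
      (by decide) (by decide) (fun Q h0 h => ?_) f
    simp [Fin.forall_fin_succ] at h ⊢
    tauto
  · refine isSilted_of_triple isReach_linearA3 isPreord_leA3
      ![(none, some 1), (none, some 2), (some 0, none)] (by decide) (by decide) (by decide)
      (by decide) (by decide) (fun Q h0 h => ?_) f
    simp [Fin.forall_fin_succ] at h ⊢
    tauto

/-- The triple for index 1 is the regular module. The last one is P 2 ⊕ P 0[1] ⊕ P 1[1], whose
summands have no nonzero morphisms between different ones; this is how three isolated points arise.
The complex with three indecomposable terms is not needed. -/
theorem isSilted_sinkA3 (K : Type u) [Field K] (k : Fin 6) {B : Type v} [Ring B] [Algebra K B]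
    (f : B ≃ₐ[K] listSink K k) : IsSilted K (RelQuiver sinkA3) B := by
  revert k
  refine fun
    | 0 => fun f => ?_
    | 1 => fun f => ?_
    | 2 => fun f => ?_
    | 3 => fun f => ?_
    | 4 => fun f => ?_
    | 5 => fun f => ?_
  · refine isSilted_of_triple isReach_sinkA3 isPreord_leSink
      ![(some 1, none), (some 2, none), (some 2, some 0)] (by decide) (by decide) (by decide)
      (by decide) (by decide) (fun Q h0 h => ?_) f
    simp [Fin.forall_fin_succ] at h ⊢
    tauto
  · refine isSilted_of_triple isReach_sinkA3 isPreord_leSink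
      ![(none, some 0), (none, some 1), (none, some 2)] (by decide) (by decide) (by decide)
      (by decide) (by decide) (fun Q h0 h => ?_) f
    simp [Fin.forall_fin_succ] at h ⊢
    tauto
  · refine isSilted_of_triple isReach_sinkA3 isPreord_leSink
      ![(some 2, some 0), (some 2, some 1), (some 2, none)] (by decide) (by decide) (by decide)
      (by decide) (by decide) (fun Q h0 h => ?_) f
    simp [Fin.forall_fin_succ] at h ⊢
    tauto
  · refine isSilted_of_triple isReach_sinkA3 isPreord_leSink
      ![(some 1, none), (some 2, some 0), (none, some 0)] (by decide) (by decide) (by decide)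
      (by decide) (by decide) (fun Q h0 h => ?_) f
    simp [Fin.forall_fin_succ] at h ⊢
    tauto
  · refine isSilted_of_triple isReach_sinkA3 isPreord_leSink
      ![(none, some 0), (none, some 2), (some 1, none)] (by decide) (by decide) (by decide)
      (by decide) (by decide) (fun Q h0 h => ?_) f
    simp [Fin.forall_fin_succ] at h ⊢
    tauto
  · refine isSilted_of_triple isReach_sinkA3 isPreord_leSink
      ![(none, some 2), (some 0, none), (some 1, none)] (by decide) (by decide) (by decide)
      (by decide) (by decide) (fun Q h0 h => ?_) f
    simp [Fin.forall_fin_succ] at h ⊢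
    tauto

end RelBasis

end Silted

namespace Silted
open CategoryTheory CategoryTheory.Limits MulOpposite

/-! ### The classification of silted algebras -/

namespace RelBasis

theorem isArtinianRing {K : Type u} [Field K] {V : Type} [Finite V] {R : V → V → Prop} {A : Type u} [Ring A] [Algebra K A]
    (b : RelBasis K R A) : IsArtinianRing Aᵐᵒᵖ := by
  have : Module.Finite K A := Module.Finite.of_basis b.basis
  exact IsArtinianRing.of_finite K Aᵐᵒᵖ

section

variable {K : Type u} [Field K] {R : Fin 3 → Fin 3 → Prop} {A : Type u} [Ring A] [Algebra K A]
  (b : RelBasis K R A) (hR : IsPreord R)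

/-- The endomorphism algebras of basic silting complexes, given the table of indecomposable
two-term complexes. -/
theorem exists_algEquiv_of_isSilting {ι : Type} [DecidableEq ι] (X : ι → HoCat A)
    {compat : ι → ι → Prop} {orth : ι → Finset (Fin 3) → Prop} {good : Fin 6 → Prop} (hX : ∀ i, ¬ IsZero (X i))
    (h₁ : ∀ i j, (∀ f : X i ⟶ (X j)⟦(1 : ℤ)⟧, f = 0) → compat i j)
    (h₂ : ∀ i t (ht : IsConvex R t), orth i t → IsOrth (toHo (st (b.thin hR ht))) (X i))
    (h₃ : ∀ s : Finset ι, (∀ i ∈ s, ∀ j ∈ s, compat i j) →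
      (∃ t : Finset (Fin 3), t.Nonempty ∧ IsConvex R t ∧ ∀ i ∈ s, orth i t) ∨
      ∃ (k : Fin 6) (e : Fin 3 → ι), good k ∧ Function.Injective e ∧ s = Finset.univ.image e ∧
        Nonempty (HomTable K (fun i => X (e i)) fun i j => listRel k j i))
    {P : CochainComplex (RightMod A) ℤ} (hP : IsSilting P) (hP' : IsBasic (toHo P)) {κ : Type} [Fintype κ] (a : κ → ι)
    (D : Decomp (toHo P) fun k => X (a k)) : ∃ k, good k ∧ Nonempty (End (toHo P) ≃ₐ[K] listSink K k) := by
  -- In a basic object no nonzero summand is repeated, so the complex is determined by the set of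
  -- its summands.
  have ha : Function.Injective a := fun k l hkl => by
    by_contra hne
    exact hX (a k) (D.isZero_of_isBasic hP' hne (eqToIso (by rw [hkl])))
  obtain ⟨t, ht, ht', ht''⟩ | ⟨k, e, hk, he, hs, ⟨H⟩⟩ := h₃ (Finset.univ.image a) (by
    intro i hi j hj
    obtain ⟨k, -, rfl⟩ := Finset.mem_image.1 hi
    obtain ⟨l, -, rfl⟩ := Finset.mem_image.1 hj
    refine h₁ _ _ fun f => ?_
    have h0 := hP.presilting 1 one_pos (D.prj k ≫ f ≫ (D.inc l)⟦(1 : ℤ)⟧')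
    have h1 : (D.inc k ≫ D.prj k) ≫ f ≫ ((D.inc l)⟦(1 : ℤ)⟧' ≫ (D.prj l)⟦(1 : ℤ)⟧') = 0 := by
      simp only [Category.assoc] at h0 ⊢
      rw [reassoc_of% h0]; simp
    rwa [← Functor.map_comp, D.inc_prj_self, D.inc_prj_self, CategoryTheory.Functor.map_id, Category.id_comp,
      Category.comp_id] at h1)
  · exact (b.false_of_isOrth ht' ht hP D fun k => h₂ _ t ht' (ht'' _ (by simp))).elim
  · have hc : ∀ i, ∃ k, a k = e i := fun i => by
      have : e i ∈ Finset.univ.image a := by rw [hs]; simp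
      simpa using this
    choose c hc using hc
    have hb : Function.Bijective c := by
      refine ⟨fun i j hij => he (by rw [← hc, ← hc, hij]), fun l => ?_⟩
      have : a l ∈ Finset.univ.image e := by rw [← hs]; simp
      obtain ⟨i, -, hi⟩ := Finset.mem_image.1 this
      exact ⟨i, ha ((hc i).trans hi)⟩
    let D' := (D.reindex (Equiv.ofBijective c hb)).congr fun i => eqToIso (congrArg X (hc i))
    obtain ⟨c'⟩ := H.nonempty_relBasis D'
    exact ⟨k, hk, nonempty_algEquiv_listSink c' (Equiv.refl _) fun _ _ => Iff.rfl⟩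

theorem not_isZero_ho {p : Option (Fin 3) × Option (Fin 3)} (hp : CplxRel R p p) : ¬ IsZero (b.ho hR p) := fun h =>
  b.hoU_ne_zero hR hp (h.eq_of_src _ _)

end

/-- The condition for `P j ⟶ P i` to be orthogonal to the thin module with support `t`. -/
abbrev CplxOrth (p : Option (Fin 3) × Option (Fin 3)) (t : Finset (Fin 3)) : Prop :=
  (∃ v ∈ p.1, v ∈ t) ↔ ∃ v ∈ p.2, v ∈ t

instance (R : Fin 3 → Fin 3 → Prop) [DecidableRel R] (t : Finset (Fin 3)) : Decidable (IsConvex R t) :=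
  inferInstanceAs (Decidable (∀ i j k, i ∈ t → k ∈ t → R i j → R j k → j ∈ t))

/-- The silting complexes over `0 → 1 → 2`. -/
def clusterLinear : Fin 14 → Fin 6 × (Fin 3 → Fin 9) :=
  ![(0, ![0, 1, 2]), (1, ![0, 5, 1]), (3, ![3, 0, 2]), (0, ![3, 4, 0]), (2, ![0, 5, 4]), (4, ![1, 2, 6]),
    (4, ![5, 1, 6]), (4, ![7, 3, 2]), (4, ![6, 7, 2]), (1, ![3, 8, 4]), (2, ![3, 8, 7]), (0, ![8, 4, 5]),
    (3, ![6, 8, 5]), (0, ![6, 7, 8])]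

/-- An exhaustive check of the 512 subsets. A compatible set that is not one of the 14 listed
triples is orthogonal to a thin module and cannot generate. -/
theorem orth_or_exists_clusterLinear : ∀ s : Finset (Fin 9),
    (∀ i ∈ s, ∀ j ∈ s, CplxCompat leA3 (indecLinear i) (indecLinear j)) →
      (∃ t : Finset (Fin 3), t.Nonempty ∧ IsConvex leA3 t ∧ ∀ i ∈ s, CplxOrth (indecLinear i) t) ∨
      ∃ n, s = Finset.univ.image (clusterLinear n).2 := by
  decide +kernel

end RelBasis

end Silted

/-! ### The silted algebras of type `0 → 1 → 2` -/

namespace Silted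
open CategoryTheory CategoryTheory.Limits MulOpposite

/-- Replacing the relation of a table of homomorphisms by an equivalent one. -/
def HomTable.congr {K : Type u} [Field K] {C : Type v} [Category.{w} C] [Preadditive C] [Linear K C]
    {κ : Type} {X : κ → C} {R R' : κ → κ → Prop} (H : HomTable K X R) (h : ∀ k l, R k l ↔ R' k l) :
    HomTable K X R' where
  f := H.f
  span := H.span
  zero k l hkl := H.zero k l fun h' => hkl ((h k l).1 h')
  ne_zero k l hkl := H.ne_zero k l ((h k l).2 hkl)
  id := H.id
  comp j k l h₁ h₂ h₃ := H.comp j k l ((h j k).2 h₁) ((h k l).2 h₂) ((h j l).2 h₃)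

namespace RelBasis

/-- Every two-term silting complex is a direct sum of complexes in a given list. -/
theorem exists_decomp {K : Type u} [Field K] {V : Type} [Finite V] {R : V → V → Prop} {A : Type u} [Ring A] [Algebra K A]
    (b : RelBasis K R A) {ι : Type} (δ : ι → CochainComplex (RightMod A) ℤ) (hδ : ∀ i, ¬ IsZero (δ i))
    (h₁ : ∀ {Y X M : RightMod A} [Projective X] (d : Y ⟶ X) (π : X ⟶ M) (w' : d ≫ π = 0)
      (_ : (ShortComplex.mk d π w').Exact) [Epi π], ¬ IsZero M → ∃ i, Nonempty (Retract (δ i) (tw d)))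
    (h₂ : ∀ {Y X : RightMod A} [Projective X] (d : Y ⟶ X) [Epi d] (i), Retract (δ i) (st (kernel d)) →
      ∃ i, Nonempty (Retract (δ i) (tw d)))
    {P : CochainComplex (RightMod A) ℤ} (hP : IsPerfect P) (hP' : IsTwoTerm P) :
    ∃ (κ : Type) (_ : Fintype κ) (a : κ → ι), Nonempty (Decomp (toHo P) fun k => toHo (δ (a k))) := by
  have := b.isArtinianRing
  obtain ⟨n, hn⟩ := twoTermLength_ne_top hP
  exact exists_decomp_of_retract δ hδ (isZero_or_exists_retract δ h₁ h₂) n P hP hP' hn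

theorem indecLinear_table : (∀ k, IsValid leA3 (indecLinear k)) ∧ (∀ k, CplxRel leA3 (indecLinear k) (indecLinear k)) ∧
    ∀ k l m, CplxComp leA3 (indecLinear k) (indecLinear l) (indecLinear m) := by
  decide +kernel

theorem clusterLinear_table : ∀ n, (∃ k : Fin 5, k.castSucc = (clusterLinear n).1) ∧
    Function.Injective (clusterLinear n).2 ∧ ∀ i j,
      CplxRel leA3 (indecLinear ((clusterLinear n).2 i)) (indecLinear ((clusterLinear n).2 j)) ↔
        listRel (clusterLinear n).1 j i := by
  unfold Function.Injective
  decide +kernel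

theorem exists_algEquiv_of_isSilted_linearA3 {K : Type u} [Field K] {B : Type v} [Ring B] [Algebra K B]
    (h : IsSilted K (RelQuiver linearA3) B) : ∃ k : Fin 5, Nonempty (B ≃ₐ[K] listSink K k.castSucc) := by
  obtain ⟨P, hP, hP', hP'', ⟨f⟩⟩ := h
  let b : RelBasis K leA3 (PathAlgebra K (RelQuiver linearA3)) := isReach_linearA3.relBasis K
  have hR := isPreord_leA3
  obtain ⟨κ, _, a, ⟨D⟩⟩ := b.exists_decomp (fun i => b.cplx hR.refl (indecLinear i))
    (fun i => b.not_isZero_cplx hR.refl (by revert i; decide)) (b.exists_retract_linear)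
    (b.exists_retract_of_retract_st hR.refl _ (by decide) (by decide)) hP.perfect hP'
  obtain ⟨ht₁, ht₂, ht₃⟩ := indecLinear_table
  obtain ⟨k, ⟨k, rfl⟩, ⟨g⟩⟩ := b.exists_algEquiv_of_isSilting hR (fun i => b.ho hR (indecLinear i))
    (compat := fun i j => CplxCompat leA3 (indecLinear i) (indecLinear j))
    (orth := fun i t => CplxOrth (indecLinear i) t) (good := fun k => ∃ l : Fin 5, l.castSucc = k)
    (fun i => b.not_isZero_ho hR (ht₂ i)) (fun i j => (b.shift_eq_zero_iff hR (ht₁ i) (ht₁ j)).1)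
    (fun i t ht h => b.isOrth_cplx ht (ht₁ i) h)
    (fun s hs => (orth_or_exists_clusterLinear s hs).imp id fun ⟨n, hn⟩ => by
      obtain ⟨h₁, h₂, h₃⟩ := clusterLinear_table n
      exact ⟨_, _, h₁, h₂, hn, ⟨((b.homTableCplx hR _ ht₁ ht₂ ht₃).comap _).congr h₃⟩⟩)
    hP hP'' a D
  exact ⟨k, ⟨f.trans g⟩⟩

end RelBasis

end Silted

/-! ### Morphisms to and from the complex P 2 → P 0 ⊕ P 1 -/

namespace Silted
open CategoryTheory CategoryTheory.Limits MulOpposite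

/-- The extension of a table of homomorphisms by an object `N`. -/
def HomTable.extend {K : Type u} [Field K] {C : Type v} [Category.{w} C] [Preadditive C] [Linear K C]
    {κ : Type} {X : Option κ → C} {R : κ → κ → Prop} (H : HomTable K (fun k => X (some k)) R)
    {R' : Option κ → Option κ → Prop} (hR : ∀ k l, R k l ↔ R' (some k) (some l)) (hR' : R' none none)
    (i : ∀ k, X (some k) ⟶ X none) (p : ∀ k, X none ⟶ X (some k))
    (i_span : ∀ k (φ : X (some k) ⟶ X none), ∃ c : K, φ = c • i k)
    (p_span : ∀ k (φ : X none ⟶ X (some k)), ∃ c : K, φ = c • p k)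
    (i_zero : ∀ k, ¬ R' (some k) none → i k = 0) (p_zero : ∀ k, ¬ R' none (some k) → p k = 0)
    (i_ne_zero : ∀ k, R' (some k) none → i k ≠ 0) (p_ne_zero : ∀ k, R' none (some k) → p k ≠ 0)
    (id_span : ∀ φ : X none ⟶ X none, ∃ c : K, φ = c • 𝟙 (X none)) (id_ne_zero : 𝟙 (X none) ≠ 0)
    (hi : ∀ k l, R' (some k) (some l) → R' (some l) none → k = l)
    (hp : ∀ k l, R' (some k) (some l) → R' none (some k) → k = l)
    (hip : ∀ k, R' (some k) none → ¬ R' none (some k))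
    (i_comp : ∀ k l, R' (some k) none → R' none (some l) → R' (some k) (some l) → i k ≫ p l = H.f k l) :
    HomTable K X R' where
  f
    | none, none => 𝟙 _
    | none, some l => p l
    | some k, none => i k
    | some k, some l => H.f k l
  span
    | none, none => id_span
    | none, some l => p_span l
    | some k, none => i_span k
    | some k, some l => H.span k l
  zero
    | none, none => fun h => absurd hR' h
    | none, some l => p_zero l
    | some k, none => i_zero k
    | some k, some l => fun h => H.zero k l fun h' => h ((hR k l).1 h')
  ne_zero
    | none, none => fun _ => id_ne_zero
    | none, some l => p_ne_zero l
    | some k, none => i_ne_zero k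
    | some k, some l => fun h => H.ne_zero k l ((hR k l).2 h)
  id
    | none => rfl
    | some k => H.id k
  comp
    | none, none, _ => fun _ _ _ => Category.id_comp _
    | none, some k, none => fun h h' _ => absurd h (hip k h')
    | some _, none, none => fun _ _ _ => Category.comp_id _
    | some k, none, some l => i_comp k l
    | some k, some l, none => fun h h' _ => by
      obtain rfl := hi k l h h'
      exact (congrArg (· ≫ i k) (H.id k)).trans (Category.id_comp _)
    | none, some k, some l => fun h h' _ => by
      obtain rfl := hp k l h' h
      exact (congrArg (p k ≫ ·) (H.id k)).trans (Category.comp_id _)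
    | some j, some k, some l => fun h h' h'' =>
      H.comp j k l ((hR j k).2 h) ((hR k l).2 h') ((hR j l).2 h'')

namespace RelBasis

variable {K : Type u} [Field K] {A : Type u} [Ring A] [Algebra K A] (b : RelBasis K leSink A)

/-- The projective module in degree zero of the complex with three indecomposable terms. -/
noncomputable def decompN : Decomp (b.P 0 ⊞ b.P 1) fun c : Fin 2 => b.P c.castSucc where
  inc
    | 0 => (biprod.inl : b.P 0 ⟶ _)
    | 1 => (biprod.inr : b.P 1 ⟶ _)
  prj
    | 0 => (biprod.fst : _ ⟶ b.P 0)
    | 1 => (biprod.snd : _ ⟶ b.P 1)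
  inc_prj_self
    | 0 => biprod.inl_fst
    | 1 => biprod.inr_snd
  inc_prj_ne
    | 0, 0, h => absurd rfl h
    | 0, 1, _ => biprod.inl_snd
    | 1, 0, _ => biprod.inr_fst
    | 1, 1, h => absurd rfl h
  total := by
    rw [Fin.sum_univ_two]
    exact biprod.total

theorem decompN_hom_ext {Y : RightMod A} {f g : Y ⟶ b.P 0 ⊞ b.P 1}
    (h : ∀ c, f ≫ b.decompN.prj c = g ≫ b.decompN.prj c) : f = g := biprod.hom_ext _ _ (h 0) (h 1)

theorem dN_prj : ∀ c : Fin 2, b.dN ≫ b.decompN.prj c = b.u isPreord_leSink.refl 2 c.castSucc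
  | 0 => biprod.lift_fst _ _
  | 1 => biprod.lift_snd _ _

theorem u_castSucc_ne {c c' : Fin 2} (h : c ≠ c') : b.u isPreord_leSink.refl c.castSucc c'.castSucc = 0 :=
  b.u_of_not _ (by revert c c'; decide)

theorem u_two_ne_zero (c : Fin 2) : b.u isPreord_leSink.refl 2 c.castSucc ≠ 0 :=
  b.u_ne_zero _ (by revert c; decide)

theorem smul_u_two {c : Fin 2} {α β : K}
    (h : α • b.u isPreord_leSink.refl 2 c.castSucc = β • b.u isPreord_leSink.refl 2 c.castSucc) : α = β :=
  smul_left_injective K (b.u_two_ne_zero c) h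

theorem hom_P_two_eq_zero {c : Fin 2} (f : b.P c.castSucc ⟶ b.P 2) : f = 0 := by
  obtain ⟨α, rfl⟩ := b.u_span isPreord_leSink.refl f
  rw [b.u_of_not _ (by revert c; decide), smul_zero]

theorem hom_decompN_eq_zero (f : b.P 0 ⊞ b.P 1 ⟶ b.P 2) : f = 0 :=
  b.decompN.hom_ext fun c => by rw [comp_zero]; exact b.hom_P_two_eq_zero _

theorem exists_smul_id (c : Fin 2) (f : b.P c.castSucc ⟶ b.P c.castSucc) : ∃ α : K, f = α • 𝟙 _ := by
  obtain ⟨α, rfl⟩ := b.u_span isPreord_leSink.refl f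
  exact ⟨α, by rw [b.u_self]⟩

theorem exists_smul_id_two (f : b.P 2 ⟶ b.P 2) : ∃ α : K, f = α • 𝟙 _ := by
  obtain ⟨α, rfl⟩ := b.u_span isPreord_leSink.refl f
  exact ⟨α, by rw [b.u_self]⟩

theorem hom_castSucc_eq_zero {c c' : Fin 2} (h : c ≠ c') (f : b.P c.castSucc ⟶ b.P c'.castSucc) : f = 0 := by
  obtain ⟨α, rfl⟩ := b.u_span isPreord_leSink.refl f
  rw [b.u_castSucc_ne h, smul_zero]

theorem exists_smul_inc (c : Fin 2) (f : b.P c.castSucc ⟶ b.P 0 ⊞ b.P 1) : ∃ α : K, f = α • b.decompN.inc c := by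
  obtain ⟨α, hα⟩ := b.exists_smul_id c (f ≫ b.decompN.prj c)
  refine ⟨α, b.decompN_hom_ext fun c' => ?_⟩
  by_cases h : c = c'
  · subst h
    rw [hα, Linear.smul_comp, b.decompN.inc_prj_self]
  · rw [b.hom_castSucc_eq_zero h (f ≫ _), Linear.smul_comp, b.decompN.inc_prj_ne _ _ h, smul_zero]

theorem exists_smul_prj (c : Fin 2) (f : b.P 0 ⊞ b.P 1 ⟶ b.P c.castSucc) : ∃ α : K, f = α • b.decompN.prj c := by
  obtain ⟨α, hα⟩ := b.exists_smul_id c (b.decompN.inc c ≫ f)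
  refine ⟨α, b.decompN.hom_ext fun c' => ?_⟩
  by_cases h : c' = c
  · subst h
    rw [hα, Linear.comp_smul, b.decompN.inc_prj_self]
  · rw [b.hom_castSucc_eq_zero h (_ ≫ f), Linear.comp_smul, b.decompN.inc_prj_ne _ _ h, smul_zero]

/-- The complex with three indecomposable terms, in the homotopy category. -/
noncomputable abbrev hoN : HoCat A := toHo (tw b.dN)

/-- The complex `P c`, in the homotopy category. -/
noncomputable abbrev hoP (c : Fin 2) : HoCat A := toHo (tw (0 : b.P' none ⟶ b.P c.castSucc))

/-- The complex `P 2 ⟶ P c`, in the homotopy category. -/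
noncomputable abbrev hoS (c : Fin 2) : HoCat A := toHo (tw (b.u isPreord_leSink.refl 2 c.castSucc))

theorem id_hoN_ne_zero : 𝟙 b.hoN ≠ 0 := fun h => by
  rw [← hoHom_id, hoHom_eq_zero_iff] at h
  obtain ⟨s, h1, -⟩ := h
  rw [b.hom_decompN_eq_zero s, comp_zero] at h1
  exact b.id_P_ne_zero isPreord_leSink.refl _ h1

/-- On each of the three indecomposable terms an endomorphism is a scalar; commutativity along the
nonzero maps P 2 → P c makes the scalars equal. -/
theorem hoN_span (φ : b.hoN ⟶ b.hoN) : ∃ α : K, φ = α • 𝟙 b.hoN := by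
  obtain ⟨x, y, h, rfl⟩ := exists_hoHom φ
  obtain ⟨α, rfl⟩ := b.exists_smul_id_two x
  refine ⟨α, ?_⟩
  rw [← hoHom_id, smul_hoHom]
  refine hoHom_congr _ rfl (b.decompN_hom_ext fun c => ?_)
  obtain ⟨β, hβ⟩ := b.exists_smul_prj c (y ≫ b.decompN.prj c)
  have h1 := congrArg (· ≫ b.decompN.prj c) h
  simp only [Category.assoc, Linear.smul_comp, Linear.comp_smul, Category.id_comp, hβ, dN_prj] at h1
  rw [hβ, b.smul_u_two h1, Linear.smul_comp, Category.id_comp]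

/-- The canonical morphism from `P c`. -/
noncomputable def incN (c : Fin 2) : b.hoP c ⟶ b.hoN :=
  hoHom 0 (b.decompN.inc c) (b.isZero_P'.eq_of_src _ _)

/-- The canonical morphism to `P 2 ⟶ P c`. -/
noncomputable def prjN (c : Fin 2) : b.hoN ⟶ b.hoS c :=
  hoHom (𝟙 _) (b.decompN.prj c) (by rw [dN_prj, Category.id_comp])

theorem incN_span (c : Fin 2) (φ : b.hoP c ⟶ b.hoN) :
    ∃ α : K, φ = α • b.incN c := by
  obtain ⟨x, y, h, rfl⟩ := exists_hoHom φ
  obtain ⟨α, rfl⟩ := b.exists_smul_inc c y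
  refine ⟨α, ?_⟩
  rw [incN, smul_hoHom]
  exact hoHom_congr _ (b.isZero_P'.eq_of_src _ _) rfl

theorem prjN_span (c : Fin 2) (φ : b.hoN ⟶ b.hoS c) :
    ∃ α : K, φ = α • b.prjN c := by
  obtain ⟨x, y, h, rfl⟩ := exists_hoHom φ
  obtain ⟨α, rfl⟩ := b.exists_smul_id_two x
  obtain ⟨β, rfl⟩ := b.exists_smul_prj c y
  refine ⟨α, ?_⟩
  rw [prjN, smul_hoHom]
  refine hoHom_congr _ rfl ?_
  have h1 : β • b.u isPreord_leSink.refl 2 c.castSucc = α • b.u isPreord_leSink.refl 2 c.castSucc := by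
    rw [← dN_prj, ← Linear.comp_smul, h, Linear.smul_comp, Category.id_comp, dN_prj]
  rw [b.smul_u_two h1]

theorem incN_ne_zero (c : Fin 2) : b.incN c ≠ 0 := fun h => by
  obtain ⟨s, -, h1⟩ := (hoHom_eq_zero_iff _ _ _).1 h
  rw [b.hom_P_two_eq_zero (c := c) s, zero_comp] at h1
  have h2 := b.decompN.inc_prj_self c
  rw [h1, zero_comp] at h2
  exact b.id_P_ne_zero isPreord_leSink.refl _ h2.symm

theorem prjN_ne_zero (c : Fin 2) : b.prjN c ≠ 0 := fun h => by
  obtain ⟨s, h1, -⟩ := (hoHom_eq_zero_iff _ _ _).1 h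
  rw [b.hom_decompN_eq_zero s, comp_zero] at h1
  exact b.id_P_ne_zero isPreord_leSink.refl _ h1

/-- The component in degree 0 lands in one summand only. Comparing the projections to the other
summand kills the scalar in degree -1, and then the projection to the same summand kills the
remaining scalar. -/
theorem hom_hoN_eq_zero (c : Fin 2) (φ : b.hoS c ⟶ b.hoN) : φ = 0 := by
  obtain ⟨x, y, h, rfl⟩ := exists_hoHom φ
  obtain ⟨α, rfl⟩ := b.exists_smul_id_two x
  obtain ⟨β, rfl⟩ := b.exists_smul_inc c y
  have h' : b.u isPreord_leSink.refl 2 c.castSucc ≫ (β • b.decompN.inc c) = (α • 𝟙 (b.P 2)) ≫ b.dN := h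
  have h1 : ∀ c', β • b.u isPreord_leSink.refl 2 c.castSucc ≫ b.decompN.inc c ≫ b.decompN.prj c' =
      α • b.u isPreord_leSink.refl 2 c'.castSucc := fun c' => by
    have h2 := congrArg (· ≫ b.decompN.prj c') h'
    simpa only [Category.assoc, Linear.smul_comp, Linear.comp_smul, Category.id_comp, dN_prj] using h2
  obtain ⟨c', hc'⟩ := exists_ne c
  have hα := h1 c'
  rw [b.decompN.inc_prj_ne _ _ hc'.symm, comp_zero, smul_zero] at hα
  obtain rfl := (smul_eq_zero.1 hα.symm).resolve_right (b.u_two_ne_zero c')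
  have hβ := h1 c
  rw [b.decompN.inc_prj_self, Category.comp_id] at hβ
  obtain rfl := b.smul_u_two hβ
  rw [hoHom_eq_zero_iff]
  exact ⟨0, by rw [zero_smul, comp_zero], by rw [zero_smul, zero_comp]⟩

theorem hoN_hom_eq_zero (c : Fin 2) (φ : b.hoN ⟶ b.hoP c) : φ = 0 := by
  obtain ⟨x, y, h, rfl⟩ := exists_hoHom φ
  obtain ⟨β, rfl⟩ := b.exists_smul_prj c y
  have h' : b.dN ≫ (β • b.decompN.prj c) = 0 := h.trans (by
    rw [b.isZero_P'.eq_of_tgt x 0, zero_comp])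
  rw [Linear.comp_smul, dN_prj] at h'
  obtain rfl := (smul_eq_zero.1 h').resolve_right (b.u_two_ne_zero c)
  rw [hoHom_eq_zero_iff]
  exact ⟨0, b.isZero_P'.eq_of_tgt _ _, by rw [zero_smul, zero_comp]⟩

/-- The only nontrivial composition through the exceptional complex: the canonical morphism from P c
to P 2 → P c factors through it. This is what makes the corresponding silting triples linear. -/
theorem incN_comp_prjN (c : Fin 2) :
    b.incN c ≫ b.prjN c = b.hoU isPreord_leSink (none, some c.castSucc) (some 2, some c.castSucc) := by
  have h1 : b.incN c ≫ b.prjN c = hoHom 0 (𝟙 (b.P c.castSucc)) (b.isZero_P'.eq_of_src _ _) := by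
    rw [incN, prjN, hoHom_comp]
    exact hoHom_congr _ (b.isZero_P'.eq_of_src _ _) (b.decompN.inc_prj_self c)
  have h2 : ∀ c : Fin 2, CplxRel leSink (none, some c.castSucc) (some 2, some c.castSucc) := by decide
  rw [b.hoU_of_rel _ (h2 c)]
  exact h1.trans (hoHom_congr _ rfl (b.u'_self isPreord_leSink.refl (some c.castSucc)).symm)

end RelBasis

end Silted

/-! ### The silted algebras of type `0 → 2 ← 1` -/

namespace Silted
open CategoryTheory CategoryTheory.Limits MulOpposite

namespace RelBasis

/-- The complexes `P c` and `P 2 ⟶ P c`. -/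
def sidePair : Fin 2 ⊕ Fin 2 → Option (Fin 3) × Option (Fin 3)
  | .inl c => (none, some c.castSucc)
  | .inr c => (some 2, some c.castSucc)

/-- The positions of the complexes `P c` and `P 2 ⟶ P c` in the list. -/
def sideIndex : Fin 2 ⊕ Fin 2 → Fin 8
  | .inl c => c.castLE (by decide)
  | .inr c => (c.natAdd 3).castLE (by decide)

theorem indecSink_sideIndex : ∀ k, indecSink (sideIndex k) = sidePair k := by decide

/-- There are nonzero morphisms between the complexes. -/
def SideRel : Option (Fin 2 ⊕ Fin 2) → Option (Fin 2 ⊕ Fin 2) → Prop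
  | none, none => True
  | none, some k => k.isRight
  | some k, none => k.isLeft
  | some k, some l => CplxRel leSink (sidePair k) (sidePair l)

instance : DecidableRel SideRel
  | none, none => inferInstanceAs (Decidable True)
  | none, some k => inferInstanceAs (Decidable (k.isRight = true))
  | some k, none => inferInstanceAs (Decidable (k.isLeft = true))
  | some k, some l => inferInstanceAs (Decidable (CplxRel leSink (sidePair k) (sidePair l)))

/-- There are no nonzero morphisms to the shift. -/
def SinkCompat : Option (Fin 8) → Option (Fin 8) → Prop
  | none, none => True
  | none, some i => i ≠ 2
  | some i, none => i ≠ 5 ∧ i ≠ 6 ∧ i ≠ 7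
  | some i, some j => CplxCompat leSink (indecSink i) (indecSink j)

instance : DecidableRel SinkCompat
  | none, none => inferInstanceAs (Decidable True)
  | none, some i => inferInstanceAs (Decidable (i ≠ 2))
  | some i, none => inferInstanceAs (Decidable (i ≠ 5 ∧ i ≠ 6 ∧ i ≠ 7))
  | some i, some j => inferInstanceAs (Decidable (CplxCompat leSink (indecSink i) (indecSink j)))

/-- A condition for the complexes to be orthogonal to the thin module with support `t`. -/
def SinkOrth : Option (Fin 8) → Finset (Fin 3) → Prop
  | none, t => 2 ∈ t ∧ (0 ∈ t ↔ 1 ∉ t)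
  | some i, t => CplxOrth (indecSink i) t

instance : ∀ o t, Decidable (SinkOrth o t)
  | none, t => inferInstanceAs (Decidable (2 ∈ t ∧ (0 ∈ t ↔ 1 ∉ t)))
  | some i, t => inferInstanceAs (Decidable (CplxOrth (indecSink i) t))

/-- The silting complexes over `0 → 2 ← 1` with at most two terms in each summand. -/
def clusterSink : Fin 10 → Fin 6 × (Fin 3 → Fin 8) :=
  ![(1, ![0, 1, 2]), (4, ![0, 2, 6]), (3, ![6, 3, 0]), (4, ![1, 2, 5]), (3, ![5, 4, 1]), (5, ![2, 5, 6]),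
    (2, ![3, 4, 7]), (0, ![6, 7, 3]), (0, ![5, 7, 4]), (1, ![5, 6, 7])]

/-- The other silting complexes over `0 → 2 ← 1`. -/
def clusterSide : Fin 4 → Fin 6 × (Fin 3 → Option (Fin 2 ⊕ Fin 2)) :=
  ![(2, ![some (.inl 0), some (.inl 1), none]), (0, ![some (.inr 0), none, some (.inl 0)]),
    (0, ![some (.inr 1), none, some (.inl 1)]), (1, ![some (.inr 0), some (.inr 1), none])]

/-- The same exhaustive check on nine objects. There are again 14 triples, four of which contain the
exceptional complex. -/
theorem orth_or_exists_clusterSink : ∀ s : Finset (Option (Fin 8)), (∀ i ∈ s, ∀ j ∈ s, SinkCompat i j) →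
    (∃ t : Finset (Fin 3), t.Nonempty ∧ IsConvex leSink t ∧ ∀ i ∈ s, SinkOrth i t) ∨
      (∃ n, s = Finset.univ.image fun k => some ((clusterSink n).2 k)) ∨
      ∃ n, s = Finset.univ.image fun k => ((clusterSide n).2 k).map sideIndex := by
  decide +kernel

theorem indecSink_table : (∀ k, IsValid leSink (indecSink k)) ∧ (∀ k, CplxRel leSink (indecSink k) (indecSink k)) ∧
    ∀ k l m, CplxComp leSink (indecSink k) (indecSink l) (indecSink m) := by
  decide +kernel

theorem sidePair_table : (∀ k, IsValid leSink (sidePair k)) ∧ (∀ k, CplxRel leSink (sidePair k) (sidePair k)) ∧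
    ∀ k l m, CplxComp leSink (sidePair k) (sidePair l) (sidePair m) := by
  decide +kernel

theorem clusterSink_table : ∀ n, Function.Injective (clusterSink n).2 ∧ ∀ i j,
      CplxRel leSink (indecSink ((clusterSink n).2 i)) (indecSink ((clusterSink n).2 j)) ↔
        listRel (clusterSink n).1 j i := by
  unfold Function.Injective
  decide +kernel

theorem clusterSide_table : ∀ n, (∀ i j, ((clusterSide n).2 i).map sideIndex = ((clusterSide n).2 j).map sideIndex → i = j) ∧
    ∀ i j, SideRel ((clusterSide n).2 i) ((clusterSide n).2 j) ↔ listRel (clusterSide n).1 j i := by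
  decide +kernel

variable {K : Type u} [Field K] {A : Type u} [Ring A] [Algebra K A] (b : RelBasis K leSink A)

/-- The complexes in the homotopy category. -/
noncomputable def hoSide : Option (Fin 2 ⊕ Fin 2) → HoCat A
  | none => b.hoN
  | some k => b.ho isPreord_leSink (sidePair k)

theorem toHo_cplxSink_map : ∀ o : Option (Fin 2 ⊕ Fin 2), toHo (b.cplxSink (o.map sideIndex)) = b.hoSide o
  | none => rfl
  | some k => congrArg (b.ho isPreord_leSink) (indecSink_sideIndex k)

/-- The table of homomorphisms between the complexes. -/
noncomputable def homTableSide : HomTable K b.hoSide SideRel :=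
  (b.homTableCplx isPreord_leSink sidePair sidePair_table.1 sidePair_table.2.1 sidePair_table.2.2).extend
    (fun _ _ => Iff.rfl) trivial
    (fun | .inl c => b.incN c | .inr _ => 0)
    (fun | .inl _ => 0 | .inr c => b.prjN c)
    (fun
      | .inl c => b.incN_span c
      | .inr c => fun φ => ⟨0, (b.hom_hoN_eq_zero c φ).trans (zero_smul K _).symm⟩)
    (fun
      | .inl c => fun φ => ⟨0, (b.hoN_hom_eq_zero c φ).trans (zero_smul K _).symm⟩
      | .inr c => b.prjN_span c)
    (fun
      | .inl _ => fun h => absurd rfl h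
      | .inr _ => fun _ => rfl)
    (fun
      | .inl _ => fun _ => rfl
      | .inr _ => fun h => absurd rfl h)
    (fun
      | .inl c => fun _ => b.incN_ne_zero c
      | .inr _ => fun h => absurd h Bool.false_ne_true)
    (fun
      | .inl _ => fun h => absurd h Bool.false_ne_true
      | .inr c => fun _ => b.prjN_ne_zero c)
    b.hoN_span b.id_hoN_ne_zero (by decide) (by decide) (by decide)
    (fun
      | .inl c, .inr c', _, _, h => by
        obtain rfl : c = c' := by revert c c'; decide
        exact b.incN_comp_prjN c)

theorem not_isZero_cplxSink : ∀ o, ¬ IsZero (toHo (b.cplxSink o))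
  | none => fun h => b.id_hoN_ne_zero (h.eq_of_src _ _)
  | some i => b.not_isZero_ho isPreord_leSink (indecSink_table.2.1 i)

/-- For the exceptional complex it suffices to exhibit a nonzero morphism to the shift in each
excluded case. Maps from P 2 do not extend to P 0 ⊕ P 1, since there are no nonzero maps from there
to P 2. For the shifted projectives, an inclusion of P 0 or P 1, or P 2 → P 0 alone, does not factor
through the differential. -/
theorem sinkCompat : ∀ i j, (∀ f : toHo (b.cplxSink i) ⟶ (toHo (b.cplxSink j))⟦(1 : ℤ)⟧, f = 0) → SinkCompat i j
  | none, none => fun _ => trivial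
  | none, some j => fun h hj => by
    subst hj
    obtain ⟨s, t, hst⟩ := (tw_shift_one_iff (d := b.dN)
      (d' := b.u' isPreord_leSink.refl none (some 2))).1 h (𝟙 (b.P 2))
    rw [b.isZero_P'.eq_of_tgt s 0, zero_comp, zero_add] at hst
    refine b.id_P_ne_zero isPreord_leSink.refl 2 (hst.trans ?_)
    exact (congrArg (b.dN ≫ ·) (b.hom_decompN_eq_zero t)).trans comp_zero
  | some i, none => fun h => by
    have key : ∀ (j : Fin 3) (f : b.P j ⟶ b.P 0 ⊞ b.P 1), indecSink i = (some j, none) →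
        ∃ s : b.P j ⟶ b.P 2, f = s ≫ b.dN := fun j f hi => by
      change ∀ φ : b.ho isPreord_leSink (indecSink i) ⟶ b.hoN⟦(1 : ℤ)⟧, φ = 0 at h
      rw [hi] at h
      obtain ⟨s, t, hst⟩ := (tw_shift_one_iff (d := b.u' isPreord_leSink.refl (some j) none) (d' := b.dN)).1 h f
      refine ⟨s, hst.trans ?_⟩
      rw [b.isZero_P'.eq_of_src t 0, comp_zero, add_zero]
      rfl
    have key' : ∀ c : Fin 2, indecSink i ≠ (some c.castSucc, none) := fun c hi => by
      obtain ⟨s, hs⟩ := key _ (b.decompN.inc c) hi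
      have h1 := b.decompN.inc_prj_self c
      rw [hs, b.hom_P_two_eq_zero s, zero_comp, zero_comp] at h1
      exact b.id_P_ne_zero isPreord_leSink.refl _ h1.symm
    refine ⟨fun hi => key' 0 (by rw [hi]; rfl), fun hi => key' 1 (by rw [hi]; rfl), fun hi => ?_⟩
    obtain ⟨s, hs⟩ := key 2 (b.u isPreord_leSink.refl 2 (Fin.castSucc 0) ≫ b.decompN.inc 0) (by rw [hi]; rfl)
    obtain ⟨α, rfl⟩ := b.exists_smul_id_two s
    have h1 : ∀ c, b.u isPreord_leSink.refl 2 (Fin.castSucc 0) ≫ b.decompN.inc 0 ≫ b.decompN.prj c =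
        α • b.u isPreord_leSink.refl 2 c.castSucc := fun c => by
      rw [reassoc_of% hs, dN_prj, Linear.smul_comp, Category.id_comp]
    have h2 := h1 1
    rw [b.decompN.inc_prj_ne 0 1 (by decide), comp_zero] at h2
    obtain rfl := (smul_eq_zero.1 h2.symm).resolve_right (b.u_two_ne_zero 1)
    have h3 := h1 0
    rw [b.decompN.inc_prj_self, Category.comp_id, zero_smul] at h3
    exact b.u_two_ne_zero 0 h3
  | some i, some j => (b.shift_eq_zero_iff isPreord_leSink (indecSink_table.1 i) (indecSink_table.1 j)).1

/-- If exactly one of 0 and 1 lies in the support together with 2, both terms of the exceptional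
complex have a one-dimensional Hom space to the thin module, and the differential identifies the
two. -/
theorem isOrth_dN {t : Finset (Fin 3)} (ht : IsConvex leSink t) (h2 : 2 ∈ t) {c : Fin 2} (hc : c.castSucc ∈ t)
    (hc' : ∀ c' ≠ c, Fin.castSucc c' ∉ t) : IsOrth (toHo (st (b.thin isPreord_leSink ht))) b.hoN := by
  have hu := b.u_comp_projThin (hR := isPreord_leSink) ht hc h2 (Or.inr rfl)
  refine isOrth_tw _ (fun y hy => ?_) fun x => ?_
  · obtain ⟨α, hα⟩ := b.projThin_span isPreord_leSink ht hc (b.decompN.inc c ≫ y)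
    have h1 : y = b.decompN.prj c ≫ (α • b.projThin isPreord_leSink ht hc) := by
      refine b.decompN.hom_ext fun c' => ?_
      by_cases h : c' = c
      · subst h
        rw [hα, b.decompN.inc_prj_self_assoc]
      · rw [b.decompN.inc_prj_ne_assoc _ _ h, zero_comp]
        exact b.hom_thin_eq_zero isPreord_leSink ht (hc' _ h) _
    rw [h1, ← Category.assoc, dN_prj, Linear.comp_smul, hu] at hy
    rw [h1, (smul_eq_zero.1 hy).resolve_right (b.projThin_ne_zero isPreord_leSink ht h2), zero_smul, comp_zero]
  · obtain ⟨α, rfl⟩ := b.projThin_span isPreord_leSink ht h2 x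
    exact ⟨b.decompN.prj c ≫ (α • b.projThin isPreord_leSink ht hc), by
      rw [← Category.assoc, dN_prj, Linear.comp_smul, hu]⟩

theorem isOrth_cplxSink : ∀ o (t : Finset (Fin 3)) (ht : IsConvex leSink t), SinkOrth o t →
    IsOrth (toHo (st (b.thin isPreord_leSink ht))) (toHo (b.cplxSink o))
  | none, t, ht, ⟨h2, h⟩ => by
    by_cases h0 : 0 ∈ t
    · exact b.isOrth_dN ht h2 (c := 0) h0 fun c' hc' => by
        obtain rfl : c' = 1 := by omega
        exact h.1 h0
    · exact b.isOrth_dN ht h2 (c := 1) (by_contra fun h1 => h0 (h.2 h1)) fun c' hc' => by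
        obtain rfl : c' = 0 := by omega
        exact h0
  | some i, _, ht, h => b.isOrth_cplx ht (indecSink_table.1 i) h

/-- The exceptional complex is no retract of a complex in degree 0, since its term P 2 in degree -1
is nonzero. -/
theorem exists_retract_cplxSink {Y X : RightMod A} [Projective X] (d : Y ⟶ X) [Epi d] :
    ∀ i, Retract (b.cplxSink i) (st (kernel d)) → ∃ i, Nonempty (Retract (b.cplxSink i) (tw d))
  | none, r => by
    obtain ⟨⟨r₁⟩, -⟩ := exists_retract_of_tw r
    exact (b.id_P_ne_zero isPreord_leSink.refl 2 ((isZero_of_retract r₁ (isZero_zero _)).eq_of_src _ _)).elim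
  | some i, r => by
    obtain ⟨i', hi'⟩ := b.exists_retract_of_retract_st isPreord_leSink.refl indecSink (by decide) (by decide) d i r
    exact ⟨some i', hi'⟩

theorem exists_algEquiv_of_isSilted_sinkA3 {K : Type u} [Field K] {B : Type v} [Ring B] [Algebra K B]
    (h : IsSilted K (RelQuiver sinkA3) B) : ∃ k : Fin 6, Nonempty (B ≃ₐ[K] listSink K k) := by
  obtain ⟨P, hP, hP', hP'', ⟨f⟩⟩ := h
  let b : RelBasis K leSink (PathAlgebra K (RelQuiver sinkA3)) := isReach_sinkA3.relBasis K
  have hR := isPreord_leSink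
  obtain ⟨κ, _, a, ⟨D⟩⟩ := b.exists_decomp b.cplxSink
    (fun i h => b.not_isZero_cplxSink i ((qHo _).map_isZero h)) b.exists_retract_sink
    b.exists_retract_cplxSink hP.perfect hP'
  obtain ⟨ht₁, ht₂, ht₃⟩ := indecSink_table
  obtain ⟨k, -, ⟨g⟩⟩ := b.exists_algEquiv_of_isSilting hR (fun i => toHo (b.cplxSink i))
    (good := fun _ => True) b.not_isZero_cplxSink b.sinkCompat b.isOrth_cplxSink
    (fun s hs => (orth_or_exists_clusterSink s hs).imp id fun h => by
      obtain ⟨n, hn⟩ | ⟨n, hn⟩ := h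
      · obtain ⟨h₂, h₃⟩ := clusterSink_table n
        exact ⟨_, _, trivial, (Option.some_injective _).comp h₂, hn,
          ⟨((b.homTableCplx hR _ ht₁ ht₂ ht₃).comap (clusterSink n).2).congr h₃⟩⟩
      · obtain ⟨h₂, h₃⟩ := clusterSide_table n
        refine ⟨(clusterSide n).1, _, trivial, h₂, hn, ?_⟩
        simp_rw [toHo_cplxSink_map]
        exact ⟨(b.homTableSide.comap (clusterSide n).2).congr h₃⟩)
    hP hP'' a D
  exact ⟨k, ⟨f.trans g⟩⟩

end RelBasis

end Silted

theorem mainTheorem4 (K : Type u) [Field K] [IsAlgClosed K] :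
    ((∀ i j, i ≠ j → IsEmpty (Silted.listLinear K i ≃ₐ[K] Silted.listLinear K j)) ∧
      (∀ (B : Type v) [Ring B] [Algebra K B],
        Silted.IsSilted K (Silted.RelQuiver Silted.linearA3) B ↔ ∃ i, Nonempty (B ≃ₐ[K] Silted.listLinear K i)) ∧
      (∀ i, Silted.IsTiltedOfGraph K Silted.graphA3 (Silted.listLinear K i) ↔ i < 4) ∧
      (∀ i, Silted.IsTiltedOfGraph K Silted.graphA2A1 (Silted.listLinear K i) ↔ i = 4)) ∧
    ((∀ i j, i ≠ j → IsEmpty (Silted.listSink K i ≃ₐ[K] Silted.listSink K j)) ∧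
      (∀ (B : Type v) [Ring B] [Algebra K B],
        Silted.IsSilted K (Silted.RelQuiver Silted.sinkA3) B ↔ ∃ i, Nonempty (B ≃ₐ[K] Silted.listSink K i)) ∧
      (∀ i, Silted.IsTiltedOfGraph K Silted.graphA3 (Silted.listSink K i) ↔ i < 4) ∧
      (∀ i, Silted.IsTiltedOfGraph K Silted.graphA2A1 (Silted.listSink K i) ↔ i = 4) ∧
      (∀ i, Silted.IsTiltedOfGraph K Silted.graphA1A1A1 (Silted.listSink K i) ↔ i = 5)) := by
  have h4 (i : Fin 5) : i.castSucc < (4 : Fin 6) ↔ i < 4 := by revert i; decide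
  have h4' (i : Fin 5) : i.castSucc = (4 : Fin 6) ↔ i = 4 := by revert i; decide
  refine ⟨⟨fun i j hij => ?_, fun B _ _ => ?_, fun i => ?_, fun i => ?_⟩,
    fun i j => Silted.isEmpty_listSink_algEquiv K, fun B _ _ => ?_,
    fun i => ⟨Silted.lt_four_of_isTiltedOfGraph_graphA3, Silted.isTiltedOfGraph_graphA3 K⟩,
    fun i => ⟨Silted.eq_four_of_isTiltedOfGraph_graphA2A1, ?_⟩,
    fun i => ⟨Silted.eq_five_of_isTiltedOfGraph_graphA1A1A1, ?_⟩⟩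
  · rw [Silted.listLinear_eq, Silted.listLinear_eq]
    exact Silted.isEmpty_listSink_algEquiv K fun h => hij (Fin.castSucc_injective _ h)
  · refine Iff.trans ⟨Silted.RelBasis.exists_algEquiv_of_isSilted_linearA3,
      fun ⟨k, ⟨f⟩⟩ => Silted.RelBasis.isSilted_linearA3 K k f⟩ (exists_congr fun k => ?_)
    rw [Silted.listLinear_eq]
  · rw [Silted.listLinear_eq, ← h4]
    exact ⟨Silted.lt_four_of_isTiltedOfGraph_graphA3, Silted.isTiltedOfGraph_graphA3 K⟩
  · rw [Silted.listLinear_eq, ← h4']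
    exact ⟨Silted.eq_four_of_isTiltedOfGraph_graphA2A1,
      fun h => h ▸ Silted.isTiltedOfGraph_graphA2A1 K⟩
  · exact ⟨Silted.RelBasis.exists_algEquiv_of_isSilted_sinkA3,
      fun ⟨k, ⟨f⟩⟩ => Silted.RelBasis.isSilted_sinkA3 K k f⟩
  · rintro rfl; exact Silted.isTiltedOfGraph_graphA2A1 K
  · rintro rfl; exact Silted.isTiltedOfGraph_graphA1A1A1 K
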